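/- Let $n\ge 2$, let $a_1,a_2,a_3,a_4\in\mathbb{C}$ be pairwise distinct, and put $H_4(z)=(z-a_1)(z-a_2)(z-a_3)(z-a_4)$. Let $T_n$ be a complex polynomial of degree $n$ and $U_{n-2}$ a complex polynomial of degree $n-2$ such that $$T_n(z)^2-1=H_4(z)\,U_{n-2}(z)^2,\qquad T_n'(z)=n\,(z-z^*)\,U_{n-2}(z)$$ for some $z^*\in\mathbb{C}$, and let $T_n^{-1}([-1,1])=\{z\in\mathbb{C}:T_n(z)\in[-1,1]\}$. An analytic Jordan arc is a set $\gamma([0,1])$, where $\gamma$ is real-analytic on an open interval containing $[0,1]$ with values in $\mathbb{C}$, injective on $[0,1]$, and $\gamma'(t)\ne0$ for all $t\in[0,1]$; its endpoints are $\gamma(0)$ and $\gamma(1)$. A set $S\subset\mathbb{C}$ is said to consist of $\nu$ analytic Jordan arcs if it is the union of $\nu$ analytic Jordan arcs any two of which have at most one point in common, and if it is not the union of fewer than $\nu$ analytic Jordan arcs. (a) If $z^*\notin\{a_1,a_2,a_3,a_4\}$, then $T_n^{-1}([-1,1])$ consists of two analytic Jordan arcs. (b) If $z^*\in\{a_1,a_2,a_3,a_4\}$,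 then $T_n^{-1}([-1,1])$ consists of three analytic Jordan arcs, each of which has $z^*$ as an endpoint, and any two of which form an angle of $2\pi/3$ at $z^*$ (the angle between the tangent vectors at $z^*$ pointing into the arcs). -/

import Mathlib

open Polynomial

/-- The inverse image `T⁻¹([-1,1]) = {z ∈ ℂ : T(z) ∈ [-1,1]}` of a complex polynomial. -/
def inverseImageSegment (T : ℂ[X]) : Set ℂ :=
  {z : ℂ | ∃ x ∈ Set.Icc (-1 : ℝ) 1, T.eval z = (x : ℂ)}

/-- `γ` restricted to `[0,1]` parametrizes an analytic Jordan arc: it is real-analytic at each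
point of `[0,1]` (in a full neighbourhood, also at the endpoints), injective on `[0,1]`, and
regular. The values of `γ` away from `[0,1]` are irrelevant. -/
structure IsAnalyticJordanArc (γ : ℝ → ℂ) : Prop where
  analytic : AnalyticOnNhd ℝ γ (Set.Icc 0 1)
  injOn : Set.InjOn γ (Set.Icc 0 1)
  regular : ∀ t ∈ Set.Icc (0 : ℝ) 1, deriv γ t ≠ 0

/-- The set of points of the arc parametrized by `γ`. -/
def arcSet (γ : ℝ → ℂ) : Set ℂ := γ '' Set.Icc 0 1

/-- `S` is the union of the `ν` analytic Jordan arcs given by the family `γ`. -/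
def IsUnionOfArcs {ν : ℕ} (S : Set ℂ) (γ : Fin ν → ℝ → ℂ) : Prop :=
  (∀ i, IsAnalyticJordanArc (γ i)) ∧ ⋃ i, arcSet (γ i) = S

/-- `S` consists of the `ν` analytic Jordan arcs given by the family `γ`: it is their union, any two
of them have at most one point in common, and `S` is not the union of fewer than `ν` analytic
Jordan arcs (however these may overlap). -/
structure ConsistsOfArcs {ν : ℕ} (S : Set ℂ) (γ : Fin ν → ℝ → ℂ) : Prop where
  isUnion : IsUnionOfArcs S γ
  inter : ∀ i j, i ≠ j → (arcSet (γ i) ∩ arcSet (γ j)).Subsingleton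
  minimal : ∀ μ < ν, ¬ ∃ δ : Fin μ → ℝ → ℂ, IsUnionOfArcs S δ

/-! The set is a graph. Since `T' = n (z - z*) U` and `T² = 1` at the zeros of `U`, the only
possible critical value of `T` in `(-1, 1)` is `T(z*)`. Cut `[-1, 1]` at that value `τ` (or at `0`).
Over each of the two open segments `T` is an unbranched covering, so the inverse image is a finite
union of edges, the lifts of `[-1, τ]` and `[τ, 1]`. At a vertex `u` where `T` has order `k` there
is a coordinate `ψ` with `T = T(u) + ψ ^ k`, and edges leave `u` along rays whose directions `ω`
satisfy `ω ^ k = ±1` (`exists_flag`, `flag_ext`). A pair (edge, end) is called a flag.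

If `ω` is a direction at `u`, so is `-ω`, unless `T(u) = ±1` and `k` is odd; such `u` are called
terminal. At a nonterminal vertex an edge is therefore continued by the opposite edge, and the two
together are analytic (`IsUnitArc.glue`). The graph is a forest (`chain_eq_zero`): a chain without
boundary is killed by integrating `g(T) T' Q` along it, Weierstrass approximation passes from the
integrals to the integrand, and interpolation isolates each coefficient. So a path that always goes
straight never returns to itself, ends at terminal points, and meets another such path at most once.
Splitting the graph into these paths gives half as many arcs as there are terminal flags
(`exists_decomposition`).

Fewer arcs are impossible: an analytic arc passing straight through a terminal point would leave the
set, because an odd power changes sign and pushes `T` beyond `±1`. Hence in any representation each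
terminal flag uses up one end of an arc (`exists_arc_end`).

Comparing multiplicities in Pell's equation and in the formula for `T'` shows that the terminal
points are exactly the `a j`, of order 1, or of order 3 if equal to `z*` (`powerOrder_of_pell`).
This gives 4 or 6 terminal flags, that is 2 or 3 arcs. In the second case the three directions at
`z*` are cube roots of one number, whence the angle. -/

section

open Set Filter Topology

/-! ### Analytic preliminaries: primitives and power coordinates -/

/-- A primitive of a real-analytic function is real-analytic, in germ form. -/
theorem AnalyticAt.exists_primitive {v : ℝ → ℝ} {t : ℝ} (hv : AnalyticAt ℝ v t) :
    ∃ F : ℝ → ℝ, AnalyticAt ℝ F t ∧ ∀ᶠ s in 𝓝 t, HasDerivAt F (v s) s := by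
  obtain ⟨p, hp⟩ := hv
  -- The power series with the same coefficients over `ℂ` has the same radius; its primitive on a
  -- complex disc is restricted to the real line.
  set c : ℕ → ℂ := fun n => (p.coeff n : ℂ)
  set q := FormalMultilinearSeries.ofScalars ℂ c
  have hnorm : ∀ n, ‖q n‖ = ‖p n‖ := fun n => by
    simp [q, c]
  have hq : 0 < q.radius := by
    have h0 := hp.radius_pos
    have : q.radius = p.radius := by simp only [FormalMultilinearSeries.radius, hnorm]
    rwa [this]
  have hG := q.hasFPowerSeriesOnBall hq
  obtain ⟨R, hR, hRball⟩ : ∃ R : ℝ, 0 < R ∧ Metric.ball (0 : ℂ) R ⊆ Metric.eball 0 q.radius := by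
    obtain ⟨R, hR, h⟩ := Metric.mem_nhds_iff.1 (Metric.eball_mem_nhds (0 : ℂ) hq)
    exact ⟨R, hR, h⟩
  have hGd : DifferentiableOn ℂ q.sum (Metric.ball 0 R) :=
    hG.differentiableOn.mono hRball
  obtain ⟨F, hF⟩ := hGd.isExactOn_ball
  have hFa : AnalyticAt ℂ F 0 := by
    have : DifferentiableOn ℂ F (Metric.ball 0 R) := fun z hz =>
      (hF z hz).differentiableAt.differentiableWithinAt
    exact this.analyticAt (Metric.ball_mem_nhds _ hR)
  have hin : AnalyticAt ℝ (fun s : ℝ => ((s - t : ℝ) : ℂ)) t := by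
    exact (Complex.ofRealCLM.analyticAt _).comp
      (analyticAt_id.sub (analyticAt_const (v := t)))
  refine ⟨fun s => (F ((s - t : ℝ) : ℂ)).re, ?_, ?_⟩
  · have h1 : AnalyticAt ℝ (fun s : ℝ => F ((s - t : ℝ) : ℂ)) t := by
      refine AnalyticAt.fun_comp (g := F) ?_ hin
      simpa using hFa.restrictScalars
    exact (Complex.reCLM.analyticAt _).comp h1
  · rw [hasFPowerSeriesAt_iff'] at hp
    have hnear : ∀ᶠ s in 𝓝 t, ((s - t : ℝ) : ℂ) ∈ Metric.ball (0 : ℂ) R :=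
      hin.continuousAt.eventually_mem (by simpa using Metric.ball_mem_nhds (0 : ℂ) hR)
    filter_upwards [hp, hnear] with s hs hs'
    have h1 := hF _ hs'
    have h2 : HasDerivAt (fun s : ℝ => F ((s - t : ℝ) : ℂ)) (q.sum ((s - t : ℝ) : ℂ)) s := by
      have h3 : HasDerivAt (fun s : ℝ => ((s - t : ℝ) : ℂ)) 1 s := by
        simpa using (((hasDerivAt_id s).sub_const t).ofReal_comp)
      simpa [Function.comp_def] using HasDerivAt.scomp (𝕜 := ℝ) (𝕜' := ℂ) s h1 h3
    have h4 : q.sum ((s - t : ℝ) : ℂ) = (v s : ℂ) := by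
      have h5 := hG.hasSum (hRball hs')
      rw [zero_add] at h5
      have h6 : HasSum (fun n => (((s - t) ^ n • p.coeff n : ℝ) : ℂ)) (v s : ℂ) :=
        Complex.hasSum_ofReal.2 hs
      refine h5.unique ?_
      have h7 : (fun n => q n fun _ => ((s - t : ℝ) : ℂ)) =
          fun n => (((s - t) ^ n • p.coeff n : ℝ) : ℂ) := by
        funext n
        rw [FormalMultilinearSeries.ofScalars_apply_eq]
        push_cast [smul_eq_mul]
        rw [mul_comm]
      rwa [h7]
    rw [h4] at h2
    have h8 := Complex.reCLM.hasFDerivAt.comp_hasDerivAt s h2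
    simpa [Function.comp_def] using h8

/-- A local coordinate at `u` in which the polynomial `T` is a pure power. -/
theorem exists_powerChart {T : ℂ[X]} (hT : 0 < T.natDegree) (u : ℂ) :
    ∃ ρ ψ : ℂ → ℂ, AnalyticAt ℂ ρ 0 ∧ AnalyticAt ℂ ψ u ∧ ρ 0 = u ∧ ψ u = 0 ∧
      deriv ρ 0 ≠ 0 ∧ deriv ψ u ≠ 0 ∧ (∀ᶠ w in 𝓝 0, ψ (ρ w) = w) ∧ (∀ᶠ z in 𝓝 u, ρ (ψ z) = z) ∧
      ∀ z, T.eval z = T.eval u + ψ z ^ (T - C (T.eval u)).rootMultiplicity u := by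
  set k := (T - C (T.eval u)).rootMultiplicity u with hk
  have hne : T - C (T.eval u) ≠ 0 := by
    intro h
    rw [sub_eq_zero] at h
    rw [h] at hT
    simp at hT
  have hkpos : 0 < k := (rootMultiplicity_pos hne).2 (by simp)
  obtain ⟨q, hq, hqu⟩ := exists_eq_pow_rootMultiplicity_mul_and_not_dvd _ hne u
  rw [dvd_iff_isRoot, IsRoot.def] at hqu
  obtain ⟨c, hc⟩ := IsAlgClosed.exists_pow_nat_eq (q.eval u) hkpos
  have hc0 : c ≠ 0 := by
    rintro rfl
    exact hqu (by rw [← hc, zero_pow hkpos.ne'])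
  -- Dividing by `q.eval u` moves the base of the power to `1` at `u`, inside the slit plane, so
  -- this root of `q` is analytic there. Its `k`-th power equals `q` everywhere, also where the
  -- branch jumps.
  set g : ℂ → ℂ := fun z => c * (q.eval z / q.eval u) ^ (1 / k : ℂ)
  have hg : AnalyticAt ℂ g u := by
    refine analyticAt_const.mul (AnalyticAt.cpow ?_ analyticAt_const ?_)
    · exact (Polynomial.differentiable q).analyticAt u |>.div_const
    · rw [div_self hqu]; exact Complex.one_mem_slitPlane
  have hgk : ∀ z, g z ^ k = q.eval z := fun z => by
    simp only [g, mul_pow, hc]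
    rw [one_div, Complex.cpow_nat_inv_pow _ hkpos.ne', mul_div_cancel₀ _ hqu]
  have hgu : g u = c := by simp [g, div_self hqu]
  set ψ : ℂ → ℂ := fun z => (z - u) * g z
  have hψ : AnalyticAt ℂ ψ u := (analyticAt_id.sub analyticAt_const).mul hg
  have hψd : deriv ψ u = c := by
    have := ((hasDerivAt_id u).sub_const u).mul hg.differentiableAt.hasDerivAt
    rw [show ψ = (fun x => x - u) * g from rfl]
    simpa [hgu] using this.deriv
  have hψ0 : ψ u = 0 := by simp [ψ]
  have hd : deriv ψ u ≠ 0 := by rwa [hψd]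
  have hs := hψ.hasStrictDerivAt
  refine ⟨hs.localInverse _ _ _ hd, ψ, ?_, hψ, ?_, hψ0, ?_, hd, ?_, ?_, ?_⟩
  · simpa [hψ0] using hψ.analyticAt_localInverse hd
  · have := HasStrictFDerivAt.localInverse_apply_image (hs.hasStrictFDerivAt_equiv hd)
    simpa [hψ0] using this
  · have := (hs.to_localInverse hd).hasDerivAt.deriv
    rw [hψ0] at this
    rw [this]
    exact inv_ne_zero hd
  · have := hs.eventually_right_inverse hd
    rwa [hψ0] at this
  · exact hs.eventually_left_inverse hd
  · intro z
    have := congrArg (eval z) hq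
    simp only [eval_sub, eval_C, eval_mul, eval_pow, eval_X] at this
    rw [mul_pow, hgk, ← this]
    ring

theorem eventually_const_of_hasDerivAt_zero {f : ℝ → ℝ} {t : ℝ}
    (h : ∀ᶠ s in 𝓝 t, HasDerivAt f 0 s) : ∀ᶠ s in 𝓝 t, f s = f t := by
  obtain ⟨r, hr, hb⟩ := Metric.eventually_nhds_iff_ball.1 h
  filter_upwards [Metric.ball_mem_nhds t hr] with s hs
  refine (convex_ball t r).is_const_of_fderivWithin_eq_zero (𝕜 := ℝ)
    (fun x hx => (hb x hx).differentiableAt.differentiableWithinAt) (fun x hx => ?_) hs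
    (Metric.mem_ball_self hr)
  rw [fderivWithin_of_isOpen Metric.isOpen_ball hx]
  ext
  simpa using (hb x hx).deriv

/-- The difference from an analytic primitive of `v` is locally constant. This is needed for the arc
length. -/
theorem AnalyticAt.of_hasDerivAt {f v : ℝ → ℝ} {t : ℝ} (hv : AnalyticAt ℝ v t)
    (hf : ∀ᶠ s in 𝓝 t, HasDerivAt f (v s) s) : AnalyticAt ℝ f t := by
  obtain ⟨F, hF, hFd⟩ := hv.exists_primitive
  have h : ∀ᶠ s in 𝓝 t, HasDerivAt (fun s => f s - F s) 0 s := by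
    filter_upwards [hf, hFd] with s h1 h2
    simpa using h1.fun_sub h2
  refine (hF.add (analyticAt_const (v := f t - F t))).congr ?_
  filter_upwards [eventually_const_of_hasDerivAt_zero h] with s hs
  simp only [Pi.add_apply]
  linarith

theorem AnalyticAt.norm_complex {f : ℝ → ℂ} {t : ℝ} (hf : AnalyticAt ℝ f t) (h : f t ≠ 0) :
    AnalyticAt ℝ (fun s => ‖f s‖) t := by
  have h1 : ContDiffAt ℝ ⊤ (fun w : ℂ => ‖w‖) (f t) := contDiffAt_norm ℝ h
  have h2 : AnalyticAt ℝ (fun w : ℂ => ‖w‖) (f t) := by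
    exact ContDiffAt.analyticAt h1
  exact AnalyticAt.fun_comp (g := fun w : ℂ => ‖w‖) h2 hf

/-! ### Unit-speed arcs -/

/-- An injective real-analytic curve on `[0, L]` of constant speed one. -/
structure IsUnitArc (c : ℝ → ℂ) (L : ℝ) : Prop where
  pos : 0 < L
  analytic : AnalyticOnNhd ℝ c (Icc 0 L)
  injOn : InjOn c (Icc 0 L)
  unit : ∀ t ∈ Icc 0 L, ‖deriv c t‖ = 1

theorem IsUnitArc.deriv_scale {c : ℝ → ℂ} {L : ℝ} (h : IsUnitArc c L) {t : ℝ}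
    (ht : t ∈ Icc (0 : ℝ) 1) : HasDerivAt (fun t => c (L * t)) (L • deriv c (L * t)) t := by
  have hm : L * t ∈ Icc 0 L :=
    ⟨mul_nonneg h.pos.le ht.1, mul_le_of_le_one_right h.pos.le ht.2⟩
  have h1 := (h.analytic _ hm).differentiableAt.hasDerivAt
  have h2 : HasDerivAt (fun t : ℝ => L * t) L t := by simpa using (hasDerivAt_id t).const_mul L
  exact HasDerivAt.scomp t h1 h2

theorem IsUnitArc.isAnalyticJordanArc {c : ℝ → ℂ} {L : ℝ} (h : IsUnitArc c L) :
    IsAnalyticJordanArc fun t => c (L * t) := by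
  have hm : ∀ t ∈ Icc (0 : ℝ) 1, L * t ∈ Icc 0 L := fun t ht =>
    ⟨mul_nonneg h.pos.le ht.1, mul_le_of_le_one_right h.pos.le ht.2⟩
  refine ⟨fun t ht => ?_, fun s hs t ht hst => ?_, fun t ht => ?_⟩
  · exact AnalyticAt.fun_comp (h.analytic _ (hm t ht)) (analyticAt_const.mul analyticAt_id)
  · exact mul_left_cancel₀ h.pos.ne' (h.injOn (hm s hs) (hm t ht) hst)
  · rw [(h.deriv_scale ht).deriv]
    refine smul_ne_zero h.pos.ne' fun h0 => ?_
    have := h.unit _ (hm t ht)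
    simp [h0] at this

theorem IsUnitArc.arcSet_scale {c : ℝ → ℂ} {L : ℝ} (h : IsUnitArc c L) :
    arcSet (fun t => c (L * t)) = c '' Icc 0 L := by
  have : (fun t => L * t) '' Icc (0 : ℝ) 1 = Icc 0 L := by
    rw [image_mul_left_Icc h.pos.le zero_le_one]
    simp
  rw [arcSet, ← this, image_image]

/-- The reversed curve. -/
theorem IsUnitArc.reverse {c : ℝ → ℂ} {L : ℝ} (h : IsUnitArc c L) :
    IsUnitArc (fun t => c (L - t)) L := by
  have hm : ∀ t ∈ Icc (0 : ℝ) L, L - t ∈ Icc 0 L := fun t ht =>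
    ⟨sub_nonneg.2 ht.2, sub_le_self _ ht.1⟩
  refine ⟨h.pos, fun t ht => ?_, fun s hs t ht hst => ?_, fun t ht => ?_⟩
  · exact AnalyticAt.fun_comp (h.analytic _ (hm t ht)) (analyticAt_const.sub analyticAt_id)
  · have := h.injOn (hm s hs) (hm t ht) hst
    linarith
  · rw [deriv_comp_const_sub, norm_neg]
    exact h.unit _ (hm t ht)

theorem image_reverse_Icc (c : ℝ → ℂ) (L : ℝ) :
    (fun t => c (L - t)) '' Icc 0 L = c '' Icc 0 L := by
  have : (fun t => L - t) '' Icc (0 : ℝ) L = Icc 0 L := by simp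
  conv_rhs => rw [← this, image_image]

/-- Parametrization by arc length: the speed is analytic because `γ'` does not vanish, hence so are
the arc length and its inverse. Unit speed leaves no freedom of parametrization, which is what later
makes glued arcs analytic. -/
theorem IsAnalyticJordanArc.exists_isUnitArc {γ : ℝ → ℂ} (h : IsAnalyticJordanArc γ) :
    ∃ (c : ℝ → ℂ) (L : ℝ), IsUnitArc c L ∧ c 0 = γ 0 ∧ c L = γ 1 ∧ c '' Icc 0 L = arcSet γ := by
  set v : ℝ → ℝ := fun t => ‖deriv γ t‖
  have hO : ∀ t ∈ Icc (0 : ℝ) 1, ∀ᶠ s in 𝓝 t, AnalyticAt ℝ γ s ∧ deriv γ s ≠ 0 := fun t ht =>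
    ((h.analytic t ht).eventually_analyticAt).and
      ((h.analytic t ht).deriv.continuousAt.eventually_ne (h.regular t ht))
  -- A margin beyond `[0, 1]`, so that the inverse of the arc length is analytic in full
  -- neighbourhoods of its end parameters.
  obtain ⟨ε, hε, hI⟩ : ∃ ε > 0, ∀ s ∈ Ioo (-ε) (1 + ε), AnalyticAt ℝ γ s ∧ deriv γ s ≠ 0 := by
    obtain ⟨e0, he0, h0⟩ := Metric.eventually_nhds_iff_ball.1 (hO 0 (by simp))
    obtain ⟨e1, he1, h1⟩ := Metric.eventually_nhds_iff_ball.1 (hO 1 (by simp))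
    refine ⟨min e0 e1, lt_min he0 he1, fun s hs => ?_⟩
    have m0 := min_le_left e0 e1
    have m1 := min_le_right e0 e1
    rcases lt_or_ge s 0 with h2 | h2
    · exact h0 s (by rw [Real.ball_eq_Ioo]; constructor <;> linarith [hs.1])
    rcases le_or_gt s 1 with h3 | h3
    · exact (hO s ⟨h2, h3⟩).self_of_nhds
    · exact h1 s (by rw [Real.ball_eq_Ioo]; constructor <;> linarith [hs.2])
  set I := Ioo (-ε) (1 + ε)
  have h0I : (0 : ℝ) ∈ I := ⟨by linarith, by linarith⟩
  have hsub : Icc (0 : ℝ) 1 ⊆ I := fun t ht => ⟨by linarith [ht.1], by linarith [ht.2]⟩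
  have hva : ∀ t ∈ I, AnalyticAt ℝ v t := fun t ht => (hI t ht).1.deriv.norm_complex (hI t ht).2
  have hvpos : ∀ t ∈ I, 0 < v t := fun t ht => norm_pos_iff.2 (hI t ht).2
  have hvc : ContinuousOn v I := fun t ht => (hva t ht).continuousAt.continuousWithinAt
  set ℓ : ℝ → ℝ := fun t => ∫ x in (0 : ℝ)..t, v x
  have hℓd : ∀ t ∈ I, HasDerivAt ℓ (v t) t := fun t ht => by
    refine intervalIntegral.integral_hasDerivAt_right ?_
      (hvc.stronglyMeasurableAtFilter isOpen_Ioo t ht) (hva t ht).continuousAt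
    exact (hvc.mono (ordConnected_Ioo.uIcc_subset h0I ht)).intervalIntegrable
  have hℓa : ∀ t ∈ I, AnalyticAt ℝ ℓ t := fun t ht =>
    (hva t ht).of_hasDerivAt ((isOpen_Ioo.eventually_mem ht).mono fun s hs => hℓd s hs)
  have hmono : StrictMonoOn ℓ I := by
    refine strictMonoOn_of_deriv_pos (convex_Ioo _ _)
      (fun t ht => (hℓa t ht).continuousAt.continuousWithinAt) fun t ht => ?_
    rw [interior_Ioo] at ht
    rw [(hℓd t ht).deriv]
    exact hvpos t ht
  have hℓ0 : ℓ 0 = 0 := by simp [ℓ]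
  have h1I : (1 : ℝ) ∈ I := hsub (by simp)
  have hL : 0 < ℓ 1 := by rw [← hℓ0]; exact hmono h0I h1I one_pos
  set s := Function.invFunOn ℓ I
  have hs : ∀ t ∈ I, s (ℓ t) = t := fun t ht => hmono.injOn.leftInvOn_invFunOn ht
  have hsurj : ∀ τ ∈ Icc 0 (ℓ 1), ∃ t ∈ Icc (0 : ℝ) 1, ℓ t = τ := fun τ hτ => by
    refine intermediate_value_Icc (f := ℓ) zero_le_one
      (fun t ht => (hℓa t (hsub ht)).continuousAt.continuousWithinAt) ?_
    rwa [hℓ0]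
  have hrange : ∀ t ∈ Icc (0 : ℝ) 1, ℓ t ∈ Icc 0 (ℓ 1) := fun t ht => by
    refine ⟨?_, hmono.monotoneOn (hsub ht) h1I ht.2⟩
    rw [← hℓ0]
    exact hmono.monotoneOn h0I (hsub ht) ht.1
  have hsa : ∀ t ∈ I, AnalyticAt ℝ s (ℓ t) ∧ HasDerivAt s (v t)⁻¹ (ℓ t) := fun t ht => by
    have hst := (hℓa t ht).hasStrictDerivAt
    have hne : deriv ℓ t ≠ 0 := by rw [(hℓd t ht).deriv]; exact (hvpos t ht).ne'
    have hinv := (hℓa t ht).analyticAt_localInverse hne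
    have hval : hst.localInverse _ _ _ hne (ℓ t) = t :=
      HasStrictFDerivAt.localInverse_apply_image (hst.hasStrictFDerivAt_equiv hne)
    -- Both inverses agree near `ℓ t`, since the local one takes values in `I`, where `ℓ` is
    -- injective.
    have heq : hst.localInverse _ _ _ hne =ᶠ[𝓝 (ℓ t)] s := by
      have h3 : ∀ᶠ τ in 𝓝 (ℓ t), hst.localInverse _ _ _ hne τ ∈ I :=
        hinv.continuousAt.eventually_mem (by rw [hval]; exact isOpen_Ioo.mem_nhds ht)
      filter_upwards [hst.eventually_right_inverse hne, h3] with τ h4 h5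
      rw [← hs _ h5, h4]
    refine ⟨hinv.congr heq, ?_⟩
    have h6 := (hst.to_localInverse hne).hasDerivAt.congr_of_eventuallyEq heq.symm
    rwa [(hℓd t ht).deriv] at h6
  refine ⟨fun τ => γ (s τ), ℓ 1, ⟨hL, ?_, ?_, ?_⟩, ?_, ?_, ?_⟩
  · intro τ hτ
    obtain ⟨t, ht, rfl⟩ := hsurj τ hτ
    refine AnalyticAt.fun_comp ?_ (hsa t (hsub ht)).1
    rw [hs t (hsub ht)]
    exact h.analytic t ht
  · intro τ hτ τ' hτ' heq
    obtain ⟨t, ht, rfl⟩ := hsurj τ hτ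
    obtain ⟨t', ht', rfl⟩ := hsurj τ' hτ'
    simp only [hs t (hsub ht), hs t' (hsub ht')] at heq
    rw [h.injOn ht ht' heq]
  · intro τ hτ
    obtain ⟨t, ht, rfl⟩ := hsurj τ hτ
    have h1 : HasDerivAt γ (deriv γ t) (s (ℓ t)) := by
      rw [hs t (hsub ht)]
      exact (h.analytic t ht).differentiableAt.hasDerivAt
    have h2 := HasDerivAt.scomp (ℓ t) h1 (hsa t (hsub ht)).2
    rw [show (fun τ => γ (s τ)) = γ ∘ s from rfl, h2.deriv, norm_smul, norm_inv, Real.norm_eq_abs,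
      abs_of_pos (hvpos t (hsub ht))]
    exact inv_mul_cancel₀ (hvpos t (hsub ht)).ne'
  · show γ (s 0) = γ 0
    have hs0 := hs 0 h0I
    rw [hℓ0] at hs0
    rw [hs0]
  · simp only [hs 1 h1I]
  · ext z
    simp only [arcSet, mem_image]
    constructor
    · rintro ⟨τ, hτ, rfl⟩
      obtain ⟨t, ht, rfl⟩ := hsurj τ hτ
      exact ⟨t, ht, by rw [hs t (hsub ht)]⟩
    · rintro ⟨t, ht, rfl⟩
      exact ⟨ℓ t, hrange t ht, by rw [hs t (hsub ht)]⟩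

/-! ### Gluing arcs that leave a point in opposite directions -/

theorem AnalyticAt.eventually_eq_of_frequently_left {E : Type*} [NormedAddCommGroup E]
    [NormedSpace ℝ E] {f g : ℝ → E} {t : ℝ} (hf : AnalyticAt ℝ f t) (hg : AnalyticAt ℝ g t)
    (h : ∀ᶠ s in 𝓝[≤] t, f s = g s) : f =ᶠ[𝓝 t] g := by
  refine (hf.frequently_eq_iff_eventually_eq hg).1 ?_
  have h1 : ∀ᶠ s in 𝓝[<] t, f s = g s := h.filter_mono (nhdsWithin_mono _ Iio_subset_Iic_self)
  exact h1.frequently.filter_mono (nhdsWithin_mono _ fun _ hx => ne_of_lt hx)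

theorem AnalyticAt.eventually_eq_of_frequently_right {E : Type*} [NormedAddCommGroup E]
    [NormedSpace ℝ E] {f g : ℝ → E} {t : ℝ} (hf : AnalyticAt ℝ f t) (hg : AnalyticAt ℝ g t)
    (h : ∀ᶠ s in 𝓝[≥] t, f s = g s) : f =ᶠ[𝓝 t] g := by
  refine (hf.frequently_eq_iff_eventually_eq hg).1 ?_
  have h1 : ∀ᶠ s in 𝓝[>] t, f s = g s := h.filter_mono (nhdsWithin_mono _ Ioi_subset_Ici_self)
  exact h1.frequently.filter_mono (nhdsWithin_mono _ fun _ hx => ne_of_gt hx)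

theorem HasDerivAt.nonneg_of_right {a : ℝ → ℝ} {a' t : ℝ} (ha : HasDerivAt a a' t)
    (h : ∀ᶠ s in 𝓝[≥] t, a t ≤ a s) : 0 ≤ a' := by
  have h1 := (hasDerivWithinAt_iff_tendsto_slope' (s := Ioi t) (by simp)).1
    (ha.hasDerivWithinAt (s := Ioi t))
  refine ge_of_tendsto h1 ?_
  filter_upwards [h.filter_mono (nhdsWithin_mono _ Ioi_subset_Ici_self),
    self_mem_nhdsWithin] with s hs hst
  rw [slope_def_field]
  exact div_nonneg (sub_nonneg.2 hs) (sub_nonneg.2 (le_of_lt hst))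

/-- The coordinate along a ray of a regular analytic curve which stays on that ray to the right
of `0`. -/
theorem exists_real_coordinate {g : ℝ → ℂ} {ψ : ℂ → ℂ} {u ω : ℂ} (hg : AnalyticAt ℝ g 0)
    (hg0 : g 0 = u) (hψ : AnalyticAt ℂ ψ u) (hψ0 : ψ u = 0) (hψd : deriv ψ u ≠ 0) (hω : ω ≠ 0)
    (hgd : deriv g 0 ≠ 0) (hray : ∀ᶠ t in 𝓝[≥] (0 : ℝ), ∃ s : ℝ, 0 ≤ s ∧ ψ (g t) = ω * s) :
    ∃ a : ℝ → ℝ, AnalyticAt ℝ a 0 ∧ a 0 = 0 ∧ 0 < deriv a 0 ∧ (∀ᶠ t in 𝓝 0, ψ (g t) = ω * a t) ∧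
      deriv ψ u * deriv g 0 = ω * (deriv a 0 : ℝ) := by
  have hψ' : AnalyticAt ℂ ψ (g 0) := by rwa [hg0]
  have hA : AnalyticAt ℝ (fun t => ψ (g t) / ω) 0 := by
    have : AnalyticAt ℝ (fun t => ψ (g t)) 0 := AnalyticAt.fun_comp (g := ψ) hψ'.restrictScalars hg
    simp only [div_eq_mul_inv]
    exact this.mul analyticAt_const
  have hre : AnalyticAt ℝ (fun t => (ψ (g t) / ω).re) 0 := (Complex.reCLM.analyticAt _).comp hA
  have him : AnalyticAt ℝ (fun t => (ψ (g t) / ω).im) 0 := (Complex.imCLM.analyticAt _).comp hA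
  have hray' : ∀ᶠ t in 𝓝[≥] (0 : ℝ), ∃ s : ℝ, 0 ≤ s ∧ ψ (g t) / ω = s := by
    filter_upwards [hray] with t ⟨s, hs, h⟩
    exact ⟨s, hs, by rw [h, mul_div_cancel_left₀ _ hω]⟩
  -- By the identity theorem, lying on the ray for `t ≥ 0` forces the curve to stay on the whole
  -- line for `t < 0`.
  have him0 : (fun t => (ψ (g t) / ω).im) =ᶠ[𝓝 0] fun _ => 0 := by
    refine him.eventually_eq_of_frequently_right analyticAt_const ?_
    filter_upwards [hray'] with t ⟨s, _, h⟩
    simp [h]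
  have heq : ∀ᶠ t in 𝓝 (0 : ℝ), ψ (g t) = ω * ((ψ (g t) / ω).re : ℝ) := by
    filter_upwards [him0] with t ht
    have : ((ψ (g t) / ω).re : ℂ) = ψ (g t) / ω := Complex.ext (by simp) (by simpa using ht.symm)
    rw [this, mul_div_cancel₀ _ hω]
  have hd : deriv ψ u * deriv g 0 = ω * (deriv (fun t => (ψ (g t) / ω).re) 0 : ℝ) := by
    have h1 : HasDerivAt (fun t => ψ (g t)) (deriv g 0 • deriv ψ (g 0)) 0 :=
      HasDerivAt.scomp (𝕜 := ℝ) (𝕜' := ℂ) 0 hψ'.differentiableAt.hasDerivAt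
        hg.differentiableAt.hasDerivAt
    have h2 : HasDerivAt (fun t : ℝ => ω * (((ψ (g t) / ω).re : ℝ) : ℂ))
        (ω * (deriv (fun t => (ψ (g t) / ω).re) 0 : ℝ)) 0 :=
      (hre.differentiableAt.hasDerivAt.ofReal_comp).const_mul ω
    have h3 := (h2.congr_of_eventuallyEq heq).unique h1
    rw [h3, hg0, smul_eq_mul, mul_comm]
  refine ⟨_, hre, by simp [hg0, hψ0], ?_, heq, hd⟩
  have hnn : 0 ≤ deriv (fun t => (ψ (g t) / ω).re) 0 := by
    refine hre.differentiableAt.hasDerivAt.nonneg_of_right ?_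
    filter_upwards [hray'] with t ⟨s, hs, h⟩
    simpa [h, hg0, hψ0] using hs
  refine lt_of_le_of_ne hnn fun h0 => ?_
  rw [← h0] at hd
  simp [hψd, hgd] at hd

/-- Two unit-speed analytic curves which leave `u` along opposite rays of a local coordinate
continue each other. -/
theorem germ_eq_of_opposite_rays {g₁ g₂ : ℝ → ℂ} {ψ ρ : ℂ → ℂ} {u ω : ℂ}
    (hg₁ : AnalyticAt ℝ g₁ 0) (hg₂ : AnalyticAt ℝ g₂ 0) (h₁0 : g₁ 0 = u) (h₂0 : g₂ 0 = u)
    (hψ : AnalyticAt ℂ ψ u) (hψ0 : ψ u = 0) (hψd : deriv ψ u ≠ 0) (hω : ω ≠ 0)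
    (hρ : ∀ᶠ z in 𝓝 u, ρ (ψ z) = z)
    (hn₁ : ∀ᶠ t in 𝓝[≤] (0 : ℝ), ‖deriv g₁ t‖ = 1) (hn₂ : ∀ᶠ t in 𝓝[≥] (0 : ℝ), ‖deriv g₂ t‖ = 1)
    (hr₁ : ∀ᶠ t in 𝓝[≤] (0 : ℝ), ∃ s : ℝ, 0 ≤ s ∧ ψ (g₁ t) = -ω * s)
    (hr₂ : ∀ᶠ t in 𝓝[≥] (0 : ℝ), ∃ s : ℝ, 0 ≤ s ∧ ψ (g₂ t) = ω * s) :
    g₁ =ᶠ[𝓝 0] g₂ := by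
  have hne₁ : deriv g₁ 0 ≠ 0 := fun h => by
    simpa [h] using hn₁.self_of_nhdsWithin (by simp)
  have hne₂ : deriv g₂ 0 ≠ 0 := fun h => by
    simpa [h] using hn₂.self_of_nhdsWithin (by simp)
  have hN₁ : ∀ᶠ t in 𝓝 (0 : ℝ), ‖deriv g₁ t‖ = 1 :=
    (hg₁.deriv.norm_complex hne₁).eventually_eq_of_frequently_left analyticAt_const hn₁
  have hN₂ : ∀ᶠ t in 𝓝 (0 : ℝ), ‖deriv g₂ t‖ = 1 :=
    (hg₂.deriv.norm_complex hne₂).eventually_eq_of_frequently_right analyticAt_const hn₂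
  have hneg : Tendsto (fun t : ℝ => -t) (𝓝[≥] 0) (𝓝[≤] 0) := by
    have := tendsto_neg_nhdsGE (a := (0 : ℝ))
    rwa [neg_zero] at this
  have hg₁' : AnalyticAt ℝ (fun t => g₁ (-t)) 0 :=
    AnalyticAt.fun_comp (g := g₁) (f := fun t => -t) (by rwa [neg_zero]) analyticAt_id.neg
  have hd₁' : deriv (fun t => g₁ (-t)) 0 = -deriv g₁ 0 := by rw [deriv_comp_neg, neg_zero]
  obtain ⟨a, ha, ha0, had, hae, -⟩ := exists_real_coordinate (ω := -ω) hg₁' (by simpa using h₁0)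
    hψ hψ0 hψd (neg_ne_zero.2 hω) (by rw [hd₁']; exact neg_ne_zero.2 hne₁) (hneg.eventually hr₁)
  obtain ⟨b, hb, hb0, hbd, hbe, -⟩ := exists_real_coordinate hg₂ h₂0 hψ hψ0 hψd hω hne₂ hr₂
  -- `α` is the coordinate of `g₁`
  set α : ℝ → ℝ := fun t => -a (-t)
  have hα : AnalyticAt ℝ α 0 :=
    (AnalyticAt.fun_comp (g := a) (f := fun t => -t) (by rwa [neg_zero]) analyticAt_id.neg).neg
  have hα0 : α 0 = 0 := by simp [α, ha0]
  have hαd : 0 < deriv α 0 := by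
    have : deriv α 0 = deriv a 0 := by
      simp only [α, deriv.fun_neg, deriv_comp_neg, neg_zero, neg_neg]
    rwa [this]
  have hαe : ∀ᶠ t in 𝓝 (0 : ℝ), ψ (g₁ t) = ω * α t := by
    have hneg' : Tendsto (fun t : ℝ => -t) (𝓝 0) (𝓝 0) := by
      simpa using (continuous_neg (G := ℝ)).tendsto 0
    filter_upwards [hneg'.eventually hae] with t ht
    rw [neg_neg] at ht
    rw [ht]
    simp [α]
  have hs := hα.hasStrictDerivAt
  have hinv := hα.analyticAt_localInverse hαd.ne'
  rw [hα0] at hinv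
  have hval : hs.localInverse _ _ _ hαd.ne' 0 = 0 := by
    have := HasStrictFDerivAt.localInverse_apply_image (hs.hasStrictFDerivAt_equiv hαd.ne')
    rwa [hα0] at this
  have hright := hs.eventually_right_inverse hαd.ne'
  rw [hα0] at hright
  set ι := hs.localInverse _ _ _ hαd.ne'
  -- In the chart both curves run along the same line, so they differ by this analytic change of
  -- parameter: `g₁ ∘ κ = g₂`. Unit speed and orientation give `κ' = 1`, and `κ 0 = 0` makes it the
  -- identity.
  set κ : ℝ → ℝ := fun s => ι (b s)
  have hκ : AnalyticAt ℝ κ 0 := AnalyticAt.fun_comp (g := ι) (by rwa [hb0]) hb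
  have hκ0 : κ 0 = 0 := by simp [κ, hb0, hval]
  have hκt : Tendsto κ (𝓝 0) (𝓝 0) := by simpa [hκ0] using hκ.continuousAt.tendsto
  have hbt : Tendsto b (𝓝 0) (𝓝 0) := by simpa [hb0] using hb.continuousAt.tendsto
  have hκd : 0 < deriv κ 0 := by
    have h1 : HasDerivAt ι (deriv α 0)⁻¹ (b 0) := by
      rw [hb0]
      have := (hs.to_localInverse hαd.ne').hasDerivAt
      rwa [hα0] at this
    have h2 := h1.comp 0 hb.differentiableAt.hasDerivAt
    rw [show κ = ι ∘ b from rfl, h2.deriv]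
    exact mul_pos (inv_pos.2 hαd) hbd
  have hg₁t : Tendsto g₁ (𝓝 0) (𝓝 u) := by simpa [h₁0] using hg₁.continuousAt.tendsto
  have hg₂t : Tendsto g₂ (𝓝 0) (𝓝 u) := by simpa [h₂0] using hg₂.continuousAt.tendsto
  have hcomp : ∀ᶠ s in 𝓝 (0 : ℝ), g₁ (κ s) = g₂ s := by
    filter_upwards [hκt.eventually (hg₁t.eventually hρ), hg₂t.eventually hρ, hbt.eventually hright,
      hκt.eventually hαe, hbe] with s h1 h2 h3 h4 h5
    rw [← h1, ← h2, h4, h5, show α (κ s) = b s from h3]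
  have hκd1 : ∀ᶠ s in 𝓝 (0 : ℝ), HasDerivAt κ 1 s := by
    filter_upwards [hcomp.eventually_nhds, hκ.eventually_analyticAt,
      hκt.eventually hg₁.eventually_analyticAt, hκt.eventually hN₁, hN₂,
      hκ.deriv.continuousAt.eventually (lt_mem_nhds hκd)] with s h1 h2 h3 h4 h5 h6
    have h7 : HasDerivAt (fun s => g₁ (κ s)) (deriv κ s • deriv g₁ (κ s)) s :=
      HasDerivAt.scomp s h3.differentiableAt.hasDerivAt h2.differentiableAt.hasDerivAt
    have h8 : deriv g₂ s = deriv κ s • deriv g₁ (κ s) := by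
      rw [← h7.deriv]
      exact (EventuallyEq.deriv_eq h1).symm
    rw [h8, norm_smul, h4, mul_one, Real.norm_eq_abs, abs_of_pos h6] at h5
    have := h2.differentiableAt.hasDerivAt
    rwa [h5] at this
  have hκid : ∀ᶠ s in 𝓝 (0 : ℝ), κ s = s := by
    have : ∀ᶠ s in 𝓝 (0 : ℝ), HasDerivAt (fun s => κ s - s) 0 s := by
      filter_upwards [hκd1] with s hs
      simpa using hs.fun_sub (hasDerivAt_id s)
    filter_upwards [eventually_const_of_hasDerivAt_zero this] with s hs
    simp only [hκ0] at hs
    linarith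
  filter_upwards [hcomp, hκid] with s h1 h2
  rw [← h1, h2]

/-- At the junction both pieces are restrictions of one germ, by `germ_eq_of_opposite_rays`, so the
concatenation is analytic there. -/
theorem IsUnitArc.glue {c₁ c₂ : ℝ → ℂ} {L₁ L₂ : ℝ} (h₁ : IsUnitArc c₁ L₁) (h₂ : IsUnitArc c₂ L₂)
    {ψ ρ : ℂ → ℂ} {u ω : ℂ} (e₁ : c₁ L₁ = u) (e₂ : c₂ 0 = u)
    (hψ : AnalyticAt ℂ ψ u) (hψ0 : ψ u = 0) (hψd : deriv ψ u ≠ 0) (hω : ω ≠ 0)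
    (hρ : ∀ᶠ z in 𝓝 u, ρ (ψ z) = z)
    (hr₁ : ∀ᶠ t in 𝓝[≤] L₁, ∃ s : ℝ, 0 ≤ s ∧ ψ (c₁ t) = -ω * s)
    (hr₂ : ∀ᶠ t in 𝓝[≥] (0 : ℝ), ∃ s : ℝ, 0 ≤ s ∧ ψ (c₂ t) = ω * s)
    (hinter : c₁ '' Icc 0 L₁ ∩ c₂ '' Icc 0 L₂ ⊆ {u}) :
    ∃ c, IsUnitArc c (L₁ + L₂) ∧ c 0 = c₁ 0 ∧ c (L₁ + L₂) = c₂ L₂ ∧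
      c '' Icc 0 (L₁ + L₂) = c₁ '' Icc 0 L₁ ∪ c₂ '' Icc 0 L₂ := by
  have p₁ := h₁.pos
  have p₂ := h₂.pos
  have hm₁ : L₁ ∈ Icc 0 L₁ := ⟨p₁.le, le_rfl⟩
  have hm₂ : (0 : ℝ) ∈ Icc 0 L₂ := ⟨le_rfl, p₂.le⟩
  have hshift : Tendsto (fun t => L₁ + t) (𝓝[≤] 0) (𝓝[≤] L₁) := by
    refine tendsto_nhdsWithin_iff.2 ⟨?_, ?_⟩
    · have : Tendsto (fun t => L₁ + t) (𝓝 0) (𝓝 (L₁ + 0)) := (continuous_const_add L₁).tendsto 0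
      rw [add_zero] at this
      exact this.mono_left nhdsWithin_le_nhds
    · filter_upwards [self_mem_nhdsWithin] with t ht
      simpa using ht
  have hg : AnalyticAt ℝ (fun t => c₁ (L₁ + t)) 0 :=
    AnalyticAt.fun_comp (g := c₁) (by simpa using h₁.analytic L₁ hm₁)
      (analyticAt_const.add analyticAt_id)
  have hgerm : (fun t => c₁ (L₁ + t)) =ᶠ[𝓝 0] c₂ := by
    refine germ_eq_of_opposite_rays hg (h₂.analytic 0 hm₂) (by simpa using e₁) e₂ hψ hψ0 hψd hω hρ
      ?_ ?_ (hshift.eventually hr₁) hr₂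
    · have : ∀ᶠ t in 𝓝[≤] L₁, ‖deriv c₁ t‖ = 1 := by
        filter_upwards [self_mem_nhdsWithin, mem_nhdsWithin_of_mem_nhds (lt_mem_nhds p₁)] with t h h'
        exact h₁.unit t ⟨le_of_lt h', h⟩
      filter_upwards [hshift.eventually this] with t ht
      rwa [deriv_comp_const_add]
    · filter_upwards [self_mem_nhdsWithin, mem_nhdsWithin_of_mem_nhds (gt_mem_nhds p₂)] with t h h'
      exact h₂.unit t ⟨h, le_of_lt h'⟩
  set c : ℝ → ℂ := fun t => if t ≤ L₁ then c₁ t else c₂ (t - L₁)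
  have hcl : ∀ t ≤ L₁, c t = c₁ t := fun t ht => if_pos ht
  have hcr : ∀ t, L₁ ≤ t → c t = c₂ (t - L₁) := fun t ht => by
    rcases ht.eq_or_lt with rfl | ht
    · rw [hcl _ le_rfl, e₁, sub_self, e₂]
    · exact if_neg (not_le.2 ht)
  have hl : ∀ t ≤ L₁, c =ᶠ[𝓝 t] c₁ := fun t ht => by
    rcases ht.eq_or_lt with rfl | ht
    · have hsub : Tendsto (fun s => s - t) (𝓝 t) (𝓝 0) := by
        simpa using (continuous_sub_right t).tendsto t
      filter_upwards [hsub.eventually hgerm] with s hs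
      rcases le_total s t with h | h
      · exact hcl s h
      · rw [hcr s h, ← hs, add_sub_cancel]
    · filter_upwards [gt_mem_nhds ht] with s hs using hcl s hs.le
  have hr : ∀ t, L₁ < t → c =ᶠ[𝓝 t] fun s => c₂ (s - L₁) := fun t ht => by
    filter_upwards [lt_mem_nhds ht] with s hs using hcr s hs.le
  -- The pieces meet only in `u`, which `c₂` takes only at parameter `0`.
  have key : ∀ s ∈ Icc 0 L₁, ∀ t, L₁ < t → t ≤ L₁ + L₂ → c s = c t → False := by
    intro s hs t ht ht' hst
    have h1 : t - L₁ ∈ Icc 0 L₂ := ⟨by linarith, by linarith⟩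
    rw [hcl s hs.2, hcr t ht.le] at hst
    have h2 : c₂ (t - L₁) ∈ ({u} : Set ℂ) :=
      hinter ⟨hst ▸ mem_image_of_mem _ hs, mem_image_of_mem _ h1⟩
    have := h₂.injOn h1 hm₂ (by rw [e₂]; exact h2)
    linarith
  refine ⟨c, ⟨by linarith, ?_, ?_, ?_⟩, hcl 0 p₁.le, ?_, ?_⟩
  · intro t ht
    rcases le_or_gt t L₁ with h | h
    · exact (h₁.analytic t ⟨ht.1, h⟩).congr (hl t h).symm
    · refine (AnalyticAt.fun_comp (g := c₂) (f := fun s => s - L₁) (h₂.analytic (t - L₁) ⟨by linarith, by linarith [ht.2]⟩)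
        (analyticAt_id.sub analyticAt_const)).congr (hr t h).symm
  · intro s hs t ht hst
    rcases le_or_gt s L₁ with h | h <;> rcases le_or_gt t L₁ with h' | h'
    · rw [hcl s h, hcl t h'] at hst
      exact h₁.injOn ⟨hs.1, h⟩ ⟨ht.1, h'⟩ hst
    · exact (key s ⟨hs.1, h⟩ t h' ht.2 hst).elim
    · exact (key t ⟨ht.1, h'⟩ s h hs.2 hst.symm).elim
    · rw [hcr s h.le, hcr t h'.le] at hst
      have := h₂.injOn ⟨by linarith, by linarith [hs.2]⟩ ⟨by linarith, by linarith [ht.2]⟩ hst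
      linarith
  · intro t ht
    rcases le_or_gt t L₁ with h | h
    · rw [(hl t h).deriv_eq]
      exact h₁.unit t ⟨ht.1, h⟩
    · rw [(hr t h).deriv_eq, deriv_comp_sub_const]
      exact h₂.unit _ ⟨by linarith, by linarith [ht.2]⟩
  · rw [hcr _ (by linarith), add_sub_cancel_left]
  · ext z
    constructor
    · rintro ⟨t, ht, rfl⟩
      rcases le_total t L₁ with h | h
      · exact Or.inl ⟨t, ⟨ht.1, h⟩, (hcl t h).symm⟩
      · exact Or.inr ⟨t - L₁, ⟨by linarith, by linarith [ht.2]⟩, (hcr t h).symm⟩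
    · rintro (⟨t, ht, rfl⟩ | ⟨t, ht, rfl⟩)
      · exact ⟨t, ⟨ht.1, by linarith [ht.2]⟩, hcl t ht.2⟩
      · refine ⟨L₁ + t, ⟨by linarith [ht.1], by linarith [ht.2]⟩, ?_⟩
        rw [hcr _ (by linarith [ht.1]), add_sub_cancel_left]

/-! ### Inverse branches of a polynomial over an interval -/

theorem Polynomial.degree_pos_of_natDegree_pos {T : ℂ[X]} (hT : 0 < T.natDegree) :
    0 < T.degree := natDegree_pos_iff_degree_pos.1 hT

theorem Polynomial.sub_C_ne_zero {T : ℂ[X]} (hT : 0 < T.natDegree) (c : ℂ) : T - C c ≠ 0 := by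
  intro h
  rw [sub_eq_zero.1 h] at hT
  simp at hT

theorem Polynomial.finite_fiber {T : ℂ[X]} (hT : 0 < T.natDegree) (c : ℂ) :
    {z | T.eval z = c}.Finite := by
  refine (finite_setOfPred_isRoot (sub_C_ne_zero hT c)).subset fun z hz => ?_
  simpa [IsRoot.def, sub_eq_zero] using hz

/-- `T` has no critical point over the open interval `(l, r)`. -/
def RegularOver (T : ℂ[X]) (l r : ℝ) : Prop :=
  ∀ x ∈ Ioo l r, ∀ z, T.eval z = (x : ℂ) → T.derivative.eval z ≠ 0

/-- A continuous inverse branch of `T` over `[l, r]`. -/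
structure IsSection (T : ℂ[X]) (l r : ℝ) (z : ℝ → ℂ) : Prop where
  cont : ContinuousOn z (Icc l r)
  eval : ∀ x ∈ Icc l r, T.eval (z x) = (x : ℂ)

theorem IsSection.injOn {T : ℂ[X]} {l r : ℝ} {z : ℝ → ℂ} (h : IsSection T l r z) :
    InjOn z (Icc l r) := fun x hx y hy hxy => by
  have h1 := h.eval x hx
  rw [hxy, h.eval y hy] at h1
  exact_mod_cast h1.symm

/-- The coincidence set is closed, and it is open because `T` is locally injective at `f x`;
connectedness does the rest. -/
theorem eqOn_of_eval_eq {T : ℂ[X]} {f g : ℝ → ℂ} {I : Set ℝ} (hI : IsPreconnected I)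
    (hf : ContinuousOn f I) (hg : ContinuousOn g I) (hfg : ∀ x ∈ I, T.eval (f x) = T.eval (g x))
    (hreg : ∀ x ∈ I, T.derivative.eval (f x) ≠ 0) {x₀ : ℝ} (hx₀ : x₀ ∈ I) (h₀ : f x₀ = g x₀) :
    EqOn f g I := by
  have := isPreconnected_iff_preconnectedSpace.1 hI
  have hf' : Continuous fun x : I => f x := continuousOn_iff_continuous_domRestrict.1 hf
  have hg' : Continuous fun x : I => g x := continuousOn_iff_continuous_domRestrict.1 hg
  have hclopen : IsClopen {x : I | f x = g x} := by
    refine ⟨isClosed_eq hf' hg', isOpen_iff_mem_nhds.2 fun x hx => ?_⟩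
    have hx' : f x = g x := hx
    have hs := T.hasStrictDerivAt (f x)
    have hl := hs.eventually_left_inverse (hreg x x.2)
    obtain ⟨inv, hl⟩ : ∃ inv : ℂ → ℂ, ∀ᶠ w in 𝓝 (f x), inv (T.eval w) = w := ⟨_, hl⟩
    have hl' := hl
    rw [hx'] at hl'
    filter_upwards [hf'.continuousAt.eventually hl, hg'.continuousAt.eventually hl'] with y h1 h2
    show f y = g y
    rw [← h1, ← h2, hfg y y.2]
  have huniv := hclopen.eq_univ ⟨⟨x₀, hx₀⟩, h₀⟩
  intro x hx
  have : (⟨x, hx⟩ : I) ∈ {x : I | f x = g x} := huniv ▸ mem_univ _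
  exact this

/-- A curve along which a nonconstant polynomial converges, itself converges. -/
theorem exists_tendsto_of_tendsto_eval {T : ℂ[X]} (hT : 0 < T.natDegree) {w : ℝ → ℂ} {δ : ℝ}
    (hδ : 0 < δ) (hw : ContinuousOn w (Ioo 0 δ)) {v : ℂ}
    (hv : Tendsto (fun s => T.eval (w s)) (𝓝[>] 0) (𝓝 v)) :
    ∃ u, T.eval u = v ∧ Tendsto w (𝓝[>] 0) (𝓝 u) := by
  have hproper := T.isProperMap_eval (degree_pos_of_natDegree_pos hT)
  obtain ⟨u, hu, hclus⟩ := hproper.clusterPt_of_mapClusterPt (ℱ := map w (𝓝[>] 0)) (y := v)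
    (hv.mapClusterPt)
  refine ⟨u, hu, Metric.tendsto_nhds.2 fun ε₀ hε₀ => ?_⟩
  -- A circle around the cluster point that misses the finite fibre over `v`. Near parameter `0` the
  -- curve cannot cross it, and being inside at some such parameter it stays inside.
  obtain ⟨ε, ⟨hε, hεε⟩, hav⟩ : ∃ ε ∈ Ioo 0 ε₀, ε ∉ (fun z => dist z u) '' {z | T.eval z = v} := by
    by_contra! hcon
    exact (Ioo_infinite hε₀) (((finite_fiber hT v).image _).subset hcon)
  have hsphere : ∀ᶠ s in 𝓝[>] (0 : ℝ), dist (w s) u ≠ ε := by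
    have hK : IsClosed (T.eval '' Metric.sphere u ε) :=
      ((isCompact_sphere u ε).image T.continuous).isClosed
    have hvK : v ∉ T.eval '' Metric.sphere u ε := by
      rintro ⟨z, hz, hzv⟩
      exact hav ⟨z, hzv, hz⟩
    filter_upwards [hv.eventually (hK.isOpen_compl.mem_nhds hvK)] with s hs hd
    exact hs ⟨w s, hd, rfl⟩
  obtain ⟨η, hη, hsη⟩ := mem_nhdsGT_iff_exists_Ioo_subset.1
    (inter_mem hsphere (Ioo_mem_nhdsGT hδ))
  have hη' : (0 : ℝ) < η := hη
  have hfreq : ∃ᶠ s in 𝓝[>] (0 : ℝ), dist (w s) u < ε := by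
    have h1 := hclus.frequently (Metric.ball_mem_nhds u hε)
    exact h1
  obtain ⟨s₁, hs₁, hs₁'⟩ := (hfreq.and_eventually (Ioo_mem_nhdsGT hη')).exists
  have hpre : IsPreconnected (Ioo 0 η) := isPreconnected_Ioo
  have hcont : ContinuousOn (fun s => dist (w s) u) (Ioo 0 η) :=
    continuous_dist.comp_continuousOn
      ((hw.mono fun s hs => (hsη hs).2).prodMk continuousOn_const)
  filter_upwards [Ioo_mem_nhdsGT hη'] with s hs
  by_contra hcon
  obtain ⟨s₂, hs₂, heq⟩ := hpre.intermediate_value hs₁' hs hcont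
    (show ε ∈ Icc _ _ from ⟨hs₁.le, by linarith [not_lt.1 hcon]⟩)
  exact (hsη hs₂).1 heq

/-- An inverse branch over an open interval extends continuously to the endpoints. -/
theorem exists_isSection_extension {T : ℂ[X]} (hT : 0 < T.natDegree) {l r : ℝ} (hlr : l < r)
    {f : ℝ → ℂ} (hf : ContinuousOn f (Ioo l r)) (hfe : ∀ x ∈ Ioo l r, T.eval (f x) = (x : ℂ)) :
    ∃ z, IsSection T l r z ∧ ∀ x ∈ Ioo l r, z x = f x := by
  have hδ : 0 < r - l := sub_pos.2 hlr
  have hleft : ∃ u, Tendsto f (𝓝[>] l) (𝓝 u) := by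
    have hmap : map (fun s => l + s) (𝓝[>] 0) = 𝓝[>] l := by
      simp
    have hc : ContinuousOn (fun s => f (l + s)) (Ioo 0 (r - l)) :=
      hf.comp (by fun_prop) fun s hs => ⟨by linarith [hs.1], by linarith [hs.2]⟩
    obtain ⟨u, -, hu⟩ := exists_tendsto_of_tendsto_eval hT hδ hc (v := l) (by
      have h1 : Tendsto (fun s : ℝ => ((l + s : ℝ) : ℂ)) (𝓝[>] 0) (𝓝 ((l + 0 : ℝ) : ℂ)) :=
        (Continuous.tendsto (by fun_prop) 0).mono_left nhdsWithin_le_nhds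
      rw [add_zero] at h1
      refine h1.congr' ?_
      filter_upwards [Ioo_mem_nhdsGT hδ] with s hs
      rw [hfe _ ⟨by linarith [hs.1], by linarith [hs.2]⟩])
    refine ⟨u, ?_⟩
    rw [← hmap]
    exact tendsto_map'_iff.2 hu
  have hright : ∃ u, Tendsto f (𝓝[<] r) (𝓝 u) := by
    have hmap : map (fun s => r - s) (𝓝[>] 0) = 𝓝[<] r := by
      simp
    have hc : ContinuousOn (fun s => f (r - s)) (Ioo 0 (r - l)) :=
      hf.comp (by fun_prop) fun s hs => ⟨by linarith [hs.2], by linarith [hs.1]⟩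
    obtain ⟨u, -, hu⟩ := exists_tendsto_of_tendsto_eval hT hδ hc (v := r) (by
      have h1 : Tendsto (fun s : ℝ => ((r - s : ℝ) : ℂ)) (𝓝[>] 0) (𝓝 ((r - 0 : ℝ) : ℂ)) :=
        (Continuous.tendsto (by fun_prop) 0).mono_left nhdsWithin_le_nhds
      rw [sub_zero] at h1
      refine h1.congr' ?_
      filter_upwards [Ioo_mem_nhdsGT hδ] with s hs
      rw [hfe _ ⟨by linarith [hs.2], by linarith [hs.1]⟩])
    refine ⟨u, ?_⟩
    rw [← hmap]
    exact tendsto_map'_iff.2 hu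
  obtain ⟨ul, hul⟩ := hleft
  obtain ⟨ur, hur⟩ := hright
  have hz := continuousOn_Icc_extendFrom_Ioo hf hul hur
  have hze : ∀ x ∈ Ioo l r, extendFrom (Ioo l r) f x = f x := fun x hx =>
    extendFrom_eq (subset_closure hx) (hf x hx)
  refine ⟨extendFrom (Ioo l r) f, ⟨hz, ?_⟩, hze⟩
  have h1 : EqOn (fun x => T.eval (extendFrom (Ioo l r) f x)) (fun x : ℝ => (x : ℂ))
      (Ioo l r) := fun x hx => by
    simp only [hze x hx, hfe x hx]
  exact h1.of_subset_closure (T.continuous.comp_continuousOn hz)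
    (Complex.continuous_ofReal.continuousOn) Ioo_subset_Icc_self (by rw [closure_Ioo hlr.ne])
-- Over `(l, r)` the polynomial is a proper local homeomorphism, hence a covering, and the inclusion
-- of the interval lifts through it because an interval is contractible.
theorem exists_isSection {T : ℂ[X]} (hT : 0 < T.natDegree) {l r : ℝ}
    (hreg : RegularOver T l r) {x₀ : ℝ} (hx₀ : x₀ ∈ Ioo l r) {y : ℂ} (hy : T.eval y = x₀) :
    ∃ z, IsSection T l r z ∧ z x₀ = y := by
  have hlr : l < r := hx₀.1.trans hx₀.2
  have hproper := T.isProperMap_eval (degree_pos_of_natDegree_pos hT)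
  have hcov : IsCoveringMapOn T.eval ((fun x : ℝ => (x : ℂ)) '' Ioo l r) := by
    refine hproper.isClosedMap.isCoveringMapOn_of_isLocalHomeomorphOn
      (fun x _ => finite_fiber hT x) ?_
    rintro z ⟨x, hx, hxz⟩
    have hd := hreg x hx z hxz.symm
    have hs := (T.hasStrictDerivAt z).hasStrictFDerivAt_equiv hd
    exact ⟨hs.toOpenPartialHomeomorph _, hs.mem_toOpenPartialHomeomorph_source, rfl⟩
  have : ContractibleSpace (Ioo l r) := (convex_Ioo l r).contractibleSpace ⟨x₀, hx₀⟩
  have : LocallyPathConnectedSpace (Ioo l r) := isOpen_Ioo.locallyPathConnectedSpace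
  obtain ⟨F, ⟨hF₀, hF⟩, -⟩ := hcov.existsUnique_continuousMap_lifts
    (⟨fun x : Ioo l r => ((x : ℝ) : ℂ), by fun_prop⟩ : C(Ioo l r, ℂ)) (a₀ := ⟨x₀, hx₀⟩) (e₀ := y) hy
    (fun a => ⟨a, a.2, rfl⟩)
  have hF' : ∀ x : Ioo l r, T.eval (F x) = ((x : ℝ) : ℂ) := fun x => congrFun hF x
  set f : ℝ → ℂ := fun x => if h : x ∈ Ioo l r then F ⟨x, h⟩ else 0
  have hf : ContinuousOn f (Ioo l r) := by
    rw [continuousOn_iff_continuous_domRestrict]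
    convert F.continuous using 1
    ext x
    simp only [Set.domRestrict_apply, f]
    rw [dif_pos x.2]
  have hfe : ∀ x ∈ Ioo l r, T.eval (f x) = (x : ℂ) := fun x hx => by
    simp only [f]
    rw [dif_pos hx]
    exact hF' ⟨x, hx⟩
  obtain ⟨z, hz, hzf⟩ := exists_isSection_extension hT hlr hf hfe
  refine ⟨z, hz, ?_⟩
  rw [hzf x₀ hx₀]
  simp only [f]
  rw [dif_pos hx₀, hF₀]

/-- A curve along which `T` moves away from the value `T u` as `σ s ^ k`, `k` the order of `T` at
`u`, leaves `u` along a ray of the power chart. -/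
theorem exists_direction {T : ℂ[X]} {u : ℂ} {ρ ψ : ℂ → ℂ} {k : ℕ} (hk : 0 < k)
    (hψ : AnalyticAt ℂ ψ u) (hρ0 : ρ 0 = u) (hρψ : ∀ᶠ z in 𝓝 u, ρ (ψ z) = z)
    (hpow : ∀ z, T.eval z = T.eval u + ψ z ^ k) {w : ℝ → ℂ} {δ : ℝ} (hδ : 0 < δ)
    (hw : ContinuousOn w (Icc 0 δ)) (hw0 : w 0 = u) {σ : ℂ}
    (hT : ∀ s ∈ Icc 0 δ, T.eval (w s) = T.eval u + σ * (s : ℂ) ^ k) :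
    ∃ ω : ℂ, ω ^ k = σ ∧ ∀ᶠ s in 𝓝[≥] (0 : ℝ), w s = ρ (ω * s) := by
  have hwt : Tendsto w (𝓝[≥] 0) (𝓝 u) := by
    have h1 := hw 0 ⟨le_rfl, hδ.le⟩
    rw [ContinuousWithinAt, hw0] at h1
    exact h1.mono_left (nhdsWithin_le_of_mem (Icc_mem_nhdsGE hδ))
  have hev := hwt.eventually (hψ.eventually_analyticAt.and hρψ)
  obtain ⟨η, hη, hsη⟩ := mem_nhdsGE_iff_exists_Icc_subset.1
    (inter_mem hev (Icc_mem_nhdsGE hδ))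
  have hη : (0 : ℝ) < η := hη
  have hsub : Ioc 0 η ⊆ Icc 0 η := Ioc_subset_Icc_self
  have hcont : ContinuousOn (fun s : ℝ => ψ (w s) / s) (Ioc 0 η) := by
    refine ContinuousOn.div ?_ (by fun_prop) fun s hs => by exact_mod_cast hs.1.ne'
    intro s hs
    have h1 := (hsη (hsub hs)).1.1.continuousAt
    exact h1.comp_continuousWithinAt
      ((hw.mono fun s hs => (hsη (hsub hs)).2) s hs)
  have hpow' : ∀ s ∈ Ioc 0 η, (ψ (w s) / s) ^ k = σ := fun s hs => by
    have h1 := hT s (hsη (hsub hs)).2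
    rw [hpow (w s)] at h1
    have h2 : ψ (w s) ^ k = σ * (s : ℂ) ^ k := by linear_combination h1
    have h3 : (s : ℂ) ≠ 0 := by exact_mod_cast hs.1.ne'
    rw [div_pow, h2, mul_div_cancel_right₀ _ (pow_ne_zero _ h3)]
  have hfin : {ω : ℂ | ω ^ k = σ}.Finite := by
    have h1 := Polynomial.finite_fiber (T := X ^ k) (by simpa using hk) σ
    simpa using h1
  have hηm : η ∈ Ioc 0 η := ⟨hη, le_rfl⟩
  -- A continuous function on an interval with values in the finite set of `k`-th roots of `σ` is
  -- constant.
  have hconst : ∀ s ∈ Ioc 0 η, ψ (w s) / s = ψ (w η) / η := fun s hs =>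
    isPreconnected_Ioc.constant_of_mapsTo hfin.isDiscrete hcont hpow' hs hηm
  refine ⟨ψ (w η) / η, hpow' η hηm, ?_⟩
  filter_upwards [Icc_mem_nhdsGE hη] with s hs
  rcases hs.1.eq_or_lt with rfl | h
  · simp [hw0, hρ0]
  · rw [← hconst s ⟨h, hs.2⟩, div_mul_cancel₀ _ (by exact_mod_cast h.ne'), (hsη hs).1.2]

/-! ### The graph of edges and flags -/

/-- The order to which `T` takes the value `T u` at `u`. -/
noncomputable def powerOrder (T : ℂ[X]) (u : ℂ) : ℕ := (T - C (T.eval u)).rootMultiplicity u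

theorem powerOrder_pos {T : ℂ[X]} (hT : 0 < T.natDegree) (u : ℂ) : 0 < powerOrder T u :=
  (rootMultiplicity_pos (sub_C_ne_zero hT _)).2 (by simp)

/-- The local coordinate at `u` in which `T` is a pure power. -/
noncomputable def powerChart {T : ℂ[X]} (hT : 0 < T.natDegree) (u : ℂ) : ℂ → ℂ :=
  (exists_powerChart hT u).choose_spec.choose

/-- The inverse of `powerChart`. -/
noncomputable def powerChartInv {T : ℂ[X]} (hT : 0 < T.natDegree) (u : ℂ) : ℂ → ℂ :=
  (exists_powerChart hT u).choose

section
variable {T : ℂ[X]} (hT : 0 < T.natDegree) (u : ℂ)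

theorem analyticAt_powerChartInv : AnalyticAt ℂ (powerChartInv hT u) 0 :=
  (exists_powerChart hT u).choose_spec.choose_spec.1
theorem analyticAt_powerChart : AnalyticAt ℂ (powerChart hT u) u :=
  (exists_powerChart hT u).choose_spec.choose_spec.2.1
theorem powerChartInv_zero : powerChartInv hT u 0 = u :=
  (exists_powerChart hT u).choose_spec.choose_spec.2.2.1
theorem powerChart_self : powerChart hT u u = 0 :=
  (exists_powerChart hT u).choose_spec.choose_spec.2.2.2.1
theorem deriv_powerChartInv_ne : deriv (powerChartInv hT u) 0 ≠ 0 :=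
  (exists_powerChart hT u).choose_spec.choose_spec.2.2.2.2.1
theorem deriv_powerChart_ne : deriv (powerChart hT u) u ≠ 0 :=
  (exists_powerChart hT u).choose_spec.choose_spec.2.2.2.2.2.1
theorem powerChart_powerChartInv :
    ∀ᶠ w in 𝓝 0, powerChart hT u (powerChartInv hT u w) = w :=
  (exists_powerChart hT u).choose_spec.choose_spec.2.2.2.2.2.2.1
theorem powerChartInv_powerChart :
    ∀ᶠ z in 𝓝 u, powerChartInv hT u (powerChart hT u z) = z :=
  (exists_powerChart hT u).choose_spec.choose_spec.2.2.2.2.2.2.2.1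
theorem eval_eq_powerChart (z : ℂ) :
    T.eval z = T.eval u + powerChart hT u z ^ powerOrder T u :=
  (exists_powerChart hT u).choose_spec.choose_spec.2.2.2.2.2.2.2.2 z

/-- Points of a ray in the inverse chart, near the origin of the chart. -/
theorem tendsto_ray (ω : ℂ) : Tendsto (fun s : ℝ => ω * s) (𝓝 0) (𝓝 0) := by
  have : Continuous fun s : ℝ => ω * (s : ℂ) := by fun_prop
  simpa using this.tendsto 0

theorem eventually_powerChart_ray (ω : ℂ) :
    ∀ᶠ s : ℝ in 𝓝 0, powerChart hT u (powerChartInv hT u (ω * s)) = ω * s :=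
  (tendsto_ray ω).eventually (powerChart_powerChartInv hT u)

end

/-- Left endpoints of the two segments into which `τ` divides `[-1, 1]`. -/
def segLo (τ : ℝ) : Bool → ℝ
  | false => -1
  | true => τ

/-- Right endpoints of the two segments into which `τ` divides `[-1, 1]`. -/
def segHi (τ : ℝ) : Bool → ℝ
  | false => τ
  | true => 1

/-- All inverse branches of a nonconstant polynomial `T` over the segments `[-1, τ]` and `[τ, 1]`,
where `T` has no critical values in the interiors of the segments. -/
structure EdgeSystem (T : ℂ[X]) (τ : ℝ) where
  natDegree_pos : 0 < T.natDegree
  mem : τ ∈ Ioo (-1 : ℝ) 1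
  regular : ∀ b, RegularOver T (segLo τ b) (segHi τ b)
  Edge : Type
  fin : Fintype Edge
  side : Edge → Bool
  z : Edge → ℝ → ℂ
  sec : ∀ e, IsSection T (segLo τ (side e)) (segHi τ (side e)) (z e)
  disj : ∀ e e', side e = side e' → ∀ x ∈ Ioo (segLo τ (side e)) (segHi τ (side e)),
    z e x = z e' x → e = e'
  cover : ∀ b, ∀ x ∈ Ioo (segLo τ b) (segHi τ b), ∀ y, T.eval y = (x : ℂ) →
    ∃ e, side e = b ∧ z e x = y

theorem segLo_lt_segHi {τ : ℝ} (hτ : τ ∈ Ioo (-1 : ℝ) 1) (b : Bool) : segLo τ b < segHi τ b := by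
  cases b
  · exact hτ.1
  · exact hτ.2

theorem nonempty_edgeSystem {T : ℂ[X]} (hT : 0 < T.natDegree) {τ : ℝ} (hτ : τ ∈ Ioo (-1 : ℝ) 1)
    (hreg : ∀ b, RegularOver T (segLo τ b) (segHi τ b)) : Nonempty (EdgeSystem T τ) := by
  -- The edges over a segment are indexed by the fibre over its midpoint.
  set mid : Bool → ℝ := fun b => (segLo τ b + segHi τ b) / 2
  have hmid : ∀ b, mid b ∈ Ioo (segLo τ b) (segHi τ b) := fun b => by
    have := segLo_lt_segHi hτ b
    constructor <;> simp only [mid] <;> linarith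
  have hfin : ∀ b, Finite {p : ℂ // T.eval p = (mid b : ℂ)} := fun b =>
    (finite_fiber hT (mid b : ℂ)).to_subtype
  have hex : ∀ p : Σ b, {p : ℂ // T.eval p = (mid b : ℂ)}, ∃ z,
      IsSection T (segLo τ p.1) (segHi τ p.1) z ∧ z (mid p.1) = p.2 := fun p =>
    exists_isSection hT (hreg p.1) (hmid p.1) p.2.2
  choose z hz hzm using hex
  have huniq : ∀ b, ∀ f g : ℝ → ℂ, IsSection T (segLo τ b) (segHi τ b) f →
      IsSection T (segLo τ b) (segHi τ b) g → ∀ x₀ ∈ Ioo (segLo τ b) (segHi τ b), f x₀ = g x₀ →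
      EqOn f g (Ioo (segLo τ b) (segHi τ b)) := fun b f g hf hg x₀ hx₀ h₀ => by
    refine eqOn_of_eval_eq (T := T) isPreconnected_Ioo (hf.cont.mono Ioo_subset_Icc_self)
      (hg.cont.mono Ioo_subset_Icc_self) (fun x hx => ?_) (fun x hx => ?_) hx₀ h₀
    · rw [hf.eval x (Ioo_subset_Icc_self hx), hg.eval x (Ioo_subset_Icc_self hx)]
    · exact hreg b x hx _ (hf.eval x (Ioo_subset_Icc_self hx))
  refine ⟨⟨hT, hτ, hreg, Σ b, {p : ℂ // T.eval p = (mid b : ℂ)}, Fintype.ofFinite _,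
    fun p => p.1, z, hz, ?_, ?_⟩⟩
  · rintro ⟨b, p⟩ ⟨b', p'⟩ hbb x hx hxx
    obtain rfl : b = b' := hbb
    have h1 := huniq b _ _ (hz ⟨b, p⟩) (hz ⟨b, p'⟩) x hx hxx (hmid b)
    rw [hzm ⟨b, p⟩, hzm ⟨b, p'⟩] at h1
    exact congrArg (Sigma.mk b) (Subtype.ext h1)
  · intro b x hx y hy
    obtain ⟨f, hf, hfy⟩ := exists_isSection hT (hreg b) hx hy
    refine ⟨⟨b, f (mid b), hf.eval _ (Ioo_subset_Icc_self (hmid b))⟩, rfl, ?_⟩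
    rw [← hfy]
    exact huniq b _ _ (hz ⟨b, f (mid b), hf.eval _ (Ioo_subset_Icc_self (hmid b))⟩) hf (mid b)
      (hmid b) (hzm _) hx

namespace EdgeSystem

variable {T : ℂ[X]} {τ : ℝ} (S : EdgeSystem T τ)

instance : Fintype S.Edge := S.fin

/-- The lower end of the segment over which the edge lies. -/
def lo (e : S.Edge) : ℝ := segLo τ (S.side e)

/-- The upper end of the segment over which the edge lies. -/
def hi (e : S.Edge) : ℝ := segHi τ (S.side e)

theorem lo_lt_hi (e : S.Edge) : S.lo e < S.hi e := segLo_lt_segHi S.mem _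

/-- The point set of an edge. -/
def img (e : S.Edge) : Set ℂ := S.z e '' Icc (S.lo e) (S.hi e)

/-- A flag is an edge together with one of its ends. -/
abbrev Flag := S.Edge × Bool

/-- The value of `T` at the end of an edge. -/
def base (f : S.Flag) : ℝ := if f.2 then S.hi f.1 else S.lo f.1

/-- The direction in which `T` leaves its value at the end of an edge. -/
def sgn (f : S.Flag) : ℝ := if f.2 then -1 else 1

/-- The end point of a flag. -/
def pt (f : S.Flag) : ℂ := S.z f.1 (S.base f)

/-- The other end of the same edge. -/
def flip (f : S.Flag) : S.Flag := (f.1, !f.2)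

theorem base_mem (f : S.Flag) : S.base f ∈ Icc (S.lo f.1) (S.hi f.1) := by
  have := S.lo_lt_hi f.1
  unfold base
  split_ifs
  · exact ⟨this.le, le_rfl⟩
  · exact ⟨le_rfl, this.le⟩

theorem eval_pt (f : S.Flag) : T.eval (S.pt f) = (S.base f : ℂ) := (S.sec f.1).eval _ (S.base_mem f)

theorem pt_mem_img (f : S.Flag) : S.pt f ∈ S.img f.1 := ⟨_, S.base_mem f, rfl⟩

theorem base_flip_ne (f : S.Flag) : S.base (S.flip f) ≠ S.base f := by
  have := S.lo_lt_hi f.1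
  rcases f with ⟨e, _ | _⟩
  · simpa [flip, base] using this.ne'
  · simpa [flip, base] using this.ne

theorem pt_flip_ne (f : S.Flag) : S.pt (S.flip f) ≠ S.pt f := fun h => by
  have h1 := S.eval_pt f
  rw [← h, S.eval_pt] at h1
  exact S.base_flip_ne f (by exact_mod_cast h1)

/-- The order of `T` at the end of an edge. -/
noncomputable def ord (f : S.Flag) : ℕ := powerOrder T (S.pt f)

theorem ord_pos (f : S.Flag) : 0 < S.ord f := powerOrder_pos S.natDegree_pos _

theorem base_add_mem (f : S.Flag) {y : ℝ} (hy : y ∈ Icc 0 (S.hi f.1 - S.lo f.1)) :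
    S.base f + S.sgn f * y ∈ Icc (S.lo f.1) (S.hi f.1) := by
  rcases f with ⟨e, _ | _⟩
  · simp only [base, sgn] at *
    constructor <;> simp <;> linarith [hy.1, hy.2]
  · simp only [base, sgn] at *
    constructor <;> simp <;> linarith [hy.1, hy.2]

theorem base_add_mem_Ioo (f : S.Flag) {y : ℝ} (hy : y ∈ Ioo 0 (S.hi f.1 - S.lo f.1)) :
    S.base f + S.sgn f * y ∈ Ioo (S.lo f.1) (S.hi f.1) := by
  rcases f with ⟨e, _ | _⟩
  · simp only [base, sgn] at *
    constructor <;> simp <;> linarith [hy.1, hy.2]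
  · simp only [base, sgn] at *
    constructor <;> simp <;> linarith [hy.1, hy.2]

theorem exists_radius {k : ℕ} (hk : 0 < k) {d : ℝ} (hd : 0 < d) :
    ∃ δ > 0, ∀ s ∈ Ioc (0 : ℝ) δ, s ^ k ∈ Ioo 0 d := by
  refine ⟨min (1 / 2) (d / 2), by positivity, fun s hs => ⟨pow_pos hs.1 _, ?_⟩⟩
  have h1 := hs.2.trans (min_le_left _ _)
  have h2 := hs.2.trans (min_le_right _ _)
  calc s ^ k ≤ s ^ 1 := pow_le_pow_of_le_one hs.1.le (by linarith) hk
    _ < d := by rw [pow_one]; linarith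

theorem exists_dir (f : S.Flag) : ∃ ω : ℂ, ω ^ S.ord f = (S.sgn f : ℂ) ∧
    ∀ᶠ s in 𝓝[≥] (0 : ℝ), S.z f.1 (S.base f + S.sgn f * s ^ S.ord f) =
      powerChartInv S.natDegree_pos (S.pt f) (ω * s) := by
  obtain ⟨δ, hδ, hs⟩ := exists_radius (S.ord_pos f) (sub_pos.2 (S.lo_lt_hi f.1))
  have hmem : ∀ s ∈ Icc 0 δ, S.base f + S.sgn f * s ^ S.ord f ∈ Icc (S.lo f.1) (S.hi f.1) :=
    fun s hs' => by
      rcases hs'.1.eq_or_lt with rfl | h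
      · rw [zero_pow (S.ord_pos f).ne', mul_zero, add_zero]
        exact S.base_mem f
      · exact S.base_add_mem f (Ioo_subset_Icc_self (hs s ⟨h, hs'.2⟩))
  refine exists_direction (S.ord_pos f) (analyticAt_powerChart S.natDegree_pos (S.pt f))
    (powerChartInv_zero _ _) (powerChartInv_powerChart _ _) (eval_eq_powerChart S.natDegree_pos _)
    hδ ?_ ?_ ?_
  · exact (S.sec f.1).cont.comp (by fun_prop) hmem
  · rw [zero_pow (S.ord_pos f).ne', mul_zero, add_zero]
    rfl
  · intro s hs'
    rw [(S.sec f.1).eval _ (hmem s hs'), S.eval_pt]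
    push_cast
    rfl

/-- The ray of the power chart along which an edge leaves its end point. -/
noncomputable def dir (f : S.Flag) : ℂ := (S.exists_dir f).choose

theorem dir_pow (f : S.Flag) : S.dir f ^ S.ord f = (S.sgn f : ℂ) := (S.exists_dir f).choose_spec.1

theorem germ (f : S.Flag) : ∀ᶠ s in 𝓝[≥] (0 : ℝ), S.z f.1 (S.base f + S.sgn f * s ^ S.ord f) =
    powerChartInv S.natDegree_pos (S.pt f) (S.dir f * s) := (S.exists_dir f).choose_spec.2

theorem sgn_ne_zero (f : S.Flag) : S.sgn f ≠ 0 := by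
  unfold sgn
  split_ifs <;> norm_num

theorem dir_ne_zero (f : S.Flag) : S.dir f ≠ 0 := fun h => by
  have := S.dir_pow f
  rw [h, zero_pow (S.ord_pos f).ne'] at this
  exact S.sgn_ne_zero f (by exact_mod_cast this.symm)

/-- The power of the direction tells at which end of its edge the flag sits, and this end together
with the value of `T` tells over which segment. Both edges then follow the same ray, so they share
an interior point and coincide. -/
theorem flag_ext {f g : S.Flag} (hpt : S.pt f = S.pt g) (hdir : S.dir f = S.dir g) : f = g := by
  have hord : S.ord f = S.ord g := by simp only [ord, hpt]
  have hbase : S.base f = S.base g := by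
    have h1 := S.eval_pt f
    rw [hpt, S.eval_pt] at h1
    exact_mod_cast h1.symm
  have hsgn : S.sgn f = S.sgn g := by
    have h1 := S.dir_pow f
    rw [hdir, hord, S.dir_pow] at h1
    exact_mod_cast h1.symm
  have hend : f.2 = g.2 := by
    rcases f with ⟨e, _ | _⟩ <;> rcases g with ⟨e', _ | _⟩ <;> simp [sgn] at hsgn ⊢ <;>
      norm_num at hsgn
  have hside : S.side f.1 = S.side g.1 := by
    have h1 := S.mem.1.ne
    have h2 := S.mem.2.ne
    simp only [base, lo, hi, hend] at hbase
    cases h3 : S.side f.1 <;> cases h4 : S.side g.1 <;> cases h5 : g.2 <;>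
      simp_all [segLo, segHi]
  obtain ⟨δ, hδ, hs⟩ := exists_radius (S.ord_pos f) (sub_pos.2 (S.lo_lt_hi f.1))
  have hf := S.germ f
  have hg := S.germ g
  rw [← hpt, ← hdir, ← hord, ← hbase, ← hsgn] at hg
  have hev := ((hf.and hg).filter_mono (nhdsWithin_mono _ Ioi_subset_Ici_self)).and
    (Ioc_mem_nhdsGT hδ)
  obtain ⟨s, ⟨h1, h2⟩, h3⟩ := hev.exists
  exact Prod.ext (S.disj f.1 g.1 hside _ (S.base_add_mem_Ioo f (hs s h3)) (h1.trans h2.symm)) hend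

/-- `T` maps the start of the ray in direction `ω` into the segment. One point of the ray lies on an
edge by `cover`, and uniqueness of lifts identifies ray and edge all the way down to `u`. -/
theorem exists_flag {u : ℂ} {b e : Bool}
    (hu : T.eval u = ((if e then segHi τ b else segLo τ b : ℝ) : ℂ)) {ω : ℂ}
    (hω : ω ^ powerOrder T u = ((if e then -1 else 1 : ℝ) : ℂ)) :
    ∃ f : S.Flag, S.side f.1 = b ∧ f.2 = e ∧ S.pt f = u ∧ S.dir f = ω := by
  set v : ℝ := if e then segHi τ b else segLo τ b with hv
  set σ : ℝ := if e then -1 else 1 with hσ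
  set k := powerOrder T u
  have hT := S.natDegree_pos
  have hk : 0 < k := powerOrder_pos hT u
  set ρ := powerChartInv hT u
  set ψ := powerChart hT u
  obtain ⟨δ, hδ, hδs⟩ := exists_radius hk (sub_pos.2 (segLo_lt_segHi S.mem b))
  have hIoo : ∀ s ∈ Ioc 0 δ, v + σ * s ^ k ∈ Ioo (segLo τ b) (segHi τ b) := fun s hs => by
    have := hδs s hs
    cases e <;> simp [hv, hσ] <;> constructor <;> linarith [this.1, this.2]
  have hray := tendsto_ray ω
  have hev : ∀ᶠ s : ℝ in 𝓝 0, AnalyticAt ℂ ρ (ω * s) ∧ ψ (ρ (ω * s)) = ω * s :=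
    (hray.eventually (analyticAt_powerChartInv hT u).eventually_analyticAt).and
      (eventually_powerChart_ray hT u ω)
  obtain ⟨η, hη, hηs⟩ := mem_nhdsGE_iff_exists_Icc_subset.1
    (inter_mem (mem_nhdsWithin_of_mem_nhds hev) (Icc_mem_nhdsGE hδ))
  have hη : (0 : ℝ) < η := hη
  have hval : ∀ s ∈ Icc 0 η, T.eval (ρ (ω * s)) = ((v + σ * s ^ k : ℝ) : ℂ) := fun s hs => by
    rw [eval_eq_powerChart hT u, show powerChart hT u (ρ (ω * s)) = ω * s from (hηs hs).1.2,
      mul_pow, hω, hu]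
    push_cast
    rfl
  have hηm : η ∈ Ioc 0 η := ⟨hη, le_rfl⟩
  have hIoo' : ∀ s ∈ Ioc 0 η, v + σ * s ^ k ∈ Ioo (segLo τ b) (segHi τ b) := fun s hs =>
    hIoo s ⟨hs.1, (hηs (Ioc_subset_Icc_self hs)).2.2⟩
  obtain ⟨E, rfl, hE⟩ := S.cover b _ (hIoo' η hηm) _ (hval η (Ioc_subset_Icc_self hηm))
  have hEcont : ContinuousOn (fun s => S.z E (v + σ * s ^ k)) (Icc 0 η) := by
    refine (S.sec E).cont.comp (by fun_prop) fun s hs => ?_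
    rcases hs.1.eq_or_lt with rfl | h
    · rw [zero_pow hk.ne', mul_zero, add_zero]
      exact S.base_mem (E, e)
    · exact Ioo_subset_Icc_self (hIoo' s ⟨h, hs.2⟩)
  have hρcont : ContinuousOn (fun s : ℝ => ρ (ω * s)) (Icc 0 η) := fun s hs => by
    have h1 : ContinuousAt ρ (ω * s) := (hηs hs).1.1.continuousAt
    have h2 : ContinuousAt (fun s : ℝ => ω * (s : ℂ)) s := by fun_prop
    exact (ContinuousAt.comp (f := fun s : ℝ => ω * (s : ℂ)) h1 h2).continuousWithinAt
  have heq : EqOn (fun s => S.z E (v + σ * s ^ k)) (fun s : ℝ => ρ (ω * s)) (Ioc 0 η) := by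
    refine eqOn_of_eval_eq (T := T) isPreconnected_Ioc (hEcont.mono Ioc_subset_Icc_self)
      (hρcont.mono Ioc_subset_Icc_self) (fun s hs => ?_) (fun s hs => ?_) hηm hE
    · rw [(S.sec E).eval _ (Ioo_subset_Icc_self (hIoo' s hs)), hval s (Ioc_subset_Icc_self hs)]
    · exact S.regular _ _ (hIoo' s hs) _ ((S.sec E).eval _ (Ioo_subset_Icc_self (hIoo' s hs)))
  have heq' : EqOn (fun s => S.z E (v + σ * s ^ k)) (fun s : ℝ => ρ (ω * s)) (Icc 0 η) :=
    heq.of_subset_closure hEcont hρcont Ioc_subset_Icc_self (by rw [closure_Ioc hη.ne])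
  have hpt : S.pt (E, e) = u := by
    have h1 := heq' ⟨le_rfl, hη.le⟩
    simp only [zero_pow hk.ne', mul_zero, add_zero, Complex.ofReal_zero] at h1
    rw [show ρ 0 = u from powerChartInv_zero hT u] at h1
    exact h1
  refine ⟨(E, e), rfl, rfl, hpt, ?_⟩
  have hg := S.germ (E, e)
  simp only [ord, hpt] at hg
  have hev2 := ((hg.filter_mono (nhdsWithin_mono _ Ioi_subset_Ici_self)).and
    (Ioc_mem_nhdsGT hη)).and (mem_nhdsWithin_of_mem_nhds
      (eventually_powerChart_ray hT u (S.dir (E, e))))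
  obtain ⟨s, ⟨h1, h2⟩, h3⟩ := hev2.exists
  have h4 : ρ (S.dir (E, e) * s) = ρ (ω * s) := by
    exact h1.symm.trans (heq h2)
  have h5 := congrArg ψ h4
  rw [(hηs (Ioc_subset_Icc_self h2)).1.2, show ψ (ρ (S.dir (E, e) * s)) = _ from h3] at h5
  exact mul_right_cancel₀ (by exact_mod_cast h2.1.ne') h5

end EdgeSystem

/-! ### Edges are analytic arcs -/

theorem IsSection.analyticAt {T : ℂ[X]} {l r : ℝ} {z : ℝ → ℂ} (h : IsSection T l r z)
    (hreg : RegularOver T l r) {x : ℝ} (hx : x ∈ Ioo l r) :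
    AnalyticAt ℝ z x ∧ deriv z x ≠ 0 := by
  have hxT := h.eval x (Ioo_subset_Icc_self hx)
  have hd := hreg x hx _ hxT
  have hTa : AnalyticAt ℂ (fun w => T.eval w) (z x) := T.differentiable.analyticAt _
  have hd' : deriv (fun w => T.eval w) (z x) ≠ 0 := by rwa [Polynomial.deriv]
  have hinv := hTa.analyticAt_localInverse hd'
  have hl := hTa.hasStrictDerivAt.eventually_left_inverse hd'
  have hdinv := (hTa.hasStrictDerivAt.to_localInverse hd').hasDerivAt
  simp only [hxT] at hinv hdinv
  set g := hTa.hasStrictDerivAt.localInverse _ _ _ hd'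
  have hof : AnalyticAt ℝ (fun y : ℝ => (y : ℂ)) x := Complex.ofRealCLM.analyticAt x
  have hga : AnalyticAt ℝ (fun y : ℝ => g y) x :=
    AnalyticAt.fun_comp (g := g) hinv.restrictScalars hof
  have heq : (fun y : ℝ => g y) =ᶠ[𝓝 x] z := by
    have hc : ContinuousAt z x := h.cont.continuousAt (Icc_mem_nhds hx.1 hx.2)
    filter_upwards [hc.eventually hl, Icc_mem_nhds hx.1 hx.2] with y h1 h2
    rw [← h1, h.eval y h2]
  refine ⟨hga.congr heq, ?_⟩
  rw [← heq.deriv_eq]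
  rw [hdinv.comp_ofReal.deriv]
  exact inv_ne_zero hd'

theorem analyticAt_comp_ray {ρ : ℂ → ℂ} (hρ : AnalyticAt ℂ ρ 0) (hρd : deriv ρ 0 ≠ 0) {ω : ℂ}
    (hω : ω ≠ 0) {q : ℝ → ℝ} {t q' : ℝ} (hq : AnalyticAt ℝ q t) (hq0 : q t = 0)
    (hqd : HasDerivAt q q' t) (hq' : q' ≠ 0) :
    AnalyticAt ℝ (fun s => ρ (ω * q s)) t ∧ deriv (fun s => ρ (ω * q s)) t ≠ 0 := by
  have h1 : AnalyticAt ℝ (fun s => ω * (q s : ℂ)) t :=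
    analyticAt_const.mul ((Complex.ofRealCLM.analyticAt _).comp hq)
  have h0 : ω * (q t : ℂ) = 0 := by simp [hq0]
  have hρ' : AnalyticAt ℂ ρ (ω * (q t : ℂ)) := by rwa [h0]
  refine ⟨AnalyticAt.fun_comp (g := ρ) hρ'.restrictScalars h1, ?_⟩
  have h2 : HasDerivAt (fun s => ω * (q s : ℂ)) (ω * (q' : ℂ)) t := hqd.ofReal_comp.const_mul ω
  have h3 := HasDerivAt.scomp (𝕜 := ℝ) (𝕜' := ℂ) (g₁ := ρ) t hρ'.differentiableAt.hasDerivAt h2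
  rw [show (fun s => ρ (ω * q s)) = ρ ∘ fun s => ω * (q s : ℂ) from rfl, h3.deriv, h0]
  exact smul_ne_zero (mul_ne_zero hω (by exact_mod_cast hq')) hρd

namespace EdgeSystem

variable {T : ℂ[X]} {τ : ℝ} (S : EdgeSystem T τ)

theorem exists_arc (e : S.Edge) : ∃ γ, IsAnalyticJordanArc γ ∧ arcSet γ = S.img e ∧
    γ 0 = S.pt (e, false) ∧ γ 1 = S.pt (e, true) := by
  set k := S.ord (e, false)
  set m := S.ord (e, true)
  have hk : 0 < k := S.ord_pos _
  have hm : 0 < m := S.ord_pos _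
  set d := S.hi e - S.lo e with hd
  have hdpos : 0 < d := sub_pos.2 (S.lo_lt_hi e)
  -- Chosen so that `P` vanishes to order `k` at `0` and `1 - P` to order `m` at `1`. Composing with
  -- it removes the branching of the edge at both ends.
  set P : ℝ → ℝ := fun s => 1 - (1 - s ^ k) ^ m
  have hPmono : StrictMonoOn P (Icc 0 1) := fun s hs t ht hst => by
    have h1 : s ^ k < t ^ k := pow_lt_pow_left₀ hst hs.1 hk.ne'
    have h2 : t ^ k ≤ 1 := pow_le_one₀ ht.1 ht.2
    have h3 : (1 - t ^ k) ^ m < (1 - s ^ k) ^ m :=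
      pow_lt_pow_left₀ (by linarith) (by linarith) hm.ne'
    simp only [P]
    linarith
  have hP0 : P 0 = 0 := by simp [P, hk.ne']
  have hP1 : P 1 = 1 := by simp [P, hm.ne']
  have hPc : Continuous P := by fun_prop
  have hPmem : ∀ s ∈ Icc (0 : ℝ) 1, P s ∈ Icc (0 : ℝ) 1 := fun s hs => by
    have h1 := hPmono.monotoneOn (by simp) hs hs.1
    have h2 := hPmono.monotoneOn hs (by simp) hs.2
    rw [hP0] at h1; rw [hP1] at h2
    exact ⟨h1, h2⟩
  set x : ℝ → ℝ := fun s => S.lo e + d * P s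
  have hxmem : ∀ s ∈ Icc (0 : ℝ) 1, x s ∈ Icc (S.lo e) (S.hi e) := fun s hs => by
    have := hPmem s hs
    constructor <;> simp only [x] <;> nlinarith [this.1, this.2]
  have hxIoo : ∀ s ∈ Ioo (0 : ℝ) 1, x s ∈ Ioo (S.lo e) (S.hi e) := fun s hs => by
    have h1 := hPmono (by simp) (Ioo_subset_Icc_self hs) hs.1
    have h2 := hPmono (Ioo_subset_Icc_self hs) (by simp) hs.2
    rw [hP0] at h1; rw [hP1] at h2
    constructor <;> simp only [x] <;> nlinarith
  have hximg : x '' Icc 0 1 = Icc (S.lo e) (S.hi e) := by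
    refine Subset.antisymm (image_subset_iff.2 hxmem) ?_
    have := intermediate_value_Icc (zero_le_one' ℝ) (f := x) (by fun_prop)
    simpa [x, hP0, hP1, hd] using this
  have hx0 : x 0 = S.lo e := by simp [x, hP0]
  have hx1 : x 1 = S.hi e := by simp [x, hP1, hd]
  -- germ at the lower end
  set ρ₀ := powerChartInv S.natDegree_pos (S.pt (e, false))
  -- The geometric sum gives `d * P s = s ^ k * G s` with `G 0 > 0`, so `q₀` is an analytic `k`-th
  -- root of `d * P` with a simple zero at `0`.
  set G : ℝ → ℝ := fun s => d * ∑ i ∈ Finset.range m, (1 - s ^ k) ^ i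
  set q₀ : ℝ → ℝ := fun s => s * G s ^ (1 / k : ℝ)
  have hG0 : 0 < G 0 := by
    have : G 0 = d * m := by simp [G, hk.ne']
    rw [this]
    positivity
  have hGc : Continuous G := by fun_prop
  have hGa : AnalyticAt ℝ G 0 := by
    have : G = fun s => (C d * ∑ i ∈ Finset.range m, (1 - X ^ k) ^ i : ℝ[X]).eval s := by
      ext s
      simp [G, eval_finsetSum]
    rw [this]
    exact AnalyticAt.aeval_polynomial analyticAt_id _
  have hGpa : AnalyticAt ℝ (fun s => G s ^ (1 / k : ℝ)) 0 :=
    AnalyticAt.fun_comp (g := fun y : ℝ => y ^ (1 / k : ℝ))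
      (Real.contDiffAt_rpow_const_of_ne hG0.ne').analyticAt hGa
  have hq₀a : AnalyticAt ℝ q₀ 0 := analyticAt_id.mul hGpa
  have hq₀0 : q₀ 0 = 0 := by simp [q₀]
  have hq₀d : HasDerivAt q₀ (G 0 ^ (1 / k : ℝ)) 0 := by
    have h1 := (hasDerivAt_id (0 : ℝ)).fun_mul hGpa.differentiableAt.hasDerivAt
    simp only [id_eq, one_mul, zero_mul, add_zero] at h1
    exact h1
  have hGpow : ∀ s, 0 ≤ G s → q₀ s ^ k = d * P s := fun s hs => by
    have h1 := mul_neg_geom_sum (1 - s ^ k) m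
    simp only [q₀, mul_pow, one_div]
    rw [Real.rpow_inv_natCast_pow hs hk.ne']
    simp only [G, P]
    rw [← h1]
    ring
  obtain ⟨hγ₀, hγ₀d⟩ := analyticAt_comp_ray (analyticAt_powerChartInv S.natDegree_pos _)
    (deriv_powerChartInv_ne S.natDegree_pos (S.pt (e, false))) (S.dir_ne_zero (e, false))
    hq₀a hq₀0 hq₀d (Real.rpow_pos_of_pos hG0 _).ne'
  have hgerm₀ : ∀ᶠ s in 𝓝[≥] (0 : ℝ), S.z e (x s) = ρ₀ (S.dir (e, false) * q₀ s) := by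
    have hGpos : ∀ᶠ s in 𝓝[≥] (0 : ℝ), 0 < G s :=
      mem_nhdsWithin_of_mem_nhds (hGc.continuousAt.eventually (lt_mem_nhds hG0))
    have hq₀t : Tendsto q₀ (𝓝[≥] 0) (𝓝[≥] 0) := by
      refine tendsto_nhdsWithin_iff.2 ⟨?_, ?_⟩
      · have := hq₀a.continuousAt.tendsto
        rw [hq₀0] at this
        exact this.mono_left nhdsWithin_le_nhds
      · filter_upwards [hGpos, self_mem_nhdsWithin] with s h1 h2
        exact mul_nonneg h2 (Real.rpow_nonneg h1.le _)
    filter_upwards [hq₀t.eventually (S.germ (e, false)), hGpos] with s h1 h2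
    refine Eq.trans ?_ h1
    simp only [base, sgn, Bool.false_eq_true, if_false, one_mul]
    rw [hGpow s h2.le]
  -- germ at the upper end
  set ρ₁ := powerChartInv S.natDegree_pos (S.pt (e, true))
  set q₁ : ℝ → ℝ := fun s => d ^ (1 / m : ℝ) * (1 - s ^ k)
  have hdm : 0 < d ^ (1 / m : ℝ) := Real.rpow_pos_of_pos hdpos _
  have hq₁a : AnalyticAt ℝ q₁ 1 :=
    analyticAt_const.mul (analyticAt_const.sub (analyticAt_id.pow k))
  have hq₁0 : q₁ 1 = 0 := by simp [q₁]
  have hq₁d : HasDerivAt q₁ (d ^ (1 / m : ℝ) * -(k * 1 ^ (k - 1))) 1 :=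
    ((hasDerivAt_pow k (1 : ℝ)).const_sub 1).const_mul _
  have hq₁pow : ∀ s, q₁ s ^ m = d * (1 - P s) := fun s => by
    simp only [q₁, mul_pow, one_div]
    rw [Real.rpow_inv_natCast_pow hdpos.le hm.ne']
    simp only [P]
    ring
  obtain ⟨hγ₁, hγ₁d⟩ := analyticAt_comp_ray (analyticAt_powerChartInv S.natDegree_pos _)
    (deriv_powerChartInv_ne S.natDegree_pos (S.pt (e, true))) (S.dir_ne_zero (e, true))
    hq₁a hq₁0 hq₁d (by
      rw [one_pow, mul_one, mul_neg, neg_ne_zero]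
      positivity)
  have hgerm₁ : ∀ᶠ s in 𝓝[≤] (1 : ℝ), S.z e (x s) = ρ₁ (S.dir (e, true) * q₁ s) := by
    have hq₁t : Tendsto q₁ (𝓝[≤] 1) (𝓝[≥] 0) := by
      refine tendsto_nhdsWithin_iff.2 ⟨?_, ?_⟩
      · have := hq₁a.continuousAt.tendsto
        rw [hq₁0] at this
        exact this.mono_left nhdsWithin_le_nhds
      · filter_upwards [self_mem_nhdsWithin,
          mem_nhdsWithin_of_mem_nhds (lt_mem_nhds one_pos)] with s h1 h2
        exact mul_nonneg hdm.le (sub_nonneg.2 (pow_le_one₀ h2.le h1))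
    filter_upwards [hq₁t.eventually (S.germ (e, true))] with s h1
    refine Eq.trans ?_ h1
    simp only [base, sgn, if_true]
    rw [hq₁pow s]
    congr 1
    simp only [x, hd]
    ring
  -- Outside `[0, 1]` the edge is prolonged by its germs at the ends, since analyticity is required
  -- in full neighbourhoods of `0` and `1`.
  set γ : ℝ → ℂ := fun s => if s < 0 then ρ₀ (S.dir (e, false) * q₀ s) else
    if s ≤ 1 then S.z e (x s) else ρ₁ (S.dir (e, true) * q₁ s)
  have hγin : ∀ s ∈ Icc (0 : ℝ) 1, γ s = S.z e (x s) := fun s hs => by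
    simp only [γ]
    rw [if_neg (not_lt.2 hs.1), if_pos hs.2]
  have h0 : γ =ᶠ[𝓝 0] fun s => ρ₀ (S.dir (e, false) * q₀ s) := by
    rw [eventually_nhdsWithin_iff] at hgerm₀
    filter_upwards [hgerm₀, gt_mem_nhds one_pos] with s h1 h2
    rcases lt_or_ge s 0 with h | h
    · exact if_pos h
    · rw [hγin s ⟨h, h2.le⟩, h1 h]
  have h1 : γ =ᶠ[𝓝 1] fun s => ρ₁ (S.dir (e, true) * q₁ s) := by
    rw [eventually_nhdsWithin_iff] at hgerm₁
    filter_upwards [hgerm₁, lt_mem_nhds one_pos] with s h1 h2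
    rcases le_or_gt s 1 with h | h
    · rw [hγin s ⟨h2.le, h⟩, h1 h]
    · simp only [γ]
      rw [if_neg (not_lt.2 h2.le), if_neg (not_le.2 h)]
  have hin : ∀ s ∈ Ioo (0 : ℝ) 1, AnalyticAt ℝ γ s ∧ deriv γ s ≠ 0 := fun s hs => by
    have heq : γ =ᶠ[𝓝 s] fun s => S.z e (x s) := by
      filter_upwards [Icc_mem_nhds hs.1 hs.2] with t ht using hγin t ht
    obtain ⟨hz, hzd⟩ := (S.sec e).analyticAt (S.regular _) (hxIoo s hs)
    have hxd : HasDerivAt x (d * -(m * (1 - s ^ k) ^ (m - 1) * -(k * s ^ (k - 1)))) s :=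
      ((((hasDerivAt_pow k s).const_sub 1).fun_pow m).const_sub 1).const_mul d |>.const_add _
    have hxa : AnalyticAt ℝ x s := analyticAt_const.add (analyticAt_const.mul
      (analyticAt_const.sub ((analyticAt_const.sub (analyticAt_id.pow k)).pow m)))
    refine ⟨(AnalyticAt.fun_comp (g := S.z e) hz hxa).congr heq.symm, ?_⟩
    rw [heq.deriv_eq]
    have h3 := HasDerivAt.scomp s hz.differentiableAt.hasDerivAt hxd
    rw [show (fun s => S.z e (x s)) = S.z e ∘ x from rfl, h3.deriv]
    refine smul_ne_zero ?_ hzd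
    have h4 : s ^ k < 1 := pow_lt_one₀ hs.1.le hs.2 hk.ne'
    have h5 : 0 < 1 - s ^ k := by linarith
    have h6 := hs.1
    simp only [mul_neg, neg_neg]
    positivity
  have hall : ∀ s ∈ Icc (0 : ℝ) 1, AnalyticAt ℝ γ s ∧ deriv γ s ≠ 0 := fun s hs => by
    rcases hs.1.eq_or_lt with rfl | h
    · refine ⟨hγ₀.congr h0.symm, ?_⟩
      rw [h0.deriv_eq]
      exact hγ₀d
    rcases hs.2.eq_or_lt with rfl | h'
    · refine ⟨hγ₁.congr h1.symm, ?_⟩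
      rw [h1.deriv_eq]
      exact hγ₁d
    exact hin s ⟨h, h'⟩
  refine ⟨γ, ⟨fun s hs => (hall s hs).1, fun s hs t ht hst => ?_, fun s hs => (hall s hs).2⟩,
    ?_, ?_, ?_⟩
  · rw [hγin s hs, hγin t ht] at hst
    have h2 := (S.sec e).injOn (hxmem s hs) (hxmem t ht) hst
    simp only [x] at h2
    exact hPmono.injOn hs ht (mul_left_cancel₀ hdpos.ne' (add_left_cancel h2))
  · rw [arcSet, img, ← hximg, image_image]
    exact image_congr hγin
  · rw [hγin 0 (by simp), hx0]
    simp [pt, base]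
  · rw [hγin 1 (by simp), hx1]
    simp [pt, base]

/-- Each edge is a unit-speed analytic arc, starting from any of its ends. -/
theorem exists_isUnitArc (f : S.Flag) : ∃ (c : ℝ → ℂ) (L : ℝ), IsUnitArc c L ∧ c 0 = S.pt f ∧
    c L = S.pt (S.flip f) ∧ c '' Icc 0 L = S.img f.1 := by
  obtain ⟨γ, hγ, himg, h0, h1⟩ := S.exists_arc f.1
  obtain ⟨c, L, hc, hc0, hcL, hcimg⟩ := hγ.exists_isUnitArc
  rcases f with ⟨e, _ | _⟩
  · exact ⟨c, L, hc, hc0.trans h0, hcL.trans h1, hcimg.trans himg⟩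
  · refine ⟨_, L, hc.reverse, ?_, ?_, ?_⟩
    · simpa using hcL.trans h1
    · simpa [flip] using hc0.trans h0
    · rw [image_reverse_Icc, hcimg, himg]

theorem isCompact_img (e : S.Edge) : IsCompact (S.img e) :=
  isCompact_Icc.image_of_continuousOn (S.sec e).cont

/-- Near its end, an edge lies on a ray of the power chart. -/
theorem eventually_mem_ray (f : S.Flag) : ∀ᶠ y in 𝓝 (S.pt f), y ∈ S.img f.1 →
    ∃ s : ℝ, 0 ≤ s ∧ powerChart S.natDegree_pos (S.pt f) y = S.dir f * s := by
  have hk := S.ord_pos f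
  obtain ⟨η, hη, hs⟩ := mem_nhdsGE_iff_exists_Icc_subset.1 (inter_mem (S.germ f)
    (mem_nhdsWithin_of_mem_nhds (eventually_powerChart_ray S.natDegree_pos (S.pt f) (S.dir f))))
  have hη : (0 : ℝ) < η := hη
  -- The part of the edge beyond the range of the germ. It is compact and misses the end point, so
  -- nearby points of the edge are described by the germ.
  set K := S.z f.1 '' (Icc (S.lo f.1) (S.hi f.1) ∩ {x | η ^ S.ord f ≤ |x - S.base f|})
  have hK : IsClosed K := by
    refine IsCompact.isClosed (IsCompact.image_of_continuousOn ?_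
      ((S.sec f.1).cont.mono inter_subset_left))
    exact isCompact_Icc.inter_right (isClosed_le (by fun_prop) (by fun_prop))
  have hpt : S.pt f ∉ K := by
    rintro ⟨x, ⟨hx, hx'⟩, hxp⟩
    have := (S.sec f.1).injOn hx (S.base_mem f) hxp
    have hpos := pow_pos hη (S.ord f)
    simp only [this, sub_self, abs_zero, mem_ofPred_eq] at hx'
    linarith
  filter_upwards [hK.isOpen_compl.mem_nhds hpt] with y hyK hy
  obtain ⟨x, hx, rfl⟩ := hy
  have hlt : |x - S.base f| < η ^ S.ord f := by
    by_contra h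
    exact hyK ⟨x, ⟨hx, not_lt.1 h⟩, rfl⟩
  set s := |x - S.base f| ^ ((S.ord f : ℝ)⁻¹)
  have hs0 : 0 ≤ s := Real.rpow_nonneg (abs_nonneg _) _
  have hspow : s ^ S.ord f = |x - S.base f| := Real.rpow_inv_natCast_pow (abs_nonneg _) hk.ne'
  have hsη : s ≤ η := by
    by_contra h
    have := pow_lt_pow_left₀ (not_le.1 h) hη.le hk.ne'
    rw [hspow] at this
    linarith
  have hxs : S.base f + S.sgn f * s ^ S.ord f = x := by
    rw [hspow]
    rcases f with ⟨e, _ | _⟩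
    · simp only [base, sgn, Bool.false_eq_true, if_false]
      rw [abs_of_nonneg (sub_nonneg.2 hx.1)]
      ring
    · simp only [base, sgn, if_true]
      rw [abs_of_nonpos (sub_nonpos.2 hx.2)]
      ring
  have h1 := hs ⟨hs0, hsη⟩
  refine ⟨s, hs0, ?_⟩
  have h2 := h1.1
  have h3 := h1.2
  simp only [mem_ofPred_eq] at h2 h3
  rw [hxs] at h2
  rw [h2, h3]

end EdgeSystem

/-! ### The edges form a forest -/

theorem Polynomial.exists_derivative_eq (P : ℂ[X]) : ∃ K : ℂ[X], derivative K = P := by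
  induction P using Polynomial.induction_on' with
  | add p q hp hq =>
    obtain ⟨K, rfl⟩ := hp
    obtain ⟨K', rfl⟩ := hq
    exact ⟨K + K', derivative_add⟩
  | monomial n a =>
    refine ⟨monomial (n + 1) (a / (n + 1)), ?_⟩
    rw [derivative_monomial]
    have : (n + 1 : ℂ) ≠ 0 := by exact_mod_cast n.succ_ne_zero
    simp [this]

/-- Replacing one factor of `∫ a²` by a Weierstrass approximation `p` changes the integral to `0`;
the value of `ε` makes the error smaller than the integral itself. -/
theorem eq_zero_of_forall_polynomial_integral {a : ℝ → ℝ} {l r : ℝ} (hlr : l < r)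
    (ha : ContinuousOn a (Icc l r)) (h : ∀ p : ℝ[X], ∫ t in l..r, p.eval t * a t = 0) :
    ∀ t ∈ Icc l r, a t = 0 := by
  by_contra! hcon
  obtain ⟨t₀, ht₀, hat₀⟩ := hcon
  have hpos : 0 < ∫ t in l..r, a t * a t := by
    refine intervalIntegral.integral_pos hlr (ha.mul ha) (fun t _ => mul_self_nonneg _)
      ⟨t₀, ht₀, mul_self_pos.2 hat₀⟩
  obtain ⟨M, hM⟩ := isCompact_Icc.exists_bound_of_continuousOn ha
  have hM0 : 0 ≤ M := (norm_nonneg _).trans (hM t₀ ht₀)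
  set I := ∫ t in l..r, a t * a t
  set ε := I / (2 * (M + 1) * (r - l))
  have hrl : 0 < r - l := sub_pos.2 hlr
  have hε : 0 < ε := by positivity
  obtain ⟨p, hp⟩ := exists_polynomial_near_of_continuousOn l r a ha ε hε
  have hu : uIcc l r = Icc l r := uIcc_of_le hlr.le
  have hi1 : IntervalIntegrable (fun t => a t * a t) MeasureTheory.volume l r :=
    ContinuousOn.intervalIntegrable (by rw [hu]; exact ha.mul ha)
  have hi2 : IntervalIntegrable (fun t => p.eval t * a t) MeasureTheory.volume l r :=
    ContinuousOn.intervalIntegrable (by rw [hu]; exact p.continuousOn.mul ha)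
  have h1 : I = ∫ t in l..r, (a t * a t - p.eval t * a t) := by
    rw [intervalIntegral.integral_sub hi1 hi2, h p, sub_zero]
  have h2 : ‖∫ t in l..r, (a t * a t - p.eval t * a t)‖ ≤ (ε * M) * |r - l| := by
    refine intervalIntegral.norm_integral_le_of_norm_le_const fun t ht => ?_
    rw [uIoc_of_le hlr.le] at ht
    have ht' := Ioc_subset_Icc_self ht
    rw [← sub_mul, norm_mul]
    refine mul_le_mul ?_ (hM t ht') (norm_nonneg _) hε.le
    rw [Real.norm_eq_abs, abs_sub_comm]
    exact (hp t ht').le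
  rw [← h1, abs_of_pos hrl, Real.norm_eq_abs, abs_of_pos hpos] at h2
  have h3 : ε * M * (r - l) < I := by
    have h4 : ε * (2 * (M + 1) * (r - l)) = I := div_mul_cancel₀ _ (by positivity)
    nlinarith [mul_pos hε hrl]
  linarith

theorem eq_zero_of_forall_polynomial_integral_complex {Ψ : ℝ → ℂ} {l r : ℝ} (hlr : l < r)
    (hΨ : ContinuousOn Ψ (Icc l r))
    (h : ∀ p : ℝ[X], ∫ t in l..r, ((p.eval t : ℝ) : ℂ) * Ψ t = 0) :
    ∀ t ∈ Icc l r, Ψ t = 0 := by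
  have hu : uIcc l r = Icc l r := uIcc_of_le hlr.le
  have hi : ∀ p : ℝ[X], IntervalIntegrable (fun t => ((p.eval t : ℝ) : ℂ) * Ψ t)
      MeasureTheory.volume l r := fun p => ContinuousOn.intervalIntegrable (by
    rw [hu]
    exact (Complex.continuous_ofReal.comp p.continuous).continuousOn.mul hΨ)
  have hre : ∀ t ∈ Icc l r, (Ψ t).re = 0 := by
    refine eq_zero_of_forall_polynomial_integral hlr
      (Complex.continuous_re.comp_continuousOn hΨ) fun p => ?_
    have := Complex.reCLM.intervalIntegral_comp_comm (hi p)
    rw [h p] at this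
    simpa using this
  have him : ∀ t ∈ Icc l r, (Ψ t).im = 0 := by
    refine eq_zero_of_forall_polynomial_integral hlr
      (Complex.continuous_im.comp_continuousOn hΨ) fun p => ?_
    have := Complex.imCLM.intervalIntegral_comp_comm (hi p)
    rw [h p] at this
    simpa using this
  exact fun t ht => Complex.ext (hre t ht) (him t ht)

theorem IsSection.hasDerivAt {T : ℂ[X]} {l r : ℝ} {z : ℝ → ℂ} (h : IsSection T l r z)
    (hreg : RegularOver T l r) {x : ℝ} (hx : x ∈ Ioo l r) :
    ∃ z', HasDerivAt z z' x ∧ T.derivative.eval (z x) * z' = 1 := by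
  have hd := (h.analyticAt hreg hx).1.differentiableAt.hasDerivAt
  refine ⟨_, hd, ?_⟩
  have h1 : HasDerivAt (fun x => T.eval (z x)) (deriv z x • T.derivative.eval (z x)) x :=
    HasDerivAt.scomp (𝕜 := ℝ) (𝕜' := ℂ) x (T.hasDerivAt (z x)) hd
  have h2 : HasDerivAt (fun x : ℝ => (x : ℂ)) 1 x := by
    simpa using (hasDerivAt_id x).ofReal_comp
  have h3 : (fun x => T.eval (z x)) =ᶠ[𝓝 x] fun x : ℝ => (x : ℂ) := by
    filter_upwards [Icc_mem_nhds hx.1 hx.2] with y hy using h.eval y hy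
  rw [mul_comm]
  exact h1.unique (h2.congr_of_eventuallyEq h3)

/-- Substituting `w = z t`, `dt = T'(w) dw` turns the left side into the integral of `g(T) T' Q`
along the edge, which depends only on the ends. -/
theorem IsSection.integral_eq {T : ℂ[X]} {l r : ℝ} (hlr : l < r) {z : ℝ → ℂ}
    (h : IsSection T l r z) (hreg : RegularOver T l r) (g Q K : ℂ[X])
    (hK : derivative K = g.comp T * derivative T * Q) :
    ∫ t in l..r, g.eval (t : ℂ) * Q.eval (z t) = K.eval (z r) - K.eval (z l) := by
  refine intervalIntegral.integral_eq_sub_of_hasDerivAt_of_le (f := fun t => K.eval (z t)) hlr.le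
    (K.continuous.comp_continuousOn h.cont) (fun t ht => ?_) ?_
  · obtain ⟨z', hz', hz1⟩ := h.hasDerivAt hreg ht
    have h1 : HasDerivAt (fun x => K.eval (z x)) (z' • K.derivative.eval (z t)) t :=
      HasDerivAt.scomp (𝕜 := ℝ) (𝕜' := ℂ) t (K.hasDerivAt (z t)) hz'
    have h2 : g.eval (t : ℂ) * Q.eval (z t) = z' • K.derivative.eval (z t) := by
      rw [hK, eval_mul, eval_mul, eval_comp, h.eval t (Ioo_subset_Icc_self ht), smul_eq_mul]
      linear_combination (-(g.eval (t : ℂ)) * Q.eval (z t)) * hz1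
    rwa [h2]
  · refine ContinuousOn.intervalIntegrable ?_
    rw [uIcc_of_le hlr.le]
    exact (g.continuous.comp Complex.continuous_ofReal).continuousOn.mul
      (Q.continuous.comp_continuousOn h.cont)

namespace EdgeSystem

variable {T : ℂ[X]} {τ : ℝ} (S : EdgeSystem T τ)

/-- The hypothesis, applied to a primitive `K` of `g(T) T' Q` in place of `Q`, says that the sum, as
a function of `t`, is orthogonal to every polynomial `g` on `[-1, 1]`. Hence it vanishes. -/
theorem sum_eval_eq_zero {x : S.Edge → ℂ}
    (h : ∀ Q : ℂ[X], ∑ e, x e * (Q.eval (S.pt (e, true)) - Q.eval (S.pt (e, false))) = 0)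
    (Q : ℂ[X]) (b : Bool) (t : ℝ) (ht : t ∈ Ioo (segLo τ b) (segHi τ b)) :
    ∑ e with S.side e = b, x e * Q.eval (S.z e t) = 0 := by
  classical
  set Φ : Bool → ℝ → ℂ := fun b t => ∑ e with S.side e = b, x e * Q.eval (S.z e t)
  have hΦ : ∀ b, ContinuousOn (Φ b) (Icc (segLo τ b) (segHi τ b)) := fun b => by
    refine continuousOn_finsetSum _ fun e he => ?_
    have hb : S.side e = b := by simpa using he
    have := (S.sec e).cont
    rw [hb] at this
    exact continuousOn_const.mul (Q.continuous.comp_continuousOn this)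
  have hint : ∀ g : ℂ[X], (∫ t in (-1 : ℝ)..τ, g.eval (t : ℂ) * Φ false t) +
      ∫ t in τ..(1 : ℝ), g.eval (t : ℂ) * Φ true t = 0 := fun g => by
    obtain ⟨K, hK⟩ := exists_derivative_eq (g.comp T * derivative T * Q)
    have hb : ∀ b, ∫ t in (segLo τ b)..(segHi τ b), g.eval (t : ℂ) * Φ b t =
        ∑ e with S.side e = b, x e * (K.eval (S.pt (e, true)) - K.eval (S.pt (e, false))) :=
      fun b => by
      simp only [Φ, Finset.mul_sum]
      rw [intervalIntegral.integral_finsetSum]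
      · refine Finset.sum_congr rfl fun e he => ?_
        obtain rfl : S.side e = b := by simpa using he
        have h1 := (S.sec e).integral_eq (segLo_lt_segHi S.mem _) (S.regular _) g Q K hK
        rw [show K.eval (S.pt (e, true)) - K.eval (S.pt (e, false)) =
          K.eval (S.z e (segHi τ (S.side e))) - K.eval (S.z e (segLo τ (S.side e))) by
            simp [pt, base, hi, lo], ← h1, ← intervalIntegral.integral_const_mul]
        congr 1
        ext t
        ring
      · intro e he
        obtain rfl : S.side e = b := by simpa using he
        refine ContinuousOn.intervalIntegrable ?_
        rw [uIcc_of_le (segLo_lt_segHi S.mem _).le]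
        exact (g.continuous.comp Complex.continuous_ofReal).continuousOn.mul
          (continuousOn_const.mul (Q.continuous.comp_continuousOn (S.sec e).cont))
    have hf := hb false
    have ht := hb true
    simp only [segLo, segHi] at hf ht
    rw [hf, ht, ← h K, add_comm, ← Finset.sum_filter_add_sum_filter_not Finset.univ
      (fun e => S.side e = true)]
    simp
  -- the two pieces, multiplied by `t - τ`, fit together continuously
  set Ψ : ℝ → ℂ := fun t => ((t - τ : ℝ) : ℂ) * if t ≤ τ then Φ false t else Φ true t
  have hΨl : ∀ t ≤ τ, Ψ t = ((t - τ : ℝ) : ℂ) * Φ false t := fun t ht => by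
    simp only [Ψ]; rw [if_pos ht]
  have hΨr : ∀ t, τ ≤ t → Ψ t = ((t - τ : ℝ) : ℂ) * Φ true t := fun t ht => by
    rcases ht.eq_or_lt with rfl | ht
    · simp [Ψ]
    · simp only [Ψ]; rw [if_neg (not_le.2 ht)]
  have hlin : Continuous fun t : ℝ => ((t - τ : ℝ) : ℂ) := by fun_prop
  have hcl : ContinuousOn Ψ (Icc (-1) τ) :=
    (hlin.continuousOn.mul (hΦ false)).congr fun t ht => hΨl t ht.2
  have hcr : ContinuousOn Ψ (Icc τ 1) :=
    (hlin.continuousOn.mul (hΦ true)).congr fun t ht => hΨr t ht.1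
  have hm := S.mem
  have hc : ContinuousOn Ψ (Icc (-1) 1) := by
    rw [← Icc_union_Icc_eq_Icc hm.1.le hm.2.le]
    exact hcl.union_of_isClosed hcr isClosed_Icc isClosed_Icc
  have hΨ0 : ∀ t ∈ Icc (-1 : ℝ) 1, Ψ t = 0 := by
    refine eq_zero_of_forall_polynomial_integral_complex (by norm_num) hc fun p => ?_
    have hpc : Continuous fun t : ℝ => ((p.eval t : ℝ) : ℂ) :=
      Complex.continuous_ofReal.comp p.continuous
    have hil : IntervalIntegrable (fun t => ((p.eval t : ℝ) : ℂ) * Ψ t) MeasureTheory.volume (-1) τ :=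
      ContinuousOn.intervalIntegrable (by
        rw [uIcc_of_le hm.1.le]; exact hpc.continuousOn.mul hcl)
    have hir : IntervalIntegrable (fun t => ((p.eval t : ℝ) : ℂ) * Ψ t) MeasureTheory.volume τ 1 :=
      ContinuousOn.intervalIntegrable (by
        rw [uIcc_of_le hm.2.le]; exact hpc.continuousOn.mul hcr)
    -- The factor `t - τ` in `Ψ` is absorbed by the test polynomial.
    rw [← intervalIntegral.integral_add_adjacent_intervals hil hir,
      ← hint ((p.map (algebraMap ℝ ℂ)) * (X - C (τ : ℂ)))]
    have hev : ∀ t : ℝ, ((p.map (algebraMap ℝ ℂ)) * (X - C (τ : ℂ))).eval (t : ℂ) =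
        ((p.eval t : ℝ) : ℂ) * ((t - τ : ℝ) : ℂ) := fun t => by
      have : (p.map (algebraMap ℝ ℂ)).eval (t : ℂ) = ((p.eval t : ℝ) : ℂ) := by
        exact Polynomial.eval_map_apply (algebraMap ℝ ℂ) t (p := p)
      rw [eval_mul, this]
      simp
    congr 1
    · refine intervalIntegral.integral_congr fun t ht => ?_
      rw [uIcc_of_le hm.1.le] at ht
      simp only [hev, hΨl t ht.2]
      ring
    · refine intervalIntegral.integral_congr fun t ht => ?_
      rw [uIcc_of_le hm.2.le] at ht
      simp only [hev, hΨr t ht.1]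
      ring
  cases b with
  | false =>
    have ht : t ∈ Ioo (-1) τ := ht
    have h1 := hΨ0 t ⟨ht.1.le, by linarith [ht.2, hm.2]⟩
    rw [hΨl t ht.2.le] at h1
    refine (mul_eq_zero.1 h1).resolve_left ?_
    exact_mod_cast (sub_neg.2 ht.2).ne
  | true =>
    have ht : t ∈ Ioo τ 1 := ht
    have h1 := hΨ0 t ⟨by linarith [ht.1, hm.1], ht.2.le⟩
    rw [hΨr t ht.1.le] at h1
    refine (mul_eq_zero.1 h1).resolve_left ?_
    exact_mod_cast (sub_pos.2 ht.1).ne'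

/-- The edges form a forest: a chain of edges without boundary vanishes. -/
theorem chain_eq_zero {x : S.Edge → ℂ}
    (h : ∀ Q : ℂ[X], ∑ e, x e * (Q.eval (S.pt (e, true)) - Q.eval (S.pt (e, false))) = 0)
    (e₀ : S.Edge) : x e₀ = 0 := by
  classical
  set t := (S.lo e₀ + S.hi e₀) / 2
  have ht : t ∈ Ioo (S.lo e₀) (S.hi e₀) := by
    have := S.lo_lt_hi e₀
    constructor <;> simp only [t] <;> linarith
  set A : Finset S.Edge := {e | S.side e = S.side e₀ ∧ e ≠ e₀}
  -- Vanishes at the points over `t` of all other edges on the same side, so only the term of `e₀`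
  -- survives.
  set Q : ℂ[X] := ∏ e ∈ A, (X - C (S.z e t))
  have h0 : ∀ e, S.side e = S.side e₀ → e ≠ e₀ → Q.eval (S.z e t) = 0 := fun e he hne => by
    rw [eval_prod]
    exact Finset.prod_eq_zero (i := e) (by simp [A, he, hne]) (by simp)
  have h1 : Q.eval (S.z e₀ t) ≠ 0 := by
    rw [eval_prod, Finset.prod_ne_zero_iff]
    intro e he
    have he' : S.side e = S.side e₀ ∧ e ≠ e₀ := by simpa [A] using he
    simp only [eval_sub, eval_X, eval_C]
    refine sub_ne_zero.2 fun heq => he'.2 ?_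
    exact (S.disj e₀ e he'.1.symm t ht heq).symm
  have h2 := S.sum_eval_eq_zero h Q (S.side e₀) t ht
  rw [Finset.sum_eq_single e₀] at h2
  · exact (mul_eq_zero.1 h2).resolve_right h1
  · intro e he hne
    rw [h0 e (by simpa using he) hne, mul_zero]
  · intro hn
    simp at hn

end EdgeSystem

/-! ### Straight paths and the decomposition of the graph -/

/-- The points at which an inverse image arc must end: `T = ±1` to an odd order. -/
def IsTerminal (T : ℂ[X]) (u : ℂ) : Prop := T.eval u ^ 2 = 1 ∧ Odd (powerOrder T u)

namespace EdgeSystem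

variable {T : ℂ[X]} {τ : ℝ} (S : EdgeSystem T τ)

/-- At a nonterminal point, every edge is continued by an edge in the opposite direction. -/
theorem exists_opposite {f : S.Flag} (hf : ¬ IsTerminal T (S.pt f)) :
    ∃ g, S.pt g = S.pt f ∧ S.dir g = -S.dir f := by
  have hpow := S.dir_pow f
  -- For even order `-ω` has the same power as `ω`, and the continuation lies over the same segment.
  -- For odd order the sign flips; nonterminality forces the value `τ`, and the continuation lies
  -- over the other segment.
  rcases Nat.even_or_odd (S.ord f) with heven | hodd
  · obtain ⟨g, -, -, h1, h2⟩ := S.exists_flag (u := S.pt f) (b := S.side f.1) (e := f.2)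
      (ω := -S.dir f) (S.eval_pt f) (by
        rw [show powerOrder T (S.pt f) = S.ord f from rfl, heven.neg_pow, hpow]
        rfl)
    exact ⟨g, h1, h2⟩
  · have hv : ((S.base f : ℝ) : ℂ) ^ 2 ≠ 1 := fun h => hf ⟨by rw [S.eval_pt, h], hodd⟩
    have hneg : (-S.dir f) ^ powerOrder T (S.pt f) = ((-S.sgn f : ℝ) : ℂ) := by
      rw [show powerOrder T (S.pt f) = S.ord f from rfl, hodd.neg_pow, hpow]
      push_cast
      rfl
    have heval := S.eval_pt f
    rcases f with ⟨e, _ | _⟩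
    · cases hs : S.side e with
      | false => exact absurd (by simp [base, lo, hs, segLo]) hv
      | true =>
        obtain ⟨g, -, -, h1, h2⟩ := S.exists_flag (u := S.pt (e, false)) (b := false) (e := true)
          (ω := -S.dir (e, false)) (by rw [heval]; simp [base, lo, hs, segLo, segHi])
          (by rw [hneg]; simp [sgn])
        exact ⟨g, h1, h2⟩
    · cases hs : S.side e with
      | true => exact absurd (by simp [base, hi, hs, segHi]) hv
      | false =>
        obtain ⟨g, -, -, h1, h2⟩ := S.exists_flag (u := S.pt (e, true)) (b := true) (e := false)
          (ω := -S.dir (e, true)) (by rw [heval]; simp [base, hi, hs, segLo, segHi])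
          (by rw [hneg]; simp [sgn])
        exact ⟨g, h1, h2⟩

theorem eq_or_eq_flip {f h : S.Flag} (hfh : h.1 = f.1) : h = f ∨ h = S.flip f := by
  rcases f with ⟨e, b⟩
  rcases h with ⟨e', b'⟩
  obtain rfl : e' = e := hfh
  cases b <;> cases b' <;> simp [flip]

/-- A complex chain of edges from `F` with boundary `v - u`. -/
def Chain (F : Finset S.Edge) (u v : ℂ) : Prop :=
  ∃ x : S.Edge → ℂ, (∀ e, e ∉ F → x e = 0) ∧ ∀ Q : ℂ[X],
    ∑ e, x e * (Q.eval (S.pt (e, true)) - Q.eval (S.pt (e, false))) = Q.eval v - Q.eval u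

variable {S}

theorem Chain.refl (F : Finset S.Edge) (u : ℂ) : S.Chain F u u :=
  ⟨0, fun _ _ => rfl, fun Q => by simp⟩

theorem Chain.symm {F : Finset S.Edge} {u v : ℂ} (h : S.Chain F u v) : S.Chain F v u := by
  obtain ⟨x, hx, hQ⟩ := h
  refine ⟨-x, fun e he => by simp [hx e he], fun Q => ?_⟩
  simp only [Pi.neg_apply, neg_mul, Finset.sum_neg_distrib, hQ]
  ring

theorem Chain.trans {F : Finset S.Edge} {u v w : ℂ} (h : S.Chain F u v) (h' : S.Chain F v w) :
    S.Chain F u w := by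
  obtain ⟨x, hx, hQ⟩ := h
  obtain ⟨y, hy, hQ'⟩ := h'
  refine ⟨x + y, fun e he => by simp [hx e he, hy e he], fun Q => ?_⟩
  simp only [Pi.add_apply, add_mul, Finset.sum_add_distrib, hQ, hQ']
  ring

theorem Chain.mono {F F' : Finset S.Edge} {u v : ℂ} (h : S.Chain F u v) (hF : F ⊆ F') :
    S.Chain F' u v := by
  obtain ⟨x, hx, hQ⟩ := h
  exact ⟨x, fun e he => hx e fun h => he (hF h), hQ⟩

theorem chain_flip {F : Finset S.Edge} (f : S.Flag) (hf : f.1 ∈ F) :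
    S.Chain F (S.pt f) (S.pt (S.flip f)) := by
  classical
  have h0 : S.Chain F (S.pt (f.1, false)) (S.pt (f.1, true)) := by
    refine ⟨Pi.single f.1 1, fun e he => Pi.single_eq_of_ne (by rintro rfl; exact he hf) _, fun Q => ?_⟩
    rw [Finset.sum_eq_single f.1]
    · simp
    · intro e _ he
      simp [Pi.single_eq_of_ne he]
    · simp
  rcases f with ⟨e, _ | _⟩
  · exact h0
  · exact h0.symm

/-- In a forest a chain is determined by its boundary, so the two chains agree; with disjoint
supports they vanish, and testing the boundary with `X` gives `u = v`. -/
theorem Chain.eq_of_disjoint {F F' : Finset S.Edge} {u v : ℂ} (h : S.Chain F u v)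
    (h' : S.Chain F' u v) (hd : Disjoint F F') : u = v := by
  obtain ⟨x, hx, hQ⟩ := h
  obtain ⟨y, hy, hQ'⟩ := h'
  have hxy : ∀ e, x e - y e = 0 := fun e => S.chain_eq_zero (x := fun e => x e - y e) (fun Q => by
    simp only [sub_mul, Finset.sum_sub_distrib, hQ, hQ', sub_self]) e
  have hx0 : ∀ e, x e = 0 := fun e => by
    by_cases he : e ∈ F
    · have h1 := hxy e
      rwa [hy e (Finset.disjoint_left.1 hd he), sub_zero] at h1
    · exact hx e he
  have h1 := hQ X
  simp only [hx0, zero_mul, Finset.sum_const_zero, eval_X] at h1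
  exact (sub_eq_zero.1 h1.symm).symm

/-- Otherwise the edge would close a cycle. -/
theorem not_chain_flip {F : Finset S.Edge} {f : S.Flag} (hf : f.1 ∉ F) :
    ¬ S.Chain F (S.pt f) (S.pt (S.flip f)) := fun h => by
  classical
  have h1 := chain_flip (F := {f.1}) f (by simp)
  exact S.pt_flip_ne f (h.eq_of_disjoint h1 (by simpa using hf)).symm

variable (S)

/-- Distinct edges meet only in common end points. -/
theorem exists_flags_of_mem_img {e e' : S.Edge} (hne : e ≠ e') {y : ℂ} (hy : y ∈ S.img e)
    (hy' : y ∈ S.img e') : ∃ h : S.Flag, h.1 = e ∧ S.pt h = y := by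
  obtain ⟨x, hx, rfl⟩ := hy
  obtain ⟨x', hx', hxx⟩ := hy'
  have h1 := (S.sec e').eval x' hx'
  rw [hxx, (S.sec e).eval x hx] at h1
  obtain rfl : x = x' := by exact_mod_cast h1
  rcases hx.1.eq_or_lt with h | h
  · exact ⟨(e, false), rfl, by simp [pt, base, h]⟩
  rcases hx.2.eq_or_lt with h' | h'
  · exact ⟨(e, true), rfl, by simp [pt, base, h']⟩
  exfalso
  have hside : S.side e = S.side e' := by
    cases h2 : S.side e <;> cases h3 : S.side e' <;>
      simp only [lo, hi, h2, h3, segLo, segHi] at h h' hx' ⊢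
    · linarith [hx'.1]
    · linarith [hx'.2]
  exact hne (S.disj e e' hside x ⟨h, h'⟩ hxx.symm)

/-- The edges in `F` form a single analytic arc from the end `f` to the end `g`, which passes
straight through all nonterminal points in between. -/
structure IsPath (F : Finset S.Edge) (f g : S.Flag) : Prop where
  arc : ∃ (c : ℝ → ℂ) (L : ℝ), IsUnitArc c L ∧ c 0 = S.pt f ∧ c L = S.pt g ∧
    c '' Icc 0 L = ⋃ e ∈ F, S.img e
  left_mem : f.1 ∈ F
  right_mem : g.1 ∈ F
  left_unique : ∀ h : S.Flag, h.1 ∈ F → S.pt h = S.pt f → h = f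
  right_unique : ∀ h : S.Flag, h.1 ∈ F → S.pt h = S.pt g → h = g
  ne : S.pt f ≠ S.pt g
  closed : ∀ h : S.Flag, h.1 ∈ F → h ≠ f → h ≠ g → ¬ IsTerminal T (S.pt h) ∧
    ∀ h', S.pt h' = S.pt h → S.dir h' = -S.dir h → h'.1 ∈ F
  conn : ∀ h h' : S.Flag, h.1 ∈ F → h'.1 ∈ F → S.Chain F (S.pt h) (S.pt h')

theorem isPath_singleton (f : S.Flag) : S.IsPath {f.1} f (S.flip f) := by
  obtain ⟨c, L, hc, h0, hL, himg⟩ := S.exists_isUnitArc f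
  have hcase : ∀ h : S.Flag, h.1 ∈ ({f.1} : Finset S.Edge) → h = f ∨ h = S.flip f := fun h hh =>
    S.eq_or_eq_flip (by simpa using hh)
  refine ⟨⟨c, L, hc, h0, hL, by simpa using himg⟩, by simp, by simp [flip], ?_, ?_,
    (S.pt_flip_ne f).symm, ?_, ?_⟩
  · intro h hh hpt
    rcases hcase h hh with rfl | rfl
    · rfl
    · exact absurd hpt (S.pt_flip_ne f)
  · intro h hh hpt
    rcases hcase h hh with rfl | rfl
    · exact absurd hpt.symm (S.pt_flip_ne h)
    · rfl
  · intro h hh h1 h2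
    rcases hcase h hh with rfl | rfl
    · exact absurd rfl h1
    · exact absurd rfl h2
  · have h1 := chain_flip (F := {f.1}) f (by simp)
    intro h h' hh hh'
    rcases hcase h hh with rfl | rfl <;> rcases hcase h' hh' with rfl | rfl
    · exact Chain.refl _ _
    · exact h1
    · exact h1.symm
    · exact Chain.refl _ _

variable {S}

theorem IsPath.reverse {F : Finset S.Edge} {f g : S.Flag} (h : S.IsPath F f g) :
    S.IsPath F g f := by
  obtain ⟨c, L, hc, h0, hL, himg⟩ := h.arc
  refine ⟨⟨_, L, hc.reverse, by simpa using hL, by simpa using h0, ?_⟩, h.right_mem, h.left_mem,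
    h.right_unique, h.left_unique, h.ne.symm, fun k hk h1 h2 => h.closed k hk h2 h1, h.conn⟩
  rw [image_reverse_Icc, himg]

/-- A path is prolonged by the edge opposite to its last one. The forest property keeps the new end
off the old path, so the arc stays simple. -/
theorem IsPath.extend [DecidableEq S.Edge] {F : Finset S.Edge} {f g g' : S.Flag}
    (h : S.IsPath F f g) (hg : ¬ IsTerminal T (S.pt g)) (hpt : S.pt g' = S.pt g)
    (hdir : S.dir g' = -S.dir g) :
    g'.1 ∉ F ∧ S.IsPath (insert g'.1 F) f (S.flip g') := by
  -- The only flag of the path at this point is `g`, whose direction is nonzero and so differs from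
  -- that of `g'`.
  have hnot : g'.1 ∉ F := fun hmem => by
    have h1 := h.right_unique g' hmem hpt
    rw [h1] at hdir
    exact S.dir_ne_zero g (self_eq_neg.1 hdir)
  have hfar : ∀ k : S.Flag, k.1 ∈ F → S.pt k ≠ S.pt (S.flip g') := fun k hk heq => by
    have h1 := h.conn g k h.right_mem hk
    rw [heq, ← hpt] at h1
    exact not_chain_flip hnot h1
  have hcase : ∀ k : S.Flag, k.1 ∈ insert g'.1 F → k.1 ∈ F ∨ k = g' ∨ k = S.flip g' :=
    fun k hk => by
    rcases Finset.mem_insert.1 hk with hk | hk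
    · exact Or.inr (S.eq_or_eq_flip hk)
    · exact Or.inl hk
  refine ⟨hnot, ?_, Finset.mem_insert_of_mem h.left_mem, Finset.mem_insert_self _ _, ?_, ?_,
    hfar f h.left_mem, ?_, ?_⟩
  · obtain ⟨c₁, L₁, hc₁, h₁0, h₁L, himg₁⟩ := h.arc
    obtain ⟨c₂, L₂, hc₂, h₂0, h₂L, himg₂⟩ := S.exists_isUnitArc g'
    have hT := S.natDegree_pos
    obtain ⟨c, hc, hc0, hcL, himg⟩ := hc₁.glue (c₂ := c₂) (L₂ := L₂) hc₂
      (ψ := powerChart hT (S.pt g)) (ρ := powerChartInv hT (S.pt g)) (u := S.pt g) (ω := S.dir g')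
      h₁L (h₂0.trans hpt) (analyticAt_powerChart hT _) (powerChart_self hT _)
      (deriv_powerChart_ne hT _) (S.dir_ne_zero g') (powerChartInv_powerChart hT _) (by
        -- Near `S.pt g` the path consists of the edge of `g` alone, so the end of `c₁` runs along a
        -- single ray.
        have hclosed : IsClosed (⋃ e ∈ F.erase g.1, S.img e) :=
          isClosed_biUnion_finset fun e _ => (S.isCompact_img e).isClosed
        have hptg : S.pt g ∉ ⋃ e ∈ F.erase g.1, S.img e := fun hmem => by
          obtain ⟨e, he, hy⟩ := mem_iUnion₂.1 hmem
          obtain ⟨hne, heF⟩ := Finset.mem_erase.1 he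
          obtain ⟨k, rfl, hk⟩ := S.exists_flags_of_mem_img hne hy (S.pt_mem_img g)
          exact hne (by rw [h.right_unique k heF hk])
        have hct : Tendsto c₁ (𝓝[≤] L₁) (𝓝 (S.pt g)) := by
          rw [← h₁L]
          exact (hc₁.analytic L₁ ⟨hc₁.pos.le, le_rfl⟩).continuousAt.continuousWithinAt
        filter_upwards [hct.eventually (S.eventually_mem_ray g),
          hct.eventually (hclosed.isOpen_compl.mem_nhds hptg), self_mem_nhdsWithin,
          mem_nhdsWithin_of_mem_nhds (lt_mem_nhds hc₁.pos)] with t h1 h2 h3 h4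
        rw [hdir, neg_neg]
        refine h1 ?_
        have hmem : c₁ t ∈ ⋃ e ∈ F, S.img e := himg₁ ▸ mem_image_of_mem _ ⟨le_of_lt h4, h3⟩
        obtain ⟨e, he, hy⟩ := mem_iUnion₂.1 hmem
        by_cases heg : e = g.1
        · rwa [← heg]
        · exact absurd (mem_iUnion₂.2 ⟨e, Finset.mem_erase.2 ⟨heg, he⟩, hy⟩) h2)
      (by
        have hct : Tendsto c₂ (𝓝[≥] 0) (𝓝 (S.pt g')) := by
          rw [← h₂0]
          exact (hc₂.analytic 0 ⟨le_rfl, hc₂.pos.le⟩).continuousAt.continuousWithinAt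
        filter_upwards [hct.eventually (S.eventually_mem_ray g'), self_mem_nhdsWithin,
          mem_nhdsWithin_of_mem_nhds (gt_mem_nhds hc₂.pos)] with t h1 h2 h3
        rw [← hpt]
        exact h1 (himg₂ ▸ mem_image_of_mem _ ⟨h2, le_of_lt h3⟩))
      (by
        rw [himg₁, himg₂]
        rintro y ⟨hy, hy'⟩
        obtain ⟨e, he, hye⟩ := mem_iUnion₂.1 hy
        have hne : e ≠ g'.1 := fun h => hnot (h ▸ he)
        obtain ⟨k, rfl, hk⟩ := S.exists_flags_of_mem_img hne hye hy'
        obtain ⟨k', hk', hk'y⟩ := S.exists_flags_of_mem_img hne.symm hy' hye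
        rcases S.eq_or_eq_flip hk' with rfl | rfl
        · rw [mem_singleton_iff, ← hk'y, hpt]
        · exact absurd (hk.trans hk'y.symm) (hfar k he))
    refine ⟨c, _, hc, hc0.trans h₁0, hcL.trans h₂L, ?_⟩
    rw [himg, himg₁, himg₂, Finset.set_biUnion_insert, union_comm]
  · intro k hk hkf
    rcases hcase k hk with hk | rfl | rfl
    · exact h.left_unique k hk hkf
    · exact absurd (hkf.symm.trans hpt) h.ne
    · exact absurd hkf.symm (hfar f h.left_mem)
  · intro k hk hkg
    rcases hcase k hk with hk | rfl | rfl
    · exact absurd hkg (hfar k hk)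
    · exact absurd hkg.symm (S.pt_flip_ne k)
    · rfl
  · intro k hk h1 h2
    rcases hcase k hk with hk | rfl | rfl
    · by_cases hkg : k = g
      · subst hkg
        refine ⟨hg, fun k' hk' hk'd => ?_⟩
        rw [S.flag_ext (hk'.trans hpt.symm) (hk'd.trans hdir.symm)]
        exact Finset.mem_insert_self _ _
      · obtain ⟨h3, h4⟩ := h.closed k hk h1 hkg
        exact ⟨h3, fun k' a b => Finset.mem_insert_of_mem (h4 k' a b)⟩
    · refine ⟨by rwa [hpt], fun k' hk' hk'd => ?_⟩
      rw [hdir, neg_neg] at hk'd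
      rw [S.flag_ext (hk'.trans hpt) hk'd]
      exact Finset.mem_insert_of_mem h.right_mem
    · exact absurd rfl h2
  · have key : ∀ k : S.Flag, k.1 ∈ insert g'.1 F →
        S.Chain (insert g'.1 F) (S.pt k) (S.pt g) := fun k hk => by
      rcases hcase k hk with hk | rfl | rfl
      · exact (h.conn k g hk h.right_mem).mono (Finset.subset_insert _ _)
      · rw [hpt]; exact Chain.refl _ _
      · rw [← hpt]; exact (chain_flip g' (Finset.mem_insert_self _ _)).symm
    exact fun k k' hk hk' => (key k hk).trans (key k' hk').symm

variable (S)

/-- A set of edges which contains with each edge its continuations through nonterminal points. -/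
def IsContinued (G : Finset S.Edge) : Prop :=
  ∀ h : S.Flag, h.1 ∈ G → ¬ IsTerminal T (S.pt h) →
    ∀ h', S.pt h' = S.pt h → S.dir h' = -S.dir h → h'.1 ∈ G

/-- In a path inside `G` with the most edges, a nonterminal end could be prolonged within `G`. -/
theorem exists_maximal_path {G : Finset S.Edge} (hG : S.IsContinued G) (hne : G.Nonempty) :
    ∃ F ⊆ G, ∃ f g, S.IsPath F f g ∧ IsTerminal T (S.pt f) ∧ IsTerminal T (S.pt g) := by
  classical
  set P : Finset (Finset S.Edge) := {F ∈ G.powerset | ∃ f g, S.IsPath F f g}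
  have hP : P.Nonempty := by
    obtain ⟨e, he⟩ := hne
    refine ⟨{e}, ?_⟩
    simp only [P, Finset.mem_filter, Finset.mem_powerset, Finset.singleton_subset_iff]
    exact ⟨he, _, _, S.isPath_singleton (e, false)⟩
  obtain ⟨F, hF, hmax⟩ := P.exists_max_image Finset.card hP
  have hright : ∀ f g, S.IsPath F f g → IsTerminal T (S.pt g) := fun f g hfg => by
    by_contra hg
    obtain ⟨g', h1, h2⟩ := S.exists_opposite hg
    have hFG : F ⊆ G := by
      have := hF
      simp only [P, Finset.mem_filter, Finset.mem_powerset] at this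
      exact this.1
    have hg'G : g'.1 ∈ G := hG g (hFG hfg.right_mem) hg g' h1 h2
    obtain ⟨h3, h4⟩ := hfg.extend hg h1 h2
    have h5 := hmax (insert g'.1 F) (by
      simp only [P, Finset.mem_filter, Finset.mem_powerset]
      exact ⟨Finset.insert_subset hg'G hFG, _, _, h4⟩)
    rw [Finset.card_insert_of_notMem h3] at h5
    omega
  simp only [P, Finset.mem_filter, Finset.mem_powerset] at hF
  obtain ⟨hFG, f, g, hfg⟩ := hF
  exact ⟨F, hFG, f, g, hfg, hright g f hfg.reverse, hright f g hfg⟩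

/-- Maximal paths are removed one at a time. Each has exactly two terminal flags, its ends, which
gives the count. -/
theorem exists_decomposition (G : Finset S.Edge) (hG : S.IsContinued G) :
    ∃ (ν : ℕ) (F : Fin ν → Finset S.Edge) (f g : Fin ν → S.Flag),
      (∀ i, S.IsPath (F i) (f i) (g i)) ∧ (∀ i, IsTerminal T (S.pt (f i))) ∧
      (∀ i, IsTerminal T (S.pt (g i))) ∧ (∀ i, F i ⊆ G) ∧
      (∀ i j, i ≠ j → Disjoint (F i) (F j)) ∧ (∀ e ∈ G, ∃ i, e ∈ F i) ∧
      {h : S.Flag | h.1 ∈ G ∧ IsTerminal T (S.pt h)}.ncard = 2 * ν := by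
  classical
  induction hn : G.card using Nat.strong_induction_on generalizing G with
  | _ n ih =>
  rcases G.eq_empty_or_nonempty with rfl | hne
  · exact ⟨0, Fin.elim0, Fin.elim0, Fin.elim0, fun i => i.elim0, fun i => i.elim0, fun i => i.elim0,
      fun i => i.elim0, fun i => i.elim0, by simp, by simp⟩
  obtain ⟨F₀, hF₀, f₀, g₀, hp₀, hf₀, hg₀⟩ := S.exists_maximal_path hG hne
  have hint : ∀ h : S.Flag, h.1 ∈ F₀ → IsTerminal T (S.pt h) → h = f₀ ∨ h = g₀ :=
    fun h hh ht => by
    by_contra! hcon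
    exact (hp₀.closed h hh hcon.1 hcon.2).1 ht
  -- Being opposite is symmetric: if the continuation of `h` were in `F₀`, then `h` would be as
  -- well, by `closed`.
  have hG' : S.IsContinued (G \ F₀) := fun h hh ht h' hpt hdir => by
    rw [Finset.mem_sdiff] at hh ⊢
    refine ⟨hG h hh.1 ht h' hpt hdir, fun hmem => hh.2 ?_⟩
    have ht' : ¬ IsTerminal T (S.pt h') := by rwa [hpt]
    refine (hp₀.closed h' hmem ?_ ?_).2 h hpt.symm (by rw [hdir, neg_neg])
    · rintro rfl; exact ht' hf₀
    · rintro rfl; exact ht' hg₀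
  obtain ⟨ν, F, f, g, h1, h2, h3, h4, h5, h6, h7⟩ := ih _ (by
    rw [← hn]
    exact Finset.card_lt_card (Finset.sdiff_ssubset hF₀ ⟨_, hp₀.left_mem⟩)) (G \ F₀) hG' rfl
  refine ⟨ν + 1, Fin.cons F₀ F, Fin.cons f₀ f, Fin.cons g₀ g, ?_, ?_, ?_, ?_, ?_, ?_, ?_⟩
  · exact Fin.cases (by simpa using hp₀) (by simpa using h1)
  · exact Fin.cases (by simpa using hf₀) (by simpa using h2)
  · exact Fin.cases (by simpa using hg₀) (by simpa using h3)
  · exact Fin.cases (by simpa using hF₀) fun i => by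
      simpa using (h4 i).trans Finset.sdiff_subset
  · have hd : ∀ i, Disjoint F₀ (F i) := fun i =>
      Finset.disjoint_left.2 fun e he he' => (Finset.mem_sdiff.1 (h4 i he')).2 he
    refine Fin.cases (Fin.cases (fun h => absurd rfl h) fun j _ => by simpa using hd j) fun i =>
      Fin.cases (fun _ => by simpa using (hd i).symm) fun j hij => by
        simpa using h5 i j fun h => hij (by rw [h])
  · intro e he
    by_cases heF : e ∈ F₀
    · exact ⟨0, by simpa using heF⟩
    · obtain ⟨i, hi⟩ := h6 e (Finset.mem_sdiff.2 ⟨he, heF⟩)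
      exact ⟨i.succ, by simpa using hi⟩
  · have hset : {h : S.Flag | h.1 ∈ G ∧ IsTerminal T (S.pt h)} =
        {h : S.Flag | h.1 ∈ G \ F₀ ∧ IsTerminal T (S.pt h)} ∪ {f₀, g₀} := by
      ext h
      simp only [mem_ofPred_eq, mem_union, mem_insert_iff, mem_singleton_iff, Finset.mem_sdiff]
      constructor
      · rintro ⟨ha, hb⟩
        by_cases hh : h.1 ∈ F₀
        · exact Or.inr (hint h hh hb)
        · exact Or.inl ⟨⟨ha, hh⟩, hb⟩
      · rintro (⟨⟨ha, -⟩, hb⟩ | rfl | rfl)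
        · exact ⟨ha, hb⟩
        · exact ⟨hF₀ hp₀.left_mem, hf₀⟩
        · exact ⟨hF₀ hp₀.right_mem, hg₀⟩
    have hfg : f₀ ≠ g₀ := fun h => hp₀.ne (by rw [h])
    rw [hset, ncard_union_eq _ (Set.toFinite _) (Set.toFinite _), h7, ncard_pair hfg]
    · ring
    · rw [Set.disjoint_left]
      rintro h ⟨hh, -⟩ (rfl | rfl)
      · exact (Finset.mem_sdiff.1 hh).2 hp₀.left_mem
      · exact (Finset.mem_sdiff.1 hh).2 hp₀.right_mem

end EdgeSystem

/-! ### Minimality: terminal flags force ends of arcs -/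

/-- An analytic regular curve through `u` which meets a ray of a coordinate at `u` in points
accumulating at `u` stays in the line of this ray. -/
theorem exists_real_coordinate_of_frequently {g : ℝ → ℂ} {ψ : ℂ → ℂ} {u ω : ℂ} {t₀ : ℝ}
    (hg : AnalyticAt ℝ g t₀) (hg0 : g t₀ = u) (hgd : deriv g t₀ ≠ 0) (hψ : AnalyticAt ℂ ψ u)
    (hψ0 : ψ u = 0) (hψd : deriv ψ u ≠ 0) (hω : ω ≠ 0)
    (hfreq : ∃ᶠ t in 𝓝[≠] t₀, ∃ s : ℝ, ψ (g t) = ω * s) :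
    ∃ (a : ℝ → ℝ) (q : ℝ), q ≠ 0 ∧ HasDerivAt a q t₀ ∧ a t₀ = 0 ∧
      (∀ᶠ t in 𝓝 t₀, ψ (g t) = ω * a t) ∧ deriv ψ u * deriv g t₀ = ω * q := by
  set φ : ℝ → ℂ := fun t => ω⁻¹ * ψ (g t) with hφ
  have hψg : AnalyticAt ℂ ψ (g t₀) := by rwa [hg0]
  have hφa : AnalyticAt ℝ φ t₀ :=
    analyticAt_const.mul (AnalyticAt.fun_comp (g := ψ) hψg.restrictScalars hg)
  have him : AnalyticAt ℝ (fun t => (φ t).im) t₀ := (Complex.imCLM.analyticAt _).comp hφa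
  have hev : ∀ᶠ t in 𝓝 t₀, (φ t).im = 0 := by
    refine him.frequently_zero_iff_eventually_zero.1 (hfreq.mono ?_)
    rintro t ⟨s, hs⟩
    simp [hφ, hs, inv_mul_cancel_left₀ hω]
  have hd : HasDerivAt φ (ω⁻¹ * (deriv ψ u * deriv g t₀)) t₀ := by
    have h1 : HasDerivAt ψ (deriv ψ u) (g t₀) := by
      rw [hg0]; exact hψ.differentiableAt.hasDerivAt
    exact (h1.comp t₀ hg.differentiableAt.hasDerivAt).const_mul _
  set d := ω⁻¹ * (deriv ψ u * deriv g t₀) with hdd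
  have hre : HasDerivAt (fun t => (φ t).re) d.re t₀ := 
    Complex.reCLM.hasFDerivAt.comp_hasDerivAt t₀ hd
  have him' : HasDerivAt (fun t => (φ t).im) d.im t₀ := 
    Complex.imCLM.hasFDerivAt.comp_hasDerivAt t₀ hd
  have hdim : d.im = 0 :=
    him'.unique ((hasDerivAt_const t₀ (0 : ℝ)).congr_of_eventuallyEq hev)
  have hdre : (d.re : ℂ) = d := Complex.ext (by simp) (by simp [hdim])
  refine ⟨fun t => (φ t).re, d.re, ?_, hre, by simp [hφ, hg0, hψ0], ?_, ?_⟩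
  · intro h
    rw [h, Complex.ofReal_zero] at hdre
    exact mul_ne_zero (inv_ne_zero hω) (mul_ne_zero hψd hgd) hdre.symm
  · filter_upwards [hev] with t ht
    have : ((φ t).re : ℂ) = φ t := Complex.ext (by simp) (by simp [ht])
    rw [this, hφ, mul_inv_cancel_left₀ hω]
  · rw [hdre, hdd, mul_inv_cancel_left₀ hω]

/-- A parametrization of a Jordan arc is a homeomorphism onto its image. -/
theorem frequently_of_frequently_image {γ : ℝ → ℂ} {K : Set ℝ} (hK : IsCompact K)
    (hγ : ContinuousOn γ K) {t₀ : ℝ} (hinj : ∀ t ∈ K, γ t = γ t₀ → t = t₀) {P : ℂ → Prop}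
    (h : ∃ᶠ y in 𝓝[≠] γ t₀, y ∈ γ '' K ∧ P y) : ∃ᶠ t in 𝓝[≠] t₀, t ∈ K ∧ P (γ t) := by
  by_contra hcon
  rw [not_frequently, eventually_nhdsWithin_iff] at hcon
  obtain ⟨V, hV, hVo, ht₀⟩ := eventually_nhds_iff.1 hcon
  -- Parameters away from `t₀` have a compact image missing `γ t₀`.
  have hcl : IsClosed (γ '' (K \ V)) :=
    ((hK.diff hVo).image_of_continuousOn (hγ.mono sdiff_subset)).isClosed
  have hmem : γ t₀ ∉ γ '' (K \ V) := by
    rintro ⟨t, ht, htt⟩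
    exact ht.2 (hinj t ht.1 htt ▸ ht₀)
  refine h ?_
  rw [eventually_nhdsWithin_iff]
  filter_upwards [hcl.isOpen_compl.mem_nhds hmem] with y hy hne
  rintro ⟨⟨t, ht, rfl⟩, hP⟩
  by_cases htV : t ∈ V
  · exact hV t htV (fun h => hne (by rw [mem_singleton_iff.1 h]; rfl)) ⟨ht, hP⟩
  · exact hy ⟨t, ⟨ht, htV⟩, rfl⟩

theorem HasDerivAt.eventually_neg_left {a : ℝ → ℝ} {q t₀ : ℝ} (h : HasDerivAt a q t₀)
    (h0 : a t₀ = 0) (hq : 0 < q) : ∀ᶠ t in 𝓝[<] t₀, a t < 0 := by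
  have h1 := (hasDerivAt_iff_tendsto_slope_left_right.1 h).1.eventually (lt_mem_nhds hq)
  filter_upwards [h1, self_mem_nhdsWithin] with t ht htt
  rw [slope_def_field, h0, sub_zero] at ht
  have h2 : t - t₀ < 0 := sub_neg.2 htt
  by_contra! hcon
  exact absurd ht (not_lt.2 (div_nonpos_of_nonneg_of_nonpos hcon h2.le))

theorem HasDerivAt.eventually_neg_right {a : ℝ → ℝ} {q t₀ : ℝ} (h : HasDerivAt a q t₀)
    (h0 : a t₀ = 0) (hq : q < 0) : ∀ᶠ t in 𝓝[>] t₀, a t < 0 := by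
  have h1 := (hasDerivAt_iff_tendsto_slope_left_right.1 h).2.eventually (gt_mem_nhds hq)
  filter_upwards [h1, self_mem_nhdsWithin] with t ht htt
  rw [slope_def_field, h0, sub_zero] at ht
  have h2 : 0 < t - t₀ := sub_pos.2 htt
  by_contra! hcon
  exact absurd ht (not_lt.2 (div_nonneg hcon h2.le))

namespace EdgeSystem

variable {T : ℂ[X]} {τ : ℝ} (S : EdgeSystem T τ)

theorem img_subset (e : S.Edge) : S.img e ⊆ inverseImageSegment T := by
  rintro _ ⟨x, hx, rfl⟩
  have h1 := S.mem.1
  have h2 := S.mem.2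
  refine ⟨x, ?_, (S.sec e).eval x hx⟩
  cases h : S.side e <;> simp only [lo, hi, h, segLo, segHi] at hx <;>
    exact ⟨by linarith [hx.1], by linarith [hx.2]⟩

theorem exists_mem_img_of_end {u : ℂ} {b e : Bool}
    (hu : T.eval u = ((if e then segHi τ b else segLo τ b : ℝ) : ℂ)) : ∃ e, u ∈ S.img e := by
  obtain ⟨ω, hω⟩ := IsAlgClosed.exists_pow_nat_eq (((if e then -1 else 1 : ℝ) : ℂ))
    (powerOrder_pos S.natDegree_pos u)
  obtain ⟨f, -, -, hf, -⟩ := S.exists_flag hu hω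
  exact ⟨f.1, hf ▸ S.pt_mem_img f⟩

theorem iUnion_img : ⋃ e, S.img e = inverseImageSegment T := by
  refine (iUnion_subset S.img_subset).antisymm fun u hu => ?_
  obtain ⟨x, hx, hux⟩ := hu
  rw [mem_iUnion]
  have key : ∀ b, x ∈ Icc (segLo τ b) (segHi τ b) → ∃ e, u ∈ S.img e := fun b hb => by
    rcases hb.1.eq_or_lt with h | h
    · exact S.exists_mem_img_of_end (b := b) (e := false) (by simp [hux, h])
    rcases hb.2.eq_or_lt with h' | h'
    · exact S.exists_mem_img_of_end (b := b) (e := true) (by simp [hux, h'])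
    obtain ⟨e, rfl, he⟩ := S.cover b x ⟨h, h'⟩ u hux
    exact ⟨e, x, hb, he⟩
  rcases le_total x τ with h | h
  · exact key false ⟨hx.1, h⟩
  · exact key true ⟨h, hx.2⟩

theorem norm_dir (f : S.Flag) : ‖S.dir f‖ = 1 := by
  have h := congrArg norm (S.dir_pow f)
  rw [norm_pow] at h
  refine (pow_eq_one_iff_of_nonneg (norm_nonneg _) (S.ord_pos f).ne').1 (h.trans ?_)
  unfold sgn
  split_ifs <;> simp

theorem flag_ext_of_pos {f g : S.Flag} (hpt : S.pt f = S.pt g) {p q : ℝ} (hp : 0 < p) (hq : 0 < q)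
    (hdir : S.dir f * p = S.dir g * q) : f = g := by
  have h := congrArg norm hdir
  rw [norm_mul, norm_mul, norm_dir, norm_dir, Complex.norm_real, Complex.norm_real,
    Real.norm_of_nonneg hp.le, Real.norm_of_nonneg hq.le, one_mul, one_mul] at h
  rw [h] at hdir
  exact S.flag_ext hpt (mul_right_cancel₀ (by exact_mod_cast hq.ne') hdir)

theorem sgn_eq_neg_base {f : S.Flag} (hf : T.eval (S.pt f) ^ 2 = 1) : S.sgn f = -S.base f := by
  rw [S.eval_pt] at hf
  have h : S.base f ^ 2 = 1 := by exact_mod_cast hf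
  have h1 := S.mem.1
  have h2 := S.mem.2
  rcases f with ⟨e, _ | _⟩ <;> cases hs : S.side e <;>
    simp [base, lo, hi, hs, segLo, segHi, sgn] at h ⊢ <;> rcases h with h | h <;> linarith

theorem frequently_mem_ray (h : S.Flag) : ∃ᶠ y in 𝓝[≠] S.pt h, y ∈ S.img h.1 ∧
    ∃ s : ℝ, powerChart S.natDegree_pos (S.pt h) y = S.dir h * s := by
  have hev := S.eventually_mem_ray h
  have hcont : Tendsto (S.z h.1) (𝓝[Icc (S.lo h.1) (S.hi h.1)] S.base h) (𝓝 (S.pt h)) :=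
    (S.sec h.1).cont _ (S.base_mem h)
  set I := Icc (S.lo h.1) (S.hi h.1) \ {S.base h}
  have hne : (𝓝[I] S.base h).NeBot := by
    rw [← mem_closure_iff_nhdsWithin_neBot]
    have : Ioo (S.lo h.1) (S.hi h.1) ⊆ I := fun x hx => ⟨Ioo_subset_Icc_self hx, fun hx' => by
      rw [mem_singleton_iff] at hx'
      subst hx'
      rcases h with ⟨e, _ | _⟩
      · exact lt_irrefl _ hx.1
      · exact lt_irrefl _ hx.2⟩
    refine closure_mono this ?_
    rw [closure_Ioo (S.lo_lt_hi _).ne]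
    exact S.base_mem h
  have hct : Tendsto (S.z h.1) (𝓝[I] S.base h) (𝓝[≠] S.pt h) := by
    refine tendsto_nhdsWithin_of_tendsto_nhds_of_eventually_within _
      (hcont.mono_left (nhdsWithin_mono _ sdiff_subset)) ?_
    filter_upwards [self_mem_nhdsWithin] with x hx heq
    have h1 := (S.sec h.1).eval x hx.1
    rw [mem_singleton_iff.1 heq, S.eval_pt] at h1
    exact hx.2 (by exact_mod_cast h1.symm)
  refine hct.frequently (Eventually.frequently ?_)
  filter_upwards [hct.eventually (hev.filter_mono nhdsWithin_le_nhds), self_mem_nhdsWithin]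
    with x hx hxI
  have hmem : S.z h.1 x ∈ S.img h.1 := mem_image_of_mem _ hxI.1
  obtain ⟨s, -, hs⟩ := hx hmem
  exact ⟨hmem, s, hs⟩

/-- Each terminal flag gives rise to an end of an arc, in every representation of the inverse image
as a union of arcs. -/
theorem exists_arc_end {μ : ℕ} {δ : Fin μ → ℝ → ℂ} (hδ : IsUnionOfArcs (inverseImageSegment T) δ)
    {h : S.Flag} (hh : IsTerminal T (S.pt h)) : ∃ (i : Fin μ) (b : Bool),
      δ i (if b then 1 else 0) = S.pt h ∧ ∃ q : ℝ, 0 < q ∧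
        deriv (powerChart S.natDegree_pos (S.pt h)) (S.pt h) * deriv (δ i) (if b then 1 else 0) =
          S.dir h * ((if b then -1 else 1) * q : ℝ) := by
  have hT := S.natDegree_pos
  set ψ := powerChart hT (S.pt h)
  -- The points of the edge accumulate at its end, and there are finitely many arcs, so one arc
  -- contains such points arbitrarily close to the end.
  have hfr : ∃ i, ∃ᶠ y in 𝓝[≠] S.pt h, y ∈ arcSet (δ i) ∧ ∃ s : ℝ, ψ y = S.dir h * s := by
    by_contra! hcon
    refine S.frequently_mem_ray h ?_
    filter_upwards [eventually_all.2 hcon] with y hy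
    rintro ⟨hyS, s, hs⟩
    have := S.img_subset _ hyS
    rw [← hδ.2, mem_iUnion] at this
    obtain ⟨i, hi⟩ := this
    exact hy i hi s hs
  obtain ⟨i, hi⟩ := hfr
  have hJ := hδ.1 i
  have hcl : IsClosed (arcSet (δ i)) :=
    (isCompact_Icc.image_of_continuousOn hJ.analytic.continuousOn).isClosed
  have humem : S.pt h ∈ arcSet (δ i) := by
    rw [← hcl.closure_eq, mem_closure_iff_frequently]
    exact (hi.mono fun y hy => hy.1).filter_mono nhdsWithin_le_nhds
  obtain ⟨t₀, ht₀, htu⟩ := humem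
  rw [← htu] at hi
  have hfr := frequently_of_frequently_image isCompact_Icc hJ.analytic.continuousOn
    (fun t ht htt => hJ.injOn ht ht₀ htt) hi
  obtain ⟨a, q, hq, ha, ha0, hev, hdir⟩ := exists_real_coordinate_of_frequently
    (hJ.analytic t₀ ht₀) htu (hJ.regular t₀ ht₀) (analyticAt_powerChart hT _)
    (powerChart_self hT _) (deriv_powerChart_ne hT _) (S.dir_ne_zero h) (hfr.mono fun t ht => ht.2)
  -- At a negative coordinate the odd power changes sign and `T` would leave `[-1, 1]`. As `a` has
  -- nonzero derivative at `t₀`, this makes `t₀` an end parameter.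
  have hnonneg : ∀ᶠ t in 𝓝 t₀, t ∈ Icc (0 : ℝ) 1 → 0 ≤ a t := by
    filter_upwards [hev] with t ht htI
    by_contra! hneg
    have hmem : δ i t ∈ inverseImageSegment T := by
      rw [← hδ.2]
      exact mem_iUnion.2 ⟨i, t, htI, rfl⟩
    obtain ⟨x, hx, hxT⟩ := hmem
    rw [eval_eq_powerChart hT (S.pt h), ht, mul_pow, show S.dir h ^ powerOrder T (S.pt h) = _ from
      S.dir_pow h, S.eval_pt] at hxT
    have hxr : S.base h + S.sgn h * a t ^ powerOrder T (S.pt h) = x := by exact_mod_cast hxT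
    have hodd : a t ^ powerOrder T (S.pt h) < 0 := hh.2.pow_neg hneg
    have hb := hh.1
    rw [S.eval_pt] at hb
    have hb' : S.base h ^ 2 = 1 := by exact_mod_cast hb
    rw [S.sgn_eq_neg_base hh.1] at hxr
    rcases sq_eq_one_iff.1 hb' with h1 | h1 <;> rw [h1] at hxr <;>
      linarith [hx.1, hx.2]
  rcases hq.lt_or_gt with hq | hq
  · have ht1 : t₀ = 1 := by
      by_contra hne
      have hlt : t₀ < 1 := lt_of_le_of_ne ht₀.2 hne
      obtain ⟨t, ⟨h1, h2⟩, h3, h4⟩ := ((ha.eventually_neg_right ha0 hq).and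
        (hnonneg.filter_mono nhdsWithin_le_nhds) |>.and (Ioo_mem_nhdsGT hlt)).exists
      exact absurd (h2 ⟨ht₀.1.trans h3.le, h4.le⟩) (not_le.2 h1)
    subst ht1
    exact ⟨i, true, by simpa using htu, -q, by linarith, by simpa using hdir⟩
  · have ht1 : t₀ = 0 := by
      by_contra hne
      have hlt : 0 < t₀ := lt_of_le_of_ne ht₀.1 (Ne.symm hne)
      obtain ⟨t, ⟨h1, h2⟩, h3, h4⟩ := ((ha.eventually_neg_left ha0 hq).and
        (hnonneg.filter_mono nhdsWithin_le_nhds) |>.and (Ioo_mem_nhdsLT hlt)).exists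
      exact absurd (h2 ⟨h3.le, h4.le.trans ht₀.2⟩) (not_le.2 h1)
    subst ht1
    exact ⟨i, false, by simpa using htu, q, hq, by simpa using hdir⟩

/-- The terminal flags are told apart by the ends of arcs of `exists_arc_end`. -/
theorem exists_injective_arc_end {μ : ℕ} {δ : Fin μ → ℝ → ℂ}
    (hδ : IsUnionOfArcs (inverseImageSegment T) δ) :
    ∃ φ : {h : S.Flag // IsTerminal T (S.pt h)} → Fin μ × Bool, Function.Injective φ ∧
      ∀ h, δ (φ h).1 (if (φ h).2 then 1 else 0) = S.pt h ∧ ∃ q : ℝ, 0 < q ∧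
        deriv (powerChart S.natDegree_pos (S.pt h)) (S.pt h) *
          deriv (δ (φ h).1) (if (φ h).2 then 1 else 0) =
          S.dir h * ((if (φ h).2 then -1 else 1) * q : ℝ) := by
  choose i b h1 h2 using fun h : {h : S.Flag // IsTerminal T (S.pt h)} => S.exists_arc_end hδ h.2
  refine ⟨fun h => (i h, b h), fun h h' heq => Subtype.ext ?_, fun h => ⟨h1 h, h2 h⟩⟩
  obtain ⟨hi, hb⟩ := Prod.ext_iff.1 heq
  simp only at hi hb
  have hpt : S.pt h = S.pt h' := by rw [← h1 h, ← h1 h', hi, hb]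
  obtain ⟨q, hq, hqe⟩ := h2 h
  obtain ⟨q', hq', hqe'⟩ := h2 h'
  rw [hi, hb, hpt, hqe'] at hqe
  refine S.flag_ext_of_pos hpt hq hq' ?_
  cases hbb : b h' <;> simp [hbb] at hqe
  · exact hqe.symm
  · exact hqe.symm

theorem ncard_terminal_le {μ : ℕ} {δ : Fin μ → ℝ → ℂ}
    (hδ : IsUnionOfArcs (inverseImageSegment T) δ) :
    {h : S.Flag | IsTerminal T (S.pt h)}.ncard ≤ 2 * μ := by
  obtain ⟨φ, hφ, -⟩ := S.exists_injective_arc_end hδ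
  have h := Nat.card_le_card_of_injective φ hφ
  rw [Nat.card_prod, Nat.card_fin, Nat.card_eq_fintype_card (α := Bool), Fintype.card_bool,
    mul_comm] at h
  exact h

variable {S}

/-- Two common points would be joined by a chain in each of the disjoint paths, closing a cycle. -/
theorem IsPath.subsingleton_inter {F F' : Finset S.Edge} {f g f' g' : S.Flag}
    (h : S.IsPath F f g) (h' : S.IsPath F' f' g') (hd : Disjoint F F') :
    ((⋃ e ∈ F, S.img e) ∩ ⋃ e ∈ F', S.img e).Subsingleton := by
  have key : ∀ y ∈ (⋃ e ∈ F, S.img e) ∩ ⋃ e ∈ F', S.img e,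
      ∃ k k' : S.Flag, k.1 ∈ F ∧ k'.1 ∈ F' ∧ S.pt k = y ∧ S.pt k' = y := by
    rintro y ⟨hy, hy'⟩
    obtain ⟨e, he, hye⟩ := mem_iUnion₂.1 hy
    obtain ⟨e', he', hye'⟩ := mem_iUnion₂.1 hy'
    have hne : e ≠ e' := fun h => Finset.disjoint_left.1 hd he (h ▸ he')
    obtain ⟨k, rfl, hk⟩ := S.exists_flags_of_mem_img hne hye hye'
    obtain ⟨k', rfl, hk'⟩ := S.exists_flags_of_mem_img hne.symm hye' hye
    exact ⟨k, k', he, he', hk, hk'⟩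
  intro y hy w hw
  obtain ⟨k, k', hk, hk', rfl, hky⟩ := key y hy
  obtain ⟨l, l', hl, hl', rfl, hlw⟩ := key w hw
  have h1 := h'.conn k' l' hk' hl'
  rw [hky, hlw] at h1
  exact (h.conn k l hk hl).eq_of_disjoint h1 hd

variable (S)

/-- The cardinality hypothesis supplies minimality: `μ` arcs have only `2 * μ` ends to accommodate
the terminal flags. -/
theorem exists_consistsOfArcs {ν : ℕ} {F : Fin ν → Finset S.Edge} {f g : Fin ν → S.Flag}
    (hp : ∀ i, S.IsPath (F i) (f i) (g i)) (hd : ∀ i j, i ≠ j → Disjoint (F i) (F j))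
    (hc : ∀ e, ∃ i, e ∈ F i) (hcard : {h : S.Flag | IsTerminal T (S.pt h)}.ncard = 2 * ν) :
    ∃ γ : Fin ν → ℝ → ℂ, ConsistsOfArcs (inverseImageSegment T) γ ∧
      ∀ i, γ i 0 = S.pt (f i) := by
  choose c L harc h0 hL himg using fun i => (hp i).arc
  have hset : ∀ i, arcSet (fun t => c i (L i * t)) = ⋃ e ∈ F i, S.img e := fun i =>
    (harc i).arcSet_scale.trans (himg i)
  refine ⟨fun i t => c i (L i * t), ⟨⟨fun i => (harc i).isAnalyticJordanArc, ?_⟩, ?_, ?_⟩, ?_⟩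
  · rw [← S.iUnion_img]
    simp only [hset]
    ext y
    simp only [mem_iUnion]
    constructor
    · rintro ⟨i, e, -, hy⟩
      exact ⟨e, hy⟩
    · rintro ⟨e, hy⟩
      obtain ⟨i, hi⟩ := hc e
      exact ⟨i, e, hi, hy⟩
  · intro i j hij
    rw [hset, hset]
    exact (hp i).subsingleton_inter (hp j) (hd i j hij)
  · rintro μ hμ ⟨δ, hδ⟩
    have := S.ncard_terminal_le hδ
    omega
  · intro i
    simp [h0]

end EdgeSystem

/-! ### Orders at the points where `T = ±1`, from Pell's equation -/

theorem rootMultiplicity_prod_X_sub_C {ι : Type*} [Fintype ι] {a : ι → ℂ}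
    (ha : Function.Injective a) (u : ℂ) :
    (∏ j, (X - C (a j))).rootMultiplicity u = if u ∈ Finset.univ.image a then 1 else 0 := by
  rw [← Finset.prod_image (g := a) (f := fun x => X - C x) (fun i _ j _ h => ha h), ← count_roots,
    roots_prod_X_sub_C, Multiset.count_eq_of_nodup (Finset.nodup _)]
  rfl

theorem rootMultiplicity_sq (U : ℂ[X]) (u : ℂ) :
    (U ^ 2).rootMultiplicity u = 2 * U.rootMultiplicity u := by
  rw [← count_roots, roots_pow, Multiset.count_nsmul, count_roots]

/-- The order of `T` at the points where `T = ±1`, for a solution of Pell's equation. -/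
theorem powerOrder_of_pell {n : ℕ} {T U : ℂ[X]} (hT : 0 < T.natDegree) (hn : n ≠ 0) {ι : Type*}
    [Fintype ι] {a : ι → ℂ} (ha : Function.Injective a)
    (hTU : T ^ 2 - 1 = (∏ j, (X - C (a j))) * U ^ 2) {zs : ℂ}
    (hzs : derivative T = C (n : ℂ) * (X - C zs) * U) {u : ℂ} (hu : T.eval u ^ 2 = 1) :
    powerOrder T u + (if u ∈ Finset.univ.image a then 1 else 0) =
      2 + 2 * (if u = zs then 1 else 0) := by
  set v := T.eval u
  have hv0 : v ≠ 0 := fun h => by simp [h] at hu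
  have hfac : T ^ 2 - 1 = (T - C v) * (T + C v) := by
    have : (1 : ℂ[X]) = C v * C v := by rw [← C_mul, ← sq, hu, C_1]
    rw [this]; ring
  have h1 : T - C v ≠ 0 := sub_C_ne_zero hT v
  have h2 : T + C v ≠ 0 := by
    have := sub_C_ne_zero hT (-v)
    rwa [C_neg, sub_neg_eq_add] at this
  have h12 := mul_ne_zero h1 h2
  have hHU : (∏ j, (X - C (a j))) * U ^ 2 ≠ 0 := by rwa [← hTU, hfac]
  -- `T + v` does not vanish at `u`, so `T - v` carries the whole multiplicity of `T² - 1`.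
  have hk : powerOrder T u = (if u ∈ Finset.univ.image a then 1 else 0) +
      2 * U.rootMultiplicity u := by
    have h3 : (T + C v).rootMultiplicity u = 0 := by
      refine rootMultiplicity_eq_zero fun h => hv0 ?_
      have h4 : T.eval u + v = 0 := by simpa using h
      change v + v = 0 at h4
      linear_combination h4 / 2
    have h4 := congrArg (rootMultiplicity u) (hfac.symm.trans hTU)
    rwa [rootMultiplicity_mul h12, rootMultiplicity_mul hHU, h3, add_zero,
      rootMultiplicity_prod_X_sub_C ha, rootMultiplicity_sq] at h4
  have hU : U ≠ 0 := fun h => hHU (by rw [h]; ring)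
  -- Differentiation lowers the multiplicity by one. Eliminating the multiplicity of `U` between
  -- this relation and the previous one gives the claim.
  have hd : powerOrder T u - 1 = (if u = zs then 1 else 0) + U.rootMultiplicity u := by
    have h5 := derivative_rootMultiplicity_of_root (p := T - C v) (t := u) (by simp [v])
    have hcn : C (n : ℂ) ≠ 0 := C_ne_zero.2 (by exact_mod_cast hn)
    rw [derivative_sub, derivative_C, sub_zero, hzs,
      rootMultiplicity_mul (mul_ne_zero (mul_ne_zero hcn (X_sub_C_ne_zero _)) hU),
      rootMultiplicity_mul (mul_ne_zero hcn (X_sub_C_ne_zero _)), rootMultiplicity_C,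
      rootMultiplicity_X_sub_C, zero_add] at h5
    exact h5.symm
  have hpos := powerOrder_pos hT u
  omega

theorem isTerminal_iff_of_pell {n : ℕ} {T U : ℂ[X]} (hT : 0 < T.natDegree) (hn : n ≠ 0) {ι : Type*}
    [Fintype ι] {a : ι → ℂ} (ha : Function.Injective a)
    (hTU : T ^ 2 - 1 = (∏ j, (X - C (a j))) * U ^ 2) {zs : ℂ}
    (hzs : derivative T = C (n : ℂ) * (X - C zs) * U) {u : ℂ} :
    IsTerminal T u ↔ u ∈ Finset.univ.image a := by
  constructor
  · rintro ⟨h1, h2⟩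
    by_contra h
    have h3 := powerOrder_of_pell hT hn ha hTU hzs h1
    rw [if_neg h, add_zero] at h3
    rw [h3] at h2
    exact absurd h2 (Nat.not_odd_iff_even.2 ((even_two).add (even_two_mul _)))
  · intro h
    have hval : T.eval u ^ 2 = 1 := by
      obtain ⟨j, -, rfl⟩ := Finset.mem_image.1 h
      have h1 := congrArg (eval (a j)) hTU
      rw [eval_mul, eval_prod, Finset.prod_eq_zero (Finset.mem_univ j) (by simp), zero_mul] at h1
      simp only [eval_sub, eval_pow, eval_one] at h1
      exact sub_eq_zero.1 h1
    refine ⟨hval, ?_⟩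
    have h3 := powerOrder_of_pell hT hn ha hTU hzs hval
    rw [if_pos h] at h3
    have h4 : powerOrder T u = 2 * (if u = zs then 1 else 0) + 1 := by omega
    rw [h4]
    exact odd_two_mul_add_one _

/-- A critical point other than `zs` is a zero of `U`, where `T² = 1`. So it is enough to cut at the
value at `zs` if this lies in `(-1, 1)`, and anywhere, say at `0`, otherwise. -/
theorem exists_edgeSystem_of_pell {n : ℕ} {T U : ℂ[X]} (hT : 0 < T.natDegree) (hn : n ≠ 0) {H : ℂ[X]}
    (hTU : T ^ 2 - 1 = H * U ^ 2) {zs : ℂ} (hzs : derivative T = C (n : ℂ) * (X - C zs) * U) :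
    ∃ τ, Nonempty (EdgeSystem T τ) := by
  have hcrit : ∀ x ∈ Ioo (-1 : ℝ) 1, ∀ z, T.eval z = (x : ℂ) → z ≠ zs →
      T.derivative.eval z ≠ 0 := fun x hx z hz hne h => by
    rw [hzs] at h
    simp only [eval_mul, eval_C, eval_sub, eval_X, mul_eq_zero, Nat.cast_eq_zero, hn, false_or,
      sub_eq_zero, hne] at h
    have h1 := congrArg (eval z) hTU
    simp only [eval_sub, eval_pow, eval_one, eval_mul, h, hz] at h1
    have h2 : x ^ 2 = 1 := by
      have h3 : (x : ℂ) ^ 2 = 1 := by linear_combination h1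
      exact_mod_cast h3
    rcases sq_eq_one_iff.1 h2 with h3 | h3
    · exact hx.2.ne h3
    · exact hx.1.ne' h3
  by_cases hz : ∃ x ∈ Ioo (-1 : ℝ) 1, T.eval zs = (x : ℂ)
  · obtain ⟨τ, hτ, hτz⟩ := hz
    refine ⟨τ, nonempty_edgeSystem hT hτ fun b x hx z hzx => ?_⟩
    have hne : z ≠ zs := by
      rintro rfl
      obtain rfl : x = τ := by exact_mod_cast hzx.symm.trans hτz
      cases b
      · exact lt_irrefl _ hx.2
      · exact lt_irrefl _ hx.1
    refine hcrit x ?_ z hzx hne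
    cases b
    · exact ⟨hx.1, hx.2.trans hτ.2⟩
    · exact ⟨hτ.1.trans hx.1, hx.2⟩
  · have hτ : (0 : ℝ) ∈ Ioo (-1 : ℝ) 1 := by constructor <;> norm_num
    refine ⟨0, nonempty_edgeSystem hT hτ fun b x hx z hzx => ?_⟩
    have hx' : x ∈ Ioo (-1 : ℝ) 1 := by
      cases b
      · exact ⟨hx.1, hx.2.trans hτ.2⟩
      · exact ⟨hτ.1.trans hx.1, hx.2⟩
    refine hcrit x hx' z hzx ?_
    rintro rfl
    exact hz ⟨x, hx', hzx⟩

/-! ### Counting flags, and the three-arc case -/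

theorem Complex.ncard_pow_eq {k : ℕ} (hk : 0 < k) {σ : ℂ} (hσ : σ ≠ 0) :
    {ω : ℂ | ω ^ k = σ}.ncard = k := by
  have hprim := Complex.isPrimitiveRoot_exp k hk.ne'
  obtain ⟨ω₀, hω₀⟩ := IsAlgClosed.exists_pow_nat_eq σ hk
  have hset : {ω : ℂ | ω ^ k = σ} = ((nthRoots k σ).toFinset : Set ℂ) := by
    ext ω
    simp [mem_nthRoots hk]
  rw [hset, ncard_coe_finset, Multiset.toFinset_card_of_nodup (hprim.nthRoots_nodup hσ),
    hprim.card_nthRoots, if_pos ⟨ω₀, hω₀⟩]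

/-- Distinct cube roots of the same number enclose the angle `2π/3`. -/
theorem Complex.angle_of_pow_three_eq {x y : ℂ} (hy : y ≠ 0) (hxy : x ≠ y) (h : x ^ 3 = y ^ 3) :
    InnerProductGeometry.angle x y = 2 * Real.pi / 3 := by
  have hx : x ≠ 0 := fun hx => hy (by simpa [hx] using h.symm)
  rw [Complex.angle_eq_abs_arg hx hy]
  set ζ := x / y with hζ
  have hζ0 : ζ ≠ 0 := div_ne_zero hx hy
  have h3 : ζ ^ 3 = 1 := by rw [hζ, div_pow, h, div_self (pow_ne_zero _ hy)]
  have h1 : ζ ≠ 1 := fun h1 => hxy ((div_eq_one_iff_eq hy).1 h1)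
  have h2 : ζ ^ 2 + ζ + 1 = 0 := by
    have : (ζ - 1) * (ζ ^ 2 + ζ + 1) = 0 := by linear_combination h3
    exact (mul_eq_zero.1 this).resolve_left (sub_ne_zero.2 h1)
  have hre := congrArg Complex.re h2
  have him := congrArg Complex.im h2
  simp only [sq, Complex.add_re, Complex.mul_re, Complex.one_re, Complex.zero_re, Complex.add_im,
    Complex.mul_im, Complex.one_im, Complex.zero_im] at hre him
  have hhalf : ζ.re = -1 / 2 := by
    have : ζ.im * (2 * ζ.re + 1) = 0 := by linarith
    rcases mul_eq_zero.1 this with h0 | h0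
    · rw [h0] at hre
      nlinarith [sq_nonneg (2 * ζ.re + 1)]
    · linarith
  have hnorm : ‖ζ‖ = 1 :=
    (pow_eq_one_iff_of_nonneg (norm_nonneg _) three_ne_zero).1 (by rw [← norm_pow, h3, norm_one])
  have hpi := Real.pi_pos
  refine Real.injOn_cos ⟨abs_nonneg _, Complex.abs_arg_le_pi _⟩ ⟨by positivity, by linarith⟩ ?_
  rw [Real.cos_abs, Complex.cos_arg hζ0, hnorm, hhalf,
    show 2 * Real.pi / 3 = Real.pi - Real.pi / 3 by ring, Real.cos_pi_sub, Real.cos_pi_div_three]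
  norm_num

namespace EdgeSystem

variable {T : ℂ[X]} {τ : ℝ} (S : EdgeSystem T τ)

theorem sgn_eq_neg_eval {u : ℂ} (hu : T.eval u ^ 2 = 1) {h : S.Flag} (hh : S.pt h = u) :
    (S.sgn h : ℂ) = -T.eval u := by
  subst hh
  rw [S.sgn_eq_neg_base hu, S.eval_pt]
  push_cast
  rfl

/-- Where `T = ±1` edges leave only towards the inside of `[-1, 1]`, so their directions are exactly
the roots of `ω ^ k = -T u`. -/
theorem ncard_flags {u : ℂ} (hu : T.eval u ^ 2 = 1) :
    {h : S.Flag | S.pt h = u}.ncard = powerOrder T u := by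
  have hσ : -T.eval u ≠ 0 := neg_ne_zero.2 fun h => by simp [h] at hu
  rw [← Complex.ncard_pow_eq (powerOrder_pos S.natDegree_pos u) hσ]
  refine ncard_congr (fun h _ => S.dir h) ?_ ?_ ?_
  · rintro h rfl
    rw [mem_ofPred_eq, ← S.sgn_eq_neg_eval hu rfl]
    exact S.dir_pow h
  · intro h h' hh hh' hdir
    exact S.flag_ext (Eq.trans hh (Eq.symm hh')) hdir
  · intro ω hω
    rw [mem_ofPred_eq] at hω
    rcases sq_eq_one_iff.1 hu with h1 | h1
    · obtain ⟨f, -, -, h2, h3⟩ := S.exists_flag (u := u) (b := true) (e := true) (ω := ω)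
        (by simp [segHi, h1]) (by simp [hω, h1])
      exact ⟨f, h2, h3⟩
    · obtain ⟨f, -, -, h2, h3⟩ := S.exists_flag (u := u) (b := false) (e := false) (ω := ω)
        (by simp [segLo, h1]) (by simp [hω, h1])
      exact ⟨f, h2, h3⟩

theorem ncard_terminal {A : Finset ℂ} (hA : ∀ u, IsTerminal T u ↔ u ∈ A) :
    {h : S.Flag | IsTerminal T (S.pt h)}.ncard = ∑ u ∈ A, powerOrder T u := by
  classical
  have hset : {h : S.Flag | IsTerminal T (S.pt h)} =
      (Finset.univ.filter fun h : S.Flag => S.pt h ∈ A : Finset S.Flag) := by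
    ext h
    simp [hA]
  rw [hset, ncard_coe_finset, Finset.card_eq_sum_card_fiberwise (f := S.pt) (t := A)
    (fun h hh => by simpa using hh)]
  refine Finset.sum_congr rfl fun u hu => ?_
  rw [← S.ncard_flags ((hA u).2 hu).1, ← ncard_coe_finset]
  congr 1
  ext h
  simp only [Finset.coe_filter, Finset.mem_filter, Finset.mem_univ, true_and, mem_ofPred_eq]
  exact ⟨fun h1 => h1.2, fun h1 => ⟨h1 ▸ hu, h1⟩⟩

/-- If there are six terminal flags, and three of them sit at `u`, then the inverse image consists
of three arcs starting at `u` at equal angles. -/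
theorem exists_tripod {u : ℂ} (hu : IsTerminal T u) (h3 : powerOrder T u = 3)
    (h6 : {h : S.Flag | IsTerminal T (S.pt h)}.ncard = 6) :
    ∃ γ : Fin 3 → ℝ → ℂ, ConsistsOfArcs (inverseImageSegment T) γ ∧ (∀ i, γ i 0 = u) ∧
      ∀ i j, i ≠ j →
        InnerProductGeometry.angle (deriv (γ i) 0) (deriv (γ j) 0) = 2 * Real.pi / 3 := by
  classical
  obtain ⟨ν, F, f, g, hp, hf, hg, -, hd, hc, hcard⟩ := S.exists_decomposition Finset.univ
    (fun _ _ _ _ _ _ => Finset.mem_univ _)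
  simp only [Finset.mem_univ, true_and, true_implies] at hcard hc
  obtain rfl : ν = 3 := by omega
  -- A flag at a terminal point is an end of its path. No path has both ends at `u`, so the three
  -- flags at `u` belong to three different paths, which can all be oriented to start at `u`.
  have hmem : ∀ h : {h : S.Flag // S.pt h = u}, ∃ i, h.1 = f i ∨ h.1 = g i := fun ⟨h, hh⟩ => by
    obtain ⟨i, hi⟩ := hc h.1
    refine ⟨i, ?_⟩
    by_contra! hcon
    exact ((hp i).closed h hi hcon.1 hcon.2).1 (hh ▸ hu)
  choose m hm using hmem
  have hminj : Function.Injective m := fun ⟨h, hh⟩ ⟨h', hh'⟩ heq => by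
    have h1 := hm ⟨h, hh⟩
    have h2 := hm ⟨h', hh'⟩
    rw [← heq] at h2
    simp only at h1 h2
    have hpt := hh.trans hh'.symm
    rw [Subtype.mk.injEq]
    rcases h1 with h1 | h1 <;> rcases h2 with h2 | h2 <;> rw [h1, h2] at hpt ⊢
    · exact absurd hpt (hp _).ne
    · exact absurd hpt.symm (hp _).ne
  have hcard3 : Nat.card {h : S.Flag // S.pt h = u} = 3 := (S.ncard_flags hu.1).trans h3
  have hmsurj : Function.Surjective m :=
    ((Nat.bijective_iff_injective_and_card m).2 ⟨hminj, by rw [hcard3, Nat.card_fin]⟩).2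
  have hor : ∀ i, ∃ f' g', S.IsPath (F i) f' g' ∧ S.pt f' = u := fun i => by
    obtain ⟨⟨h, hh⟩, rfl⟩ := hmsurj i
    rcases hm ⟨h, hh⟩ with h1 | h1
    · exact ⟨_, _, hp _, h1 ▸ hh⟩
    · exact ⟨_, _, (hp _).reverse, h1 ▸ hh⟩
  choose f' g' hp' hf' using hor
  obtain ⟨γ, hγ, hγ0⟩ := S.exists_consistsOfArcs hp' hd hc h6
  refine ⟨γ, hγ, fun i => (hγ0 i).trans (hf' i), fun i j hij => ?_⟩
  obtain ⟨φ, hφ, hφe⟩ := S.exists_injective_arc_end hγ.isUnion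
  -- Six terminal flags inject into the six ends of three arcs. Hence every initial end comes from a
  -- flag, and its tangent is a positive multiple of that flag's direction divided by the derivative
  -- of the chart.
  have hφs : Function.Surjective φ := ((Nat.bijective_iff_injective_and_card φ).2 ⟨hφ, by
    rw [Nat.card_prod, Nat.card_fin, Nat.card_eq_fintype_card (α := Bool), Fintype.card_bool]
    exact h6⟩).2
  have key : ∀ i, ∃ h : {h : S.Flag // IsTerminal T (S.pt h)}, φ h = (i, false) ∧ S.pt h = u ∧
      ∃ q : ℝ, 0 < q ∧
        deriv (powerChart S.natDegree_pos u) u * deriv (γ i) 0 = S.dir h * (q : ℝ) := fun i => by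
    obtain ⟨h, hh⟩ := hφs (i, false)
    obtain ⟨h1, q, hq, h2⟩ := hφe h
    simp only [hh, Bool.false_eq_true, if_false, one_mul] at h1 h2
    have hpt : S.pt h = u := by rw [← h1, hγ0, hf']
    rw [hpt] at h2
    exact ⟨h, hh, hpt, q, hq, h2⟩
  have hψ := deriv_powerChart_ne S.natDegree_pos u
  obtain ⟨h, hh, hpt, q, hq, hdir⟩ := key i
  obtain ⟨h', hh', hpt', q', hq', hdir'⟩ := key j
  set d := deriv (powerChart S.natDegree_pos u) u
  have e1 : deriv (γ i) 0 = q • (S.dir h / d) := by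
    rw [Complex.real_smul]
    field_simp
    linear_combination hdir
  have e2 : deriv (γ j) 0 = q' • (S.dir h' / d) := by
    rw [Complex.real_smul]
    field_simp
    linear_combination hdir'
  rw [e1, e2, InnerProductGeometry.angle_smul_left_of_pos _ _ hq,
    InnerProductGeometry.angle_smul_right_of_pos _ _ hq']
  refine Complex.angle_of_pow_three_eq (div_ne_zero (S.dir_ne_zero _) hψ) (fun heq => hij ?_) ?_
  · have h1 : S.dir h = S.dir h' := (div_left_inj' hψ).1 heq
    have h2 : h = h' := Subtype.ext (S.flag_ext (hpt.trans hpt'.symm) h1)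
    rw [h2, hh'] at hh
    exact (Prod.ext_iff.1 hh).1.symm
  · have e3 := S.dir_pow h
    have e4 := S.dir_pow h'
    rw [S.sgn_eq_neg_eval hu.1 hpt, ord, hpt, h3] at e3
    rw [S.sgn_eq_neg_eval hu.1 hpt', ord, hpt', h3] at e4
    rw [div_pow, div_pow, e3, e4]

end EdgeSystem

end

/-! ### The two cases -/

theorem theorem3 (n : ℕ) (hn : 2 ≤ n) (T U : ℂ[X]) (hT : T.natDegree = n)
    (hU : U.natDegree = n - 2) (a : Fin 4 → ℂ) (ha : Function.Injective a)
    (hTU : T ^ 2 - 1 = (∏ j, (X - C (a j))) * U ^ 2)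
    (zs : ℂ) (hzs : derivative T = C (n : ℂ) * (X - C zs) * U) :
    (zs ∉ Set.range a →
      ∃ γ : Fin 2 → ℝ → ℂ, ConsistsOfArcs (inverseImageSegment T) γ) ∧
    (zs ∈ Set.range a →
      ∃ γ : Fin 3 → ℝ → ℂ, ConsistsOfArcs (inverseImageSegment T) γ ∧
        (∀ i, γ i 0 = zs) ∧
        ∀ i j, i ≠ j →
          InnerProductGeometry.angle (deriv (γ i) 0) (deriv (γ j) 0) = 2 * Real.pi / 3) := by
  have hT0 : 0 < T.natDegree := by omega
  have hn0 : n ≠ 0 := by omega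
  obtain ⟨τ, ⟨S⟩⟩ := exists_edgeSystem_of_pell hT0 hn0 hTU hzs
  have hA : ∀ u, IsTerminal T u ↔ u ∈ Finset.univ.image a := fun u =>
    isTerminal_iff_of_pell hT0 hn0 ha hTU hzs
  have hord : ∀ u ∈ Finset.univ.image a, powerOrder T u = 1 + if u = zs then 2 else 0 :=
    fun u hu => by
    have h1 := powerOrder_of_pell hT0 hn0 ha hTU hzs ((hA u).2 hu).1
    rw [if_pos hu] at h1
    split_ifs at h1 ⊢ <;> omega
  -- Each of the four points contributes 1, and `zs` contributes 2 more if it is among them.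
  have hcard := S.ncard_terminal hA
  rw [Finset.sum_congr rfl hord, Finset.sum_add_distrib, Finset.sum_ite_eq', Finset.sum_const,
    Finset.card_image_of_injective _ ha, Finset.card_univ, Fintype.card_fin] at hcard
  have hzmem : zs ∈ Finset.univ.image a ↔ zs ∈ Set.range a := by simp
  refine ⟨fun hz => ?_, fun hz => ?_⟩
  · rw [if_neg (mt hzmem.1 hz)] at hcard
    obtain ⟨ν, F, f, g, hp, -, -, -, hd, hc, hcard'⟩ := S.exists_decomposition Finset.univ
      (fun _ _ _ _ _ _ => Finset.mem_univ _)
    simp only [Finset.mem_univ, true_and, true_implies] at hcard' hc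
    obtain rfl : ν = 2 := by
      rw [hcard] at hcard'
      norm_num at hcard'
      omega
    obtain ⟨γ, hγ, -⟩ := S.exists_consistsOfArcs hp hd hc hcard'
    exact ⟨γ, hγ⟩
  · rw [if_pos (hzmem.2 hz)] at hcard
    exact S.exists_tripod ((hA zs).2 (hzmem.2 hz)) (by simpa using hord zs (hzmem.2 hz))
      (by simpa using hcard)
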